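/- Work over $\mathbb{C}$. Let $B$ be a smooth (integral, separated, finite type) variety, $\mathscr{L}$ a line bundle on $B$, and $a_2\in H^0(B,\mathscr{L}^{\otimes 2})$, $a_4\in H^0(B,\mathscr{L}^{\otimes 4})$ sections such that $V(a_2)$ and $V(a_4)$ are smooth and irreducible, have non-empty intersection, and meet transversally at every point of it. Let $$Y_0:\quad y^2z=x(x^2+a_2xz+a_4z^2)$$ be the corresponding Weierstrass model over $B$, with discriminant $\Delta=16a_4^2(a_2^2-4a_4)$, $c_4=16(a_2^2-3a_4)$ and $c_6=-32a_2(2a_2^2-9a_4)$. Let $\varphi:Y\to B$ be its proper transform under the blowup of the ambient $\mathbb{P}^2$-bundle along $x=y=0$, i.e. with $(x,y)=(e_1x_1,e_1y_1)$, $$Y:\quad e_1y_1^2z=x_1(e_1^2x_1^2+e_1a_2x_1z+a_4z^2),$$ and assume that $Y$ is nonsingular, so that $Y$ is a resolution of $Y_0$ (an SO(3)-model). Then: 1. The reduced discriminant is the divisor $a_4(4a_4-a_2^2)=0$: the radical of the ideal $(\Delta)$ is generated by $a_4(4a_4-a_2^2)$. Both $V(a_4)$ and $V(4a_4-a_2^2)$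 are smooth divisors (effective Cartier divisors, smooth over $\mathbb{C}$). 2. $V(a_4)\cap V(4a_4-a_2^2)=V(a_2,a_4)$; this is the cuspidal locus $V(c_4,c_6)$, and the two divisors are not transverse at any point of it. 3. For a point $p$ of $B$ with residue field $\kappa(p)$, let $Y_p$ be the scheme-theoretic fiber of $\varphi$. * If $p\notin V(\Delta)$, then $Y_p$ is smooth over $\kappa(p)$. If $p\in V(a_4)\setminus V(a_2)$, then $Y_p$ is of type $\mathrm{I}_2$: two copies of $\mathbb{P}^1_{\kappa(p)}$ meeting in a scheme that is étale of degree 2 over $\kappa(p)$. If $p\in V(4a_4-a_2^2)\setminus V(a_2)$, then $Y_p$ is of type $\mathrm{I}_1$ (a nodal plane cubic). If $p\in V(a_2,a_4)$ (in particular, if $p$ is a generic point of $V(a_2,a_4)$), then $Y_p$ is of type $\mathrm{III}$: two copies of $\mathbb{P}^1_{\kappa(p)}$ whose intersection is a double point $\operatorname{Spec}\kappa(p)[\varepsilon]/(\varepsilon^2)$. * The fiber over the generic point $\eta$ of $V(a_4)$ is of type $\mathrm{I}_2^{\mathrm{ns}}$: two copies of $\mathbb{P}^1_{\kappa(\eta)}$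 meeting transversally along $\operatorname{Spec}K$ with $K/\kappa(\eta)$ a quadratic field extension. * The fiber over the generic point of every irreducible component of $V(4a_4-a_2^2)$ is of type $\mathrm{I}_1$. -/

import Mathlib

open CategoryTheory CategoryTheory.Limits AlgebraicGeometry

universe u

namespace SO3

noncomputable section

section Gluing

variable {A B : Type u} [CommRing A] [CommRing B]

/-- If `f : B → A[1/a]` and `g : A → B[1/b]` extend to mutually inverse maps between `B[1/b]` and
`A[1/a]`, then `Spec A[1/a] ⟶ Spec B` is an open immersion (with image `D(b)`). -/
theorem isOpenImmersion_of_inverse (a : A) (b : B)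
    (f : B →+* Localization.Away a) (g : A →+* Localization.Away b)
    (hf : IsUnit (f b)) (hg : IsUnit (g a))
    (h₁ : (Localization.awayLift g a hg).comp f = algebraMap B _)
    (h₂ : (Localization.awayLift f b hf).comp g = algebraMap A _) :
    IsOpenImmersion (Spec.map (CommRingCat.ofHom f)) := by
  have hF : (Localization.awayLift f b hf).comp (algebraMap B _) = f := by
    ext x; simp [Localization.awayLift]
  have hG : (Localization.awayLift g a hg).comp (algebraMap A _) = g := by
    ext x; simp [Localization.awayLift]
  let e : Localization.Away b ≃+* Localization.Away a :=
    RingEquiv.ofRingHom (Localization.awayLift f b hf) (Localization.awayLift g a hg)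
      (IsLocalization.ringHom_ext (Submonoid.powers a) (by
        rw [RingHom.comp_assoc, hG, h₂, RingHom.id_comp]))
      (IsLocalization.ringHom_ext (Submonoid.powers b) (by
        rw [RingHom.comp_assoc, hF, h₁, RingHom.id_comp]))
  have : CommRingCat.ofHom f =
      CommRingCat.ofHom (algebraMap B (Localization.Away b)) ≫ e.toCommRingCatIso.hom := by
    ext x
    exact (DFunLike.congr_fun hF x).symm
  rw [this, Spec.map_comp]
  infer_instance

end Gluing

theorem isOpenImmersion_inl {X Y Z : Scheme.{u}} (f : X ⟶ Y) (g : X ⟶ Z)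
    [IsOpenImmersion f] [IsOpenImmersion g] : IsOpenImmersion (pushout.inl f g) :=
  inferInstanceAs (IsOpenImmersion (colimit.ι (span f g) WalkingSpan.left))

section PlaneCharts

open Polynomial

variable {R : Type u} [CommRing R]

/-- The coordinate ring `R[u, v] / (p(u, v))` of an affine plane chart.  A polynomial
`p : R[X][X]` is a polynomial in the second coordinate `v` with coefficients in `R[u]`. -/
abbrev PlaneRing (p : R[X][X]) : Type u := AdjoinRoot p

/-- The first coordinate `u`. -/
def fstCoord (p : R[X][X]) : PlaneRing p := AdjoinRoot.of p X

/-- The second coordinate `v`. -/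
def sndCoord (p : R[X][X]) : PlaneRing p := AdjoinRoot.root p

/-- The map of `R`-algebras `R[u, v] / (p) → S` with prescribed values of `u` and `v`. -/
def planeLift {S : Type u} [CommRing S] [Algebra R S] (p : R[X][X]) (u v : S)
    (h : p.eval₂ (eval₂RingHom (algebraMap R S) u) v = 0) : PlaneRing p →+* S :=
  AdjoinRoot.lift (eval₂RingHom (algebraMap R S) u) v h

section

variable {S : Type u} [CommRing S] [Algebra R S] (p : R[X][X]) (u v : S)
  (h : p.eval₂ (eval₂RingHom (algebraMap R S) u) v = 0)

@[simp] theorem planeLift_fst : planeLift p u v h (fstCoord p) = u := by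
  simp [planeLift, fstCoord]

@[simp] theorem planeLift_snd : planeLift p u v h (sndCoord p) = v := by
  simp [planeLift, sndCoord]

@[simp] theorem planeLift_algebraMap (r : R) :
    planeLift p u v h (algebraMap R _ r) = algebraMap R S r := by
  rw [AdjoinRoot.algebraMap_eq', RingHom.comp_apply]
  simp [planeLift]

theorem planeRing_hom_ext {T : Type u} [CommRing T] {p : R[X][X]} {f g : PlaneRing p →+* T}
    (h₀ : ∀ r : R, f (algebraMap R _ r) = g (algebraMap R _ r))
    (h₁ : f (fstCoord p) = g (fstCoord p)) (h₂ : f (sndCoord p) = g (sndCoord p)) : f = g := by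
  refine AdjoinRoot.ringHom_ext (Polynomial.ringHom_ext (fun r => ?_) h₁) h₂
  have := h₀ r
  rw [AdjoinRoot.algebraMap_eq', RingHom.comp_apply] at this
  exact this

end

/-- The affine plane chart `Spec R[u, v] / (p)`. -/
abbrev planeChart (p : R[X][X]) : Scheme.{u} := Spec (CommRingCat.of (PlaneRing p))

/-- The structure morphism of `Spec R[u, v] / (p)` over `Spec R`. -/
def planeChartToBase (p : R[X][X]) : planeChart p ⟶ Spec (CommRingCat.of R) :=
  Spec.map (CommRingCat.ofHom (algebraMap R (PlaneRing p)))

end PlaneCharts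

section Transition

open Polynomial

variable {R : Type u} [CommRing R]

theorem planeRel (p : R[X][X]) :
    p.eval₂ (eval₂RingHom (algebraMap R (PlaneRing p)) (fstCoord p)) (sndCoord p) = 0 := by
  have h : eval₂RingHom (algebraMap R (PlaneRing p)) (fstCoord p) = AdjoinRoot.of p := by
    refine Polynomial.ringHom_ext (fun r => ?_) ?_
    · simp [AdjoinRoot.algebraMap_eq']
    · simp [fstCoord]
  rw [h]
  exact AdjoinRoot.eval₂_root p

/-- The image of `b` in `A[1/a]`. -/
abbrev loc {A : Type u} [CommRing A] (a b : A) : Localization.Away a := algebraMap A _ b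

/-- The element `1/a` of `A[1/a]`. -/
abbrev invCoord {A : Type u} [CommRing A] (a : A) : Localization.Away a :=
  IsLocalization.Away.invSelf a

theorem invCoord_mul {A : Type u} [CommRing A] (a : A) : loc a a * invCoord a = 1 :=
  IsLocalization.Away.mul_invSelf a

theorem locRel {p : R[X][X]} (a : PlaneRing p) :
    p.eval₂ (eval₂RingHom (algebraMap R (Localization.Away a)) (loc a (fstCoord p)))
      (loc a (sndCoord p)) = 0 := by
  have := congrArg (algebraMap (PlaneRing p) (Localization.Away a)) (planeRel p)
  rw [Polynomial.hom_eval₂, map_zero] at this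
  rw [← this]
  congr 1
  refine Polynomial.ringHom_ext (fun r => ?_) ?_
  · simp [IsScalarTower.algebraMap_apply R (PlaneRing p) (Localization.Away a)]
  · simp

theorem awayLift_loc {A S : Type u} [CommRing A] [CommRing S] (a : A) (g : A →+* S)
    (hg : IsUnit (g a)) (b : A) : Localization.awayLift g a hg (loc a b) = g b := by
  simp [Localization.awayLift, loc]

theorem awayLift_inv {A S : Type u} [CommRing A] [CommRing S] (a : A) (g : A →+* S)
    (hg : IsUnit (g a)) (s : S) (hs : g a * s = 1) :
    Localization.awayLift g a hg (invCoord a) = s := by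
  have h := congrArg (Localization.awayLift g a hg) (invCoord_mul a)
  rw [map_mul, awayLift_loc, map_one] at h
  exact hg.mul_left_cancel (h.trans hs.symm)

/-- A criterion for two plane charts `R[u, v] / (p)` and `R[u', v'] / (q)` to be glued along
`D(a)` and `D(b)` by mutually inverse coordinate changes. -/
theorem isOpenImmersion_plane {p q : R[X][X]} (a : PlaneRing p) (b : PlaneRing q)
    (f : PlaneRing q →+* Localization.Away a) (g : PlaneRing p →+* Localization.Away b)
    (hf : ∀ r : R, f (algebraMap R _ r) = algebraMap R _ r)
    (hg : ∀ r : R, g (algebraMap R _ r) = algebraMap R _ r)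
    (b' : Localization.Away a) (hb : f b * b' = 1)
    (a' : Localization.Away b) (ha : g a * a' = 1)
    (H₁ : ∀ F : Localization.Away a →+* Localization.Away b, (∀ x, F (loc a x) = g x) →
      F (invCoord a) = a' →
        F (f (fstCoord q)) = loc b (fstCoord q) ∧ F (f (sndCoord q)) = loc b (sndCoord q))
    (H₂ : ∀ G : Localization.Away b →+* Localization.Away a, (∀ x, G (loc b x) = f x) →
      G (invCoord b) = b' →
        G (g (fstCoord p)) = loc a (fstCoord p) ∧ G (g (sndCoord p)) = loc a (sndCoord p)) :
    IsOpenImmersion (Spec.map (CommRingCat.ofHom f)) := by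
  have uf : IsUnit (f b) := IsUnit.of_mul_eq_one _ hb
  have ug : IsUnit (g a) := IsUnit.of_mul_eq_one _ ha
  refine isOpenImmersion_of_inverse a b f g uf ug ?_ ?_
  · obtain ⟨h, h'⟩ := H₁ _ (awayLift_loc a g ug) (awayLift_inv a g ug a' ha)
    refine planeRing_hom_ext (fun r => ?_) h h'
    rw [RingHom.comp_apply, hf, IsScalarTower.algebraMap_apply R (PlaneRing p),
      awayLift_loc, hg, IsScalarTower.algebraMap_apply R (PlaneRing q)]
  · obtain ⟨h, h'⟩ := H₂ _ (awayLift_loc b f uf) (awayLift_inv b f uf b' hb)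
    refine planeRing_hom_ext (fun r => ?_) h h'
    rw [RingHom.comp_apply, hg, IsScalarTower.algebraMap_apply R (PlaneRing q),
      awayLift_loc, hf, IsScalarTower.algebraMap_apply R (PlaneRing p)]

end Transition

section WeierstrassModel

open Polynomial

variable {R : Type u} [CommRing R] (a₂ a₄ : R)

/-- The chart `z = 1` of `y²z = x(x² + a₂xz + a₄z²)`, with coordinates `(u, v) = (x, y)`. -/
def chartXY : R[X][X] := X ^ 2 - C X * ((C X) ^ 2 + C (C a₂) * C X + C (C a₄))

/-- The chart `y = 1` of `y²z = x(x² + a₂xz + a₄z²)`, with coordinates `(u, v) = (x, z)`. -/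
def chartXZ : R[X][X] := X - C X * ((C X) ^ 2 + C (C a₂) * C X * X + C (C a₄) * X ^ 2)

section

variable {S : Type u} [CommRing S] [Algebra R S] (u v : S)

theorem eval_chartXY : (chartXY a₂ a₄).eval₂ (eval₂RingHom (algebraMap R S) u) v =
    v ^ 2 - u * (u ^ 2 + algebraMap R S a₂ * u + algebraMap R S a₄) := by
  simp [chartXY, -map_pow, eval₂_mul, eval₂_pow]

theorem eval_chartXZ : (chartXZ a₂ a₄).eval₂ (eval₂RingHom (algebraMap R S) u) v =
    v - u * (u ^ 2 + algebraMap R S a₂ * u * v + algebraMap R S a₄ * v ^ 2) := by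
  simp [chartXZ, -map_pow, eval₂_mul, eval₂_pow]

end

/-- The coordinate change `(x, z) = (x / y, 1 / y)`. -/
def xzToXY : PlaneRing (chartXZ a₂ a₄) →+* Localization.Away (sndCoord (chartXY a₂ a₄)) :=
  planeLift _ (loc _ (fstCoord (chartXY a₂ a₄)) * invCoord _) (invCoord _) (by
    have h := locRel (sndCoord (chartXY a₂ a₄))
    have i := invCoord_mul (sndCoord (chartXY a₂ a₄))
    rw [eval_chartXY] at h
    rw [eval_chartXZ]
    set y := loc (sndCoord (chartXY a₂ a₄)) (sndCoord (chartXY a₂ a₄))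
    set w := invCoord (sndCoord (chartXY a₂ a₄))
    linear_combination w ^ 3 * h - (w ^ 2 * y + w) * i)

/-- The coordinate change `(x, y) = (x / z, 1 / z)`. -/
def xyToXZ : PlaneRing (chartXY a₂ a₄) →+* Localization.Away (sndCoord (chartXZ a₂ a₄)) :=
  planeLift _ (loc _ (fstCoord (chartXZ a₂ a₄)) * invCoord _) (invCoord _) (by
    have h := locRel (sndCoord (chartXZ a₂ a₄))
    have i := invCoord_mul (sndCoord (chartXZ a₂ a₄))
    rw [eval_chartXZ] at h
    rw [eval_chartXY]
    set x := loc (sndCoord (chartXZ a₂ a₄)) (fstCoord (chartXZ a₂ a₄))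
    set z := loc (sndCoord (chartXZ a₂ a₄)) (sndCoord (chartXZ a₂ a₄))
    set w := invCoord (sndCoord (chartXZ a₂ a₄))
    linear_combination w ^ 3 * h + (- w ^ 2 + algebraMap R _ a₂ * x ^ 2 * w ^ 2 +
      algebraMap R _ a₄ * x * (w ^ 2 * z + w)) * i)

instance isOpenImmersion_xzToXY :
    IsOpenImmersion (Spec.map (CommRingCat.ofHom (xzToXY a₂ a₄))) := by
  have i := invCoord_mul (sndCoord (chartXY a₂ a₄))
  have j := invCoord_mul (sndCoord (chartXZ a₂ a₄))
  refine isOpenImmersion_plane _ (sndCoord _) _ (xyToXZ a₂ a₄) (planeLift_algebraMap _ _ _ _)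
    (planeLift_algebraMap _ _ _ _) (loc _ (sndCoord _)) ?_ (loc _ (sndCoord _)) ?_ ?_ ?_
  · simpa [xzToXY, mul_comm] using i
  · simpa [xyToXZ, mul_comm] using j
  · intro F hF hF'
    simp only [xzToXY, planeLift_fst, planeLift_snd, map_mul, hF, hF', xyToXZ, and_true]
    linear_combination loc _ (fstCoord (chartXZ a₂ a₄)) * j
  · intro F hF hF'
    simp only [xzToXY, planeLift_fst, planeLift_snd, map_mul, hF, hF', xyToXZ, and_true]
    linear_combination loc _ (fstCoord (chartXY a₂ a₄)) * i

/-- The Weierstrass model `y²z = x(x² + a₂xz + a₄z²)` in the projective plane over `Spec R`: its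
charts `z = 1` and `y = 1` (which cover it) glued along `yz ≠ 0`. -/
def weierstrassModel : Scheme.{u} :=
  pushout
    (Spec.map (CommRingCat.ofHom (algebraMap (PlaneRing (chartXY a₂ a₄))
      (Localization.Away (sndCoord (chartXY a₂ a₄))))))
    (Spec.map (CommRingCat.ofHom (xzToXY a₂ a₄)))

theorem spec_loc_comp (p : R[X][X]) (a : PlaneRing p) {q : R[X][X]}
    (f : PlaneRing q →+* Localization.Away a)
    (hf : ∀ r : R, f (algebraMap R _ r) = algebraMap R _ r) :
    Spec.map (CommRingCat.ofHom (algebraMap (PlaneRing p) (Localization.Away a))) ≫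
        planeChartToBase p =
      Spec.map (CommRingCat.ofHom f) ≫ planeChartToBase q := by
  rw [planeChartToBase, planeChartToBase, ← Spec.map_comp, ← Spec.map_comp]
  congr 1
  ext r
  exact ((hf r).trans (IsScalarTower.algebraMap_apply R (PlaneRing p) _ r)).symm

/-- The structure morphism of the Weierstrass model. -/
def weierstrassModelToBase : weierstrassModel a₂ a₄ ⟶ Spec (CommRingCat.of R) :=
  pushout.desc (planeChartToBase _) (planeChartToBase _)
    (spec_loc_comp _ _ _ (planeLift_algebraMap _ _ _ _))

end WeierstrassModel

section ResolvedModel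

open Polynomial

variable {R : Type u} [CommRing R] (a₂ a₄ : R)

/-- The chart `x₁ = z = 1` of `e₁y₁²z = x₁(e₁²x₁² + e₁a₂x₁z + a₄z²)`, with coordinates
`(u, v) = (t, x) = (y₁, e₁)`; here `y = xt`. -/
def chartTX : R[X][X] := X * (C X) ^ 2 - (X ^ 2 + C (C a₂) * X + C (C a₄))

/-- The chart `y₁ = z = 1` of `e₁y₁²z = x₁(e₁²x₁² + e₁a₂x₁z + a₄z²)`, with coordinates
`(u, v) = (s, y) = (x₁, e₁)`; here `x = ys`. -/
def chartSY : R[X][X] :=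
  X - C X * (X ^ 2 * (C X) ^ 2 + C (C a₂) * X * C X + C (C a₄))

/-- The chart `y₁ = e₁ = 1` of `e₁y₁²z = x₁(e₁²x₁² + e₁a₂x₁z + a₄z²)`, with coordinates
`(u, v) = (s, z) = (x₁, z)`; here `(x, y) = (s, 1)`. -/
def chartSZ : R[X][X] :=
  X - C X * ((C X) ^ 2 + C (C a₂) * C X * X + C (C a₄) * X ^ 2)

section

variable {S : Type u} [CommRing S] [Algebra R S] (u v : S)

theorem eval_chartTX : (chartTX a₂ a₄).eval₂ (eval₂RingHom (algebraMap R S) u) v =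
    v * u ^ 2 - (v ^ 2 + algebraMap R S a₂ * v + algebraMap R S a₄) := by
  simp [chartTX, -map_pow, eval₂_mul, eval₂_pow]

theorem eval_chartSY : (chartSY a₂ a₄).eval₂ (eval₂RingHom (algebraMap R S) u) v =
    v - u * (v ^ 2 * u ^ 2 + algebraMap R S a₂ * v * u + algebraMap R S a₄) := by
  simp [chartSY, -map_pow, eval₂_mul, eval₂_pow]

theorem eval_chartSZ : (chartSZ a₂ a₄).eval₂ (eval₂RingHom (algebraMap R S) u) v =
    v - u * (u ^ 2 + algebraMap R S a₂ * u * v + algebraMap R S a₄ * v ^ 2) := by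
  simp [chartSZ, -map_pow, eval₂_mul, eval₂_pow]

end

/-- The coordinate change `(s, z) = (s, 1 / y)`. -/
def szToSY : PlaneRing (chartSZ a₂ a₄) →+* Localization.Away (sndCoord (chartSY a₂ a₄)) :=
  planeLift _ (loc _ (fstCoord (chartSY a₂ a₄))) (invCoord _) (by
    have h := locRel (sndCoord (chartSY a₂ a₄))
    have i := invCoord_mul (sndCoord (chartSY a₂ a₄))
    rw [eval_chartSY] at h
    rw [eval_chartSZ]
    set s := loc (sndCoord (chartSY a₂ a₄)) (fstCoord (chartSY a₂ a₄))
    set y := loc (sndCoord (chartSY a₂ a₄)) (sndCoord (chartSY a₂ a₄))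
    set w := invCoord (sndCoord (chartSY a₂ a₄))
    linear_combination w ^ 2 * h + (- w + s ^ 3 * (y * w + 1) + algebraMap R _ a₂ * s ^ 2 * w) * i)

/-- The coordinate change `(s, y) = (s, 1 / z)`. -/
def syToSZ : PlaneRing (chartSY a₂ a₄) →+* Localization.Away (sndCoord (chartSZ a₂ a₄)) :=
  planeLift _ (loc _ (fstCoord (chartSZ a₂ a₄))) (invCoord _) (by
    have h := locRel (sndCoord (chartSZ a₂ a₄))
    have i := invCoord_mul (sndCoord (chartSZ a₂ a₄))
    rw [eval_chartSZ] at h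
    rw [eval_chartSY]
    set s := loc (sndCoord (chartSZ a₂ a₄)) (fstCoord (chartSZ a₂ a₄))
    set z := loc (sndCoord (chartSZ a₂ a₄)) (sndCoord (chartSZ a₂ a₄))
    set w := invCoord (sndCoord (chartSZ a₂ a₄))
    linear_combination w ^ 2 * h + (- w + algebraMap R _ a₂ * s ^ 2 * w +
      algebraMap R _ a₄ * s * (z * w + 1)) * i)

instance isOpenImmersion_szToSY :
    IsOpenImmersion (Spec.map (CommRingCat.ofHom (szToSY a₂ a₄))) := by
  have i := invCoord_mul (sndCoord (chartSY a₂ a₄))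
  have j := invCoord_mul (sndCoord (chartSZ a₂ a₄))
  refine isOpenImmersion_plane _ (sndCoord _) _ (syToSZ a₂ a₄) (planeLift_algebraMap _ _ _ _)
    (planeLift_algebraMap _ _ _ _) (loc _ (sndCoord _)) ?_ (loc _ (sndCoord _)) ?_ ?_ ?_
  · simpa [szToSY, mul_comm] using i
  · simpa [syToSZ, mul_comm] using j
  · intro F hF hF'
    simp only [szToSY, planeLift_fst, planeLift_snd, hF, hF', syToSZ, and_self]
  · intro F hF hF'
    simp only [szToSY, planeLift_fst, planeLift_snd, hF, hF', syToSZ, and_self]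

/-- The coordinate change `(s, y) = (1 / t, xt)`. -/
def syToTX : PlaneRing (chartSY a₂ a₄) →+* Localization.Away (fstCoord (chartTX a₂ a₄)) :=
  planeLift _ (invCoord _)
    (loc _ (sndCoord (chartTX a₂ a₄)) * loc _ (fstCoord (chartTX a₂ a₄))) (by
    have h := locRel (fstCoord (chartTX a₂ a₄))
    have i := invCoord_mul (fstCoord (chartTX a₂ a₄))
    rw [eval_chartTX] at h
    rw [eval_chartSY]
    set t := loc (fstCoord (chartTX a₂ a₄)) (fstCoord (chartTX a₂ a₄))
    set x := loc (fstCoord (chartTX a₂ a₄)) (sndCoord (chartTX a₂ a₄))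
    set w := invCoord (fstCoord (chartTX a₂ a₄))
    linear_combination w * h - (x * t + w * x ^ 2 * (t * w + 1) + algebraMap R _ a₂ * x * w) * i)

/-- The coordinate change `(t, x) = (1 / s, ys)`. -/
def txToSY : PlaneRing (chartTX a₂ a₄) →+* Localization.Away (fstCoord (chartSY a₂ a₄)) :=
  planeLift _ (invCoord _)
    (loc _ (sndCoord (chartSY a₂ a₄)) * loc _ (fstCoord (chartSY a₂ a₄))) (by
    have h := locRel (fstCoord (chartSY a₂ a₄))
    have i := invCoord_mul (fstCoord (chartSY a₂ a₄))
    rw [eval_chartSY] at h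
    rw [eval_chartTX]
    set s := loc (fstCoord (chartSY a₂ a₄)) (fstCoord (chartSY a₂ a₄))
    set y := loc (fstCoord (chartSY a₂ a₄)) (sndCoord (chartSY a₂ a₄))
    set w := invCoord (fstCoord (chartSY a₂ a₄))
    linear_combination w * h + (y * w + y ^ 2 * s ^ 2 + algebraMap R _ a₂ * y * s +
      algebraMap R _ a₄) * i)

instance isOpenImmersion_syToTX :
    IsOpenImmersion (Spec.map (CommRingCat.ofHom (syToTX a₂ a₄))) := by
  have i := invCoord_mul (fstCoord (chartTX a₂ a₄))
  have j := invCoord_mul (fstCoord (chartSY a₂ a₄))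
  refine isOpenImmersion_plane _ (fstCoord _) _ (txToSY a₂ a₄) (planeLift_algebraMap _ _ _ _)
    (planeLift_algebraMap _ _ _ _) (loc _ (fstCoord _)) ?_ (loc _ (fstCoord _)) ?_ ?_ ?_
  · simpa [syToTX, mul_comm] using i
  · simpa [txToSY, mul_comm] using j
  · intro F hF hF'
    simp only [syToTX, planeLift_fst, planeLift_snd, map_mul, hF, hF', txToSY, true_and]
    linear_combination loc _ (sndCoord (chartSY a₂ a₄)) * j
  · intro F hF hF'
    simp only [syToTX, planeLift_fst, planeLift_snd, map_mul, hF, hF', txToSY, true_and]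
    linear_combination loc _ (sndCoord (chartTX a₂ a₄)) * i

/-- The open subscheme `y₁ ≠ 0` of the resolved model: the charts `y₁ = z = 1` and
`y₁ = e₁ = 1` glued along `e₁z ≠ 0`. -/
def resolvedModelAux : Scheme.{u} :=
  pushout
    (Spec.map (CommRingCat.ofHom (algebraMap (PlaneRing (chartSY a₂ a₄))
      (Localization.Away (sndCoord (chartSY a₂ a₄))))))
    (Spec.map (CommRingCat.ofHom (szToSY a₂ a₄)))

/-- The structure morphism of the open subscheme `y₁ ≠ 0`. -/
def resolvedModelAuxToBase : resolvedModelAux a₂ a₄ ⟶ Spec (CommRingCat.of R) :=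
  pushout.desc (planeChartToBase _) (planeChartToBase _)
    (spec_loc_comp _ _ _ (planeLift_algebraMap _ _ _ _))

/-- The inclusion of the chart `y₁ = z = 1`. -/
def chartSYToAux : planeChart (chartSY a₂ a₄) ⟶ resolvedModelAux a₂ a₄ :=
  pushout.inl
    (Spec.map (CommRingCat.ofHom (algebraMap (PlaneRing (chartSY a₂ a₄))
      (Localization.Away (sndCoord (chartSY a₂ a₄))))))
    (Spec.map (CommRingCat.ofHom (szToSY a₂ a₄)))

instance : IsOpenImmersion (chartSYToAux a₂ a₄) := isOpenImmersion_inl _ _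

/-- The overlap `x₁y₁ ≠ 0` as an open subscheme of the open subscheme `y₁ ≠ 0`. -/
def overlapToAux : Spec (CommRingCat.of (Localization.Away (fstCoord (chartTX a₂ a₄)))) ⟶
    resolvedModelAux a₂ a₄ :=
  Spec.map (CommRingCat.ofHom (syToTX a₂ a₄)) ≫ chartSYToAux a₂ a₄

instance : IsOpenImmersion (overlapToAux a₂ a₄) :=
  inferInstanceAs (IsOpenImmersion (Spec.map (CommRingCat.ofHom (syToTX a₂ a₄)) ≫
    chartSYToAux a₂ a₄))

/-- The resolved model over `Spec R`: the hypersurface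
`e₁y₁²z = x₁(e₁²x₁² + e₁a₂x₁z + a₄z²)` in the blowup, along `x = y = 0`, of the projective plane
with coordinates `[x : y : z] = [e₁x₁ : e₁y₁ : z]`, where `[x₁ : y₁]` are the projective
coordinates of the exceptional curve `e₁ = 0`.  It is the proper transform of the Weierstrass model
`y²z = x(x² + a₂xz + a₄z²)`.  The charts `x₁ = z = 1`, `y₁ = z = 1` and `y₁ = e₁ = 1` cover it:
where `x₁ ≠ 0`, the equation forces `z ≠ 0`. -/
def resolvedModel : Scheme.{u} :=
  pushout
    (Spec.map (CommRingCat.ofHom (algebraMap (PlaneRing (chartTX a₂ a₄))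
      (Localization.Away (fstCoord (chartTX a₂ a₄))))))
    (overlapToAux a₂ a₄)

/-- The structure morphism of the resolved model. -/
def resolvedModelToBase : resolvedModel a₂ a₄ ⟶ Spec (CommRingCat.of R) :=
  pushout.desc (planeChartToBase _) (resolvedModelAuxToBase _ _) (by
    have h : chartSYToAux a₂ a₄ ≫ resolvedModelAuxToBase a₂ a₄ = planeChartToBase _ :=
      pushout.inl_desc _ _ _
    rw [overlapToAux, Category.assoc, h]
    exact spec_loc_comp _ _ _ (planeLift_algebraMap _ _ _ _))

end ResolvedModel

section FiberTypes

open Polynomial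

/-- The coordinate change `X = 1 / X'` between the two affine charts of the projective line. -/
def lineChange (k : Type u) [CommRing k] : k[X] →+* Localization.Away (X : k[X]) :=
  eval₂RingHom (algebraMap k _) (invCoord X)

instance isOpenImmersion_lineChange (k : Type u) [CommRing k] :
    IsOpenImmersion (Spec.map (CommRingCat.ofHom (lineChange k))) := by
  have i := invCoord_mul (X : k[X])
  have hX : lineChange k X = invCoord X := by simp [lineChange]
  have hX' : lineChange k X * loc X X = 1 := by rw [hX, mul_comm]; exact i
  have u : IsUnit (lineChange k X) := IsUnit.of_mul_eq_one _ hX'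
  have key : (Localization.awayLift (lineChange k) X u).comp (lineChange k) =
      algebraMap k[X] _ := by
    refine Polynomial.ringHom_ext (fun r => ?_) ?_
    · have h : lineChange k (C r) = loc X (C r) := by
        simp only [lineChange, coe_eval₂RingHom, eval₂_C]
        exact IsScalarTower.algebraMap_apply k k[X] _ r
      rw [RingHom.comp_apply, h, awayLift_loc, h]
    · rw [RingHom.comp_apply, hX]
      exact awayLift_inv _ _ u _ hX'
  exact isOpenImmersion_of_inverse X X (lineChange k) (lineChange k) u u key key

/-- The projective line over `k`: two affine lines glued by `X ↦ 1 / X`. -/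
def projLine (k : Type u) [CommRing k] : Scheme.{u} :=
  pushout
    (Spec.map (CommRingCat.ofHom (algebraMap k[X] (Localization.Away (X : k[X])))))
    (Spec.map (CommRingCat.ofHom (lineChange k)))

/-- The structure morphism of the projective line. -/
def projLineToBase (k : Type u) [CommRing k] : projLine k ⟶ Spec (CommRingCat.of k) :=
  pushout.desc (Spec.map (CommRingCat.ofHom (algebraMap k k[X])))
    (Spec.map (CommRingCat.ofHom (algebraMap k k[X]))) (by
      rw [← Spec.map_comp, ← Spec.map_comp]
      congr 1
      ext r
      refine (IsScalarTower.algebraMap_apply k k[X] (Localization.Away (X : k[X])) r).symm.trans ?_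
      exact (eval₂_C _ _).symm)

/-- `X` and `Y` are isomorphic as schemes over `S`. -/
def IsIsoOver {X Y S : Scheme.{u}} (f : X ⟶ S) (g : Y ⟶ S) : Prop :=
  ∃ e : X ≅ Y, e.hom ≫ g = f

variable {k : Type u} [Field k] {X : Scheme.{u}}

/-- The `k`-scheme `X` is the scheme-theoretic union of two closed subschemes `C₀` and `C₁` (in
particular it contains each of them with multiplicity one), both isomorphic to the projective line
over `k`, whose scheme-theoretic intersection is isomorphic to `Spec A` over `k`. -/
def IsTwoLinesMeetingIn (f : X ⟶ Spec (CommRingCat.of k)) (A : Type u) [CommRing A]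
    [Algebra k A] : Prop :=
  ∃ I₀ I₁ : X.IdealSheafData, I₀ ⊓ I₁ = ⊥ ∧
    IsIsoOver (I₀.subschemeι ≫ f) (projLineToBase k) ∧
    IsIsoOver (I₁.subschemeι ≫ f) (projLineToBase k) ∧
    IsIsoOver ((I₀ ⊔ I₁).subschemeι ≫ f) (Spec.map (CommRingCat.ofHom (algebraMap k A)))

/-- Kodaira type I₂, with both components defined over `k`, in its split or non-split form: two
rational curves meeting transversally along a divisor of degree 2. -/
def IsTypeI2 (f : X ⟶ Spec (CommRingCat.of k)) : Prop :=
  ∃ (A : Type u) (_ : CommRing A) (_ : Algebra k A),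
    Algebra.Etale k A ∧ Module.finrank k A = 2 ∧ IsTwoLinesMeetingIn f A

/-- Type I₂ⁿˢ: two rational curves meeting transversally along a divisor of degree 2 which is the
spectrum of a quadratic field extension `K` of `k`, so that this extension is needed to split the
divisor into two rational points. -/
def IsTypeI2ns (f : X ⟶ Spec (CommRingCat.of k)) : Prop :=
  ∃ (K : Type u) (_ : Field K) (_ : Algebra k K),
    Algebra.IsSeparable k K ∧ Module.finrank k K = 2 ∧ IsTwoLinesMeetingIn f K

/-- Kodaira type III: two rational curves meeting along a double point, that is, along a divisor
isomorphic to `Spec k[ε]` with `ε² = 0`. -/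
def IsTypeIII (f : X ⟶ Spec (CommRingCat.of k)) : Prop :=
  IsTwoLinesMeetingIn f (DualNumber k)

/-- Kodaira type I₁ (`k` of characteristic zero): a nodal plane cubic.  With the node moved to
`[0 : 0 : 1]` and a flex at `[0 : 1 : 0]`, its equation is `y²z = x²(x + cz)` with `c ≠ 0`; the
tangent directions at the node are `y² = cx²`. -/
def IsTypeI1 (f : X ⟶ Spec (CommRingCat.of k)) : Prop :=
  ∃ c : k, c ≠ 0 ∧ IsIsoOver f (weierstrassModelToBase c (0 : k))

end FiberTypes

section LineBundles

variable (B : Scheme.{u})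

/-- Restriction of functions. -/
abbrev res {B : Scheme.{u}} {V W : B.Opens} (h : V ≤ W) : Γ(B, W) →+* Γ(B, V) :=
  (B.presheaf.map (homOfLE h).op).hom

/-- A line bundle on `B`, given by transition functions: a cover of `B` by affine open
trivializing sets `U i` and units `g i j` on `U i ⊓ U j` that satisfy the cocycle condition. -/
structure LineBundle where
  ι : Type u
  U : ι → B.affineOpens
  cover : ⨆ i, (U i : B.Opens) = ⊤
  g : ∀ i j, Γ(B, (U i : B.Opens) ⊓ U j)ˣ
  cocycle : ∀ i j k,
    res (V := (U i : B.Opens) ⊓ U j ⊓ U k) inf_le_left (g i j : Γ(B, (U i : B.Opens) ⊓ U j)) *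
      res (le_inf (inf_le_left.trans inf_le_right) inf_le_right)
        (g j k : Γ(B, (U j : B.Opens) ⊓ U k)) =
      res (le_inf (inf_le_left.trans inf_le_left) inf_le_right)
        (g i k : Γ(B, (U i : B.Opens) ⊓ U k))

variable {B}

namespace LineBundle

variable (L : LineBundle B)

/-- A function on each trivializing open set. -/
abbrev Family : Type u := ∀ i : L.ι, Γ(B, (L.U i : B.Opens))

/-- The family `s` is a section of the `n`-th tensor power of `L`, written in the
trivializations. -/
def IsSection (n : ℕ) (s : L.Family) : Prop :=
  ∀ i j, res (V := (L.U i : B.Opens) ⊓ L.U j) inf_le_left (s i) =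
    (L.g i j : Γ(B, (L.U i : B.Opens) ⊓ L.U j)) ^ n * res inf_le_right (s j)

variable {L}

/-- The algebraic set `V(s)`. -/
def zeroLocus (s : L.Family) : Set B :=
  {p | ∀ i, p ∈ (L.U i : B.Opens) → p ∉ B.basicOpen (s i)}

/-- The closed subscheme `V(s)` is an effective Cartier divisor: its local equations are
nonzerodivisors. -/
def IsDivisor (s : L.Family) : Prop :=
  ∀ i, s i ∈ nonZeroDivisors Γ(B, (L.U i : B.Opens))

/-- The closed subscheme `V(s)`, which on `U i` is `Spec Γ(B, U i) / (s i)`, is smooth over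
`S`. -/
def IsSmoothZeroScheme {S : Scheme.{u}} (π : B ⟶ S) (s : L.Family) : Prop :=
  ∀ i, Smooth (Spec.map (CommRingCat.ofHom (Ideal.Quotient.mk (Ideal.span {s i}))) ≫
    (L.U i).2.fromSpec ≫ π)

/-- `V(s)` and `V(t)` meet transversally at the point `p` of `B`: their local equations vanish at
`p` and have linearly independent differentials there, that is, linearly independent classes in the
cotangent space `𝔪 / 𝔪²` of the local ring at `p`. -/
def IsTransverseAt (s t : L.Family) (p : B) : Prop :=
  ∀ (i : L.ι) (hp : p ∈ (L.U i : B.Opens)),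
    ∃ (hs : B.presheaf.germ (L.U i) p hp (s i) ∈
          IsLocalRing.maximalIdeal (B.presheaf.stalk p))
      (ht : B.presheaf.germ (L.U i) p hp (t i) ∈
          IsLocalRing.maximalIdeal (B.presheaf.stalk p)),
      LinearIndependent (IsLocalRing.ResidueField (B.presheaf.stalk p))
        ![(IsLocalRing.maximalIdeal (B.presheaf.stalk p)).toCotangent ⟨_, hs⟩,
          (IsLocalRing.maximalIdeal (B.presheaf.stalk p)).toCotangent ⟨_, ht⟩]

/-- `η` is the generic point of an irreducible component of the closed set `Z`. -/
def IsGenericPointOfComponent (η : B) (Z : Set B) : Prop :=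
  η ∈ Z ∧ ∀ p ∈ Z, p ⤳ η → p = η

/-- The Weierstrass equation `y² = x³ + a₂x² + a₄x` over a trivializing open set. -/
def weierstrass (a₂ a₄ : L.Family) (i : L.ι) : WeierstrassCurve Γ(B, (L.U i : B.Opens)) where
  a₁ := 0
  a₂ := a₂ i
  a₃ := 0
  a₄ := a₄ i
  a₆ := 0

/-- The discriminant, a section of the twelfth power of `L`. -/
def disc (a₂ a₄ : L.Family) : L.Family := fun i => (weierstrass a₂ a₄ i).Δ

/-- The invariant `c₄`, a section of the fourth power of `L`. -/
def invC4 (a₂ a₄ : L.Family) : L.Family := fun i => (weierstrass a₂ a₄ i).c₄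

/-- The invariant `c₆`, a section of the sixth power of `L`. -/
def invC6 (a₂ a₄ : L.Family) : L.Family := fun i => (weierstrass a₂ a₄ i).c₆

/-- The section `4a₄ - a₂²` of the fourth power of `L`. -/
def residualDisc (a₂ a₄ : L.Family) : L.Family := fun i => 4 * a₄ i - a₂ i ^ 2

/-- `φ : Y ⟶ B` is the resolved model `e₁y₁²z = x₁(e₁²x₁² + e₁a₂x₁z + a₄z²)`: over each
trivializing affine open set `U i`, it is isomorphic to the resolved model with coefficients
`a₂ i` and `a₄ i`.  (The local models patch by `(x, y) ↦ (g² x, g³ y)`, `t ↦ g t`; which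
isomorphisms are used to patch them plays no role for the fibers and for smoothness.) -/
def IsResolvedModel (a₂ a₄ : L.Family) {Y : Scheme.{u}} (φ : Y ⟶ B) : Prop :=
  ∀ i, ∃ e : resolvedModel (a₂ i) (a₄ i) ⟶ Y,
    IsPullback e (resolvedModelToBase (a₂ i) (a₄ i)) φ (L.U i).2.fromSpec

end LineBundle

end LineBundles

end

end SO3

open SO3 SO3.LineBundle

/-! Fibers and discriminant of the SO(3)-model.

Everything about the fibration reduces to explicit plane curves.  Over a trivializing affine open
set the fibration is the resolved model, which is glued from three plane charts, and gluing
commutes with base change (`IsGluing.isPullback_base`, `exists_isPullback_resolvedModel`); so the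
fiber over `p` is the resolved model over the residue field with the values `a₂(p)`, `a₄(p)` as
coefficients (`isIsoOver_fiber`).  Over a field of characteristic zero there are three cases.

* If `a₄ (a₂² - 4a₄) ≠ 0`, the partial derivatives of each chart have no common zero on the curve.
  Hence they generate the unit ideal, so one step of Newton's method lifts
  solutions along square-zero extensions and the curve is smooth (`smooth_resolvedModelToBase`).
* If `a₄ = 0`, the equation is `x (t² - a₂ - x) = 0` with `t = y / x`.  The curve is the union of
  the lines `x = 0` and `x = t² - a₂`, both parametrized by `t`, and their intersection is the
  spectrum of `k[t] / (t² - a₂)` (`isTwoLinesMeetingIn_of_isIsoOver`).  This algebra is étale if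
  `a₂ ≠ 0`, a field if `a₂` is not a square, and the algebra of dual numbers if `a₂ = 0`.
* If `4a₄ = a₂² ≠ 0`, write `a₂ = 2r`, `a₄ = r²`.  The equation `y² = x (x + r)²` is that of a cubic
  whose node is not at `x = y = 0`, so the blowup changes nothing (`isIsoOver_nodal`).

The remaining claims concern the two divisors `a₄ = 0` and `δ = 0`, where `δ = 4a₄ - a₂²`.
The divisor `δ = 0` carries a section of the total space, namely the nodes of the fibers, and the
smoothness of the total space along it yields the smoothness of the divisor (`smooth_residual`).
Smooth schemes are reduced and, as far as square roots are concerned, normal: locally they are étale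
over a polynomial ring (`isReduced_of_smooth`, `dvd_of_sq_eq_of_smooth`).  Reducedness implies that
at a generic point of one of the divisors, the maximal ideal is generated by the local equation of
the divisor (`maximalIdeal_eq_span_of_mem_minimalPrimes`); if `a₂` vanished there, then so would
`a₄`, and the two could not be transverse.  So `a₂` does not vanish at these points.  It follows
that `a₄` and `δ`, which agree up to the factor `4` modulo `a₂²`, have no common component, which
gives the radical of the discriminant `-16 a₄² δ` (`radical_span_sq_mul`).  Where `a₂` and `a₄`
vanish, the same congruence shows that the divisors are tangent (`germ_mem_span_residualDisc_sup`).

Finally, `a₂` is not a square at the generic point of `V(a₄)`: as `V(a₄)` is normal, a square root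
would extend over it, and `a₂` would vanish to order two along `V(a₄)` at the points of
`V(a₂) ∩ V(a₄)`, against transversality (`not_isSquare_evaluation`). -/

namespace SO3

/-! ### Schemes glued from two open subschemes -/

/-- `X` is glued from `U` and `V` along `W`: the schemes `U` and `V` are open in `X`, they cover
it, and `W` is their intersection. -/
structure IsGluing {W U V X : Scheme.{u}} (i : W ⟶ U) (j : W ⟶ V) (a : U ⟶ X) (b : V ⟶ X) :
    Prop where
  isOpenImmersion_left : IsOpenImmersion a
  isOpenImmersion_right : IsOpenImmersion b
  isPullback : IsPullback i j a b
  covers : ∀ x : X, x ∈ Set.range a ∨ x ∈ Set.range b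

/-- The two-element open cover given by a jointly surjective pair of open immersions. -/
noncomputable def pairCover {U V X : Scheme.{u}} (a : U ⟶ X) (b : V ⟶ X) [IsOpenImmersion a]
    [IsOpenImmersion b] (h : ∀ x : X, x ∈ Set.range a ∨ x ∈ Set.range b) : X.OpenCover where
  I₀ := Bool
  X t := bif t then U else V
  f t := match t with
    | true => a
    | false => b
  mem₀ := by
    rw [Scheme.presieve₀_mem_precoverage_iff]
    refine ⟨fun x => ?_, ?_⟩
    · obtain h | h := h x
      · exact ⟨true, h⟩
      · exact ⟨false, h⟩
    · rintro (_ | _)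
      · assumption
      · assumption

/-- Two schemes can be glued along a common open subscheme. -/
theorem isGluing_pushout {W U V : Scheme.{u}} (i : W ⟶ U) (j : W ⟶ V) [IsOpenImmersion i]
    [IsOpenImmersion j] : IsGluing i j (pushout.inl i j) (pushout.inr i j) := by
  have hl : IsOpenImmersion (pushout.inl i j) := isOpenImmersion_inl i j
  have hr : IsOpenImmersion (pushout.inr i j) :=
    inferInstanceAs (IsOpenImmersion (colimit.ι (span i j) WalkingSpan.right))
  refine ⟨hl, hr, ?_, ?_⟩
  · refine (IsOpenImmersion.isPullback j i (pushout.inr i j) (pushout.inl i j)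
      pushout.condition ?_).flip
    ext x
    constructor
    · rintro ⟨y, hy⟩
      obtain ⟨k, fi, fj, w, hi, hj⟩ := (Scheme.IsLocallyDirected.ι_eq_ι_iff (span i j)
        (i := WalkingSpan.right) (j := WalkingSpan.left)).mp hy
      match k, fi, fj, w, hi, hj with
      | none, fi, fj, w, hi, hj =>
        obtain rfl : fj = WalkingSpan.Hom.fst := Subsingleton.elim _ _
        exact ⟨w, hj⟩
      | some WalkingPair.left, fi, fj, w, hi, hj => exact nomatch (fi : WidePushoutShape.Hom _ _)
      | some WalkingPair.right, fi, fj, w, hi, hj => exact nomatch (fj : WidePushoutShape.Hom _ _)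
    · rintro ⟨w, rfl⟩
      refine ⟨j w, ?_⟩
      simp only [← Scheme.Hom.comp_apply, pushout.condition]
  · intro x
    obtain ⟨k, y, rfl⟩ := Scheme.IsLocallyDirected.ι_jointly_surjective (span i j) x
    match k, y with
    | none, y =>
      left
      refine ⟨i y, ?_⟩
      rw [← colimit.w (span i j) WalkingSpan.Hom.fst, Scheme.Hom.comp_apply]
      rfl
    | some WalkingPair.left, y => exact Or.inl ⟨y, rfl⟩
    | some WalkingPair.right, y => exact Or.inr ⟨y, rfl⟩

namespace IsGluing

variable {W U V X : Scheme.{u}} {i : W ⟶ U} {j : W ⟶ V} {a : U ⟶ X} {b : V ⟶ X}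

theorem hom_ext (h : IsGluing i j a b) {Z : Scheme.{u}} {f g : X ⟶ Z} (hl : a ≫ f = a ≫ g)
    (hr : b ≫ f = b ≫ g) : f = g := by
  have := h.isOpenImmersion_left
  have := h.isOpenImmersion_right
  refine (pairCover a b h.covers).hom_ext _ _ ?_
  rintro (_ | _)
  · exact hr
  · exact hl

theorem exists_desc (h : IsGluing i j a b) {Z : Scheme.{u}} (f : U ⟶ Z) (g : V ⟶ Z)
    (w : i ≫ f = j ≫ g) : ∃ l : X ⟶ Z, a ≫ l = f ∧ b ≫ l = g := by
  have := h.isOpenImmersion_left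
  have := h.isOpenImmersion_right
  let 𝒰 := pairCover a b h.covers
  let F : ∀ t, 𝒰.X t ⟶ Z := fun t => match t with
    | true => f
    | false => g
  have hF : ∀ x y, pullback.fst (𝒰.f x) (𝒰.f y) ≫ F x = pullback.snd _ _ ≫ F y := by
    rintro (_ | _) (_ | _)
    · change pullback.fst b b ≫ g = pullback.snd b b ≫ g
      rw [(cancel_mono b).mp pullback.condition]
    · change pullback.fst b a ≫ g = pullback.snd b a ≫ f
      have e := h.isPullback.flip.isoPullback_inv_fst
      have e' := h.isPullback.flip.isoPullback_inv_snd
      rw [← e, ← e', Category.assoc, Category.assoc, w]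
    · change pullback.fst a b ≫ f = pullback.snd a b ≫ g
      have e := h.isPullback.isoPullback_inv_fst
      have e' := h.isPullback.isoPullback_inv_snd
      rw [← e, ← e', Category.assoc, Category.assoc, w]
    · change pullback.fst a a ≫ f = pullback.snd a a ≫ f
      rw [(cancel_mono a).mp pullback.condition]
  exact ⟨𝒰.glueMorphisms F hF, 𝒰.ι_glueMorphisms F hF true, 𝒰.ι_glueMorphisms F hF false⟩

theorem isPushout (h : IsGluing i j a b) : IsPushout i j a b := by
  refine ⟨⟨h.isPullback.w⟩, ⟨PushoutCocone.IsColimit.mk _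
    (fun s => (h.exists_desc s.inl s.inr s.condition).choose)
    (fun s => (h.exists_desc s.inl s.inr s.condition).choose_spec.1)
    (fun s => (h.exists_desc s.inl s.inr s.condition).choose_spec.2) ?_⟩⟩
  intro s m hl hr
  obtain ⟨h₁, h₂⟩ := (h.exists_desc s.inl s.inr s.condition).choose_spec
  exact h.hom_ext (hl.trans h₁.symm) (hr.trans h₂.symm)

theorem isOpenImmersion_snd (h : IsGluing i j a b) : IsOpenImmersion j :=
  have := h.isOpenImmersion_left
  MorphismProperty.of_isPullback h.isPullback ‹_›

/-- Gluing is universal in the following sense: a morphism between glued schemes which is cartesian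
over the intersections is cartesian over the pieces. -/
theorem isPullback_left {W' U' V' X' : Scheme.{u}} {i' : W' ⟶ U'} {j' : W' ⟶ V'}
    {a' : U' ⟶ X'} {b' : V' ⟶ X'} (h : IsGluing i j a b) (h' : IsGluing i' j' a' b')
    {f : U' ⟶ U} {g : V' ⟶ V} {k : W' ⟶ W} {F : X' ⟶ X} (hf : a' ≫ F = f ≫ a)
    (hg : b' ≫ F = g ≫ b) (HV : IsPullback j' k g j) : IsPullback a' f F a := by
  have := h.isOpenImmersion_left
  have := h'.isOpenImmersion_left
  refine (IsOpenImmersion.isPullback f a' a F hf ?_).flip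
  ext x
  constructor
  · rintro ⟨u, hu⟩
    obtain ⟨y, rfl⟩ | ⟨y, rfl⟩ := h'.covers x
    · exact ⟨y, rfl⟩
    · -- the image of `y` in `V` lies in `U` as well, hence in the intersection `W`
      have e : a u = b (g y) := by
        rw [hu, ← Scheme.Hom.comp_apply, hg, Scheme.Hom.comp_apply]
      obtain ⟨w, -, hw⟩ := Scheme.Pullback.exists_preimage_pullback u (g y) e
      have hw' : g y = j (h.isPullback.isoPullback.inv w) := by
        rw [← hw, ← Scheme.Hom.comp_apply, h.isPullback.isoPullback_inv_snd]
      obtain ⟨z, hz, -⟩ := Scheme.Pullback.exists_preimage_pullback y _ hw'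
      refine ⟨i' (HV.isoPullback.inv z), ?_⟩
      rw [← hz, ← Scheme.Hom.comp_apply, h'.isPullback.w, Scheme.Hom.comp_apply,
        ← Scheme.Hom.comp_apply HV.isoPullback.inv, HV.isoPullback_inv_fst]
  · rintro ⟨y, rfl⟩
    exact ⟨f y, by rw [← Scheme.Hom.comp_apply, ← hf, Scheme.Hom.comp_apply]⟩

theorem symm (h : IsGluing i j a b) : IsGluing j i b a :=
  ⟨h.isOpenImmersion_right, h.isOpenImmersion_left, h.isPullback.flip, fun x => (h.covers x).symm⟩

/-- Gluing commutes with base change. -/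
theorem isPullback_base {W' U' V' X' S S' : Scheme.{u}} {i' : W' ⟶ U'} {j' : W' ⟶ V'}
    {a' : U' ⟶ X'} {b' : V' ⟶ X'} (h : IsGluing i j a b) (h' : IsGluing i' j' a' b')
    {f : U' ⟶ U} {g : V' ⟶ V} {k : W' ⟶ W} {π : X ⟶ S} {π' : X' ⟶ S'} {s : S' ⟶ S}
    {F : X' ⟶ X} (hf : a' ≫ F = f ≫ a) (hg : b' ≫ F = g ≫ b)
    (w : F ≫ π = π' ≫ s) (HU : IsPullback f (a' ≫ π') (a ≫ π) s)
    (HV : IsPullback g (b' ≫ π') (b ≫ π) s) (HW : IsPullback i' k f i) (hj : j' ≫ g = k ≫ j) :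
    IsPullback F π' π s := by
  have := h.isOpenImmersion_left
  have := h.isOpenImmersion_right
  let c : X' ⟶ pullback π s := pullback.lift F π' w
  have hc₁ : c ≫ pullback.fst π s = F := pullback.lift_fst _ _ _
  have hc₂ : c ≫ pullback.snd π s = π' := pullback.lift_snd _ _ _
  have HU' : IsPullback f (a' ≫ c) a (pullback.fst π s) := by
    refine IsPullback.of_bot ?_ ?_ (IsPullback.of_hasPullback π s)
    · rwa [Category.assoc, hc₂]
    · rw [Category.assoc, hc₁, hf]
  have HV' : IsPullback g (b' ≫ c) b (pullback.fst π s) := by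
    refine IsPullback.of_bot ?_ ?_ (IsPullback.of_hasPullback π s)
    · rwa [Category.assoc, hc₂]
    · rw [Category.assoc, hc₁, hg]
  -- the pieces `U'` and `V'` also glue to the base change
  have hP : IsGluing i' j' (a' ≫ c) (b' ≫ c) := by
    refine ⟨MorphismProperty.of_isPullback HU' ‹_›, MorphismProperty.of_isPullback HV' ‹_›, ?_,
      fun x => ?_⟩
    · refine (IsPullback.of_right (h₁₂ := g) (v₁₃ := b) (h₂₂ := pullback.fst π s) ?_ ?_ HV').flip
      · rw [Category.assoc, hc₁, hf, hj]
        exact HW.flip.paste_horiz h.isPullback.flip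
      · rw [reassoc_of% h'.isPullback.w]
    · obtain ⟨y, hy⟩ | ⟨y, hy⟩ := h.covers (pullback.fst π s x)
      · obtain ⟨z, -, hz⟩ := Scheme.Pullback.exists_preimage_pullback y x hy
        refine Or.inl ⟨HU'.isoPullback.inv z, ?_⟩
        rw [← Scheme.Hom.comp_apply, HU'.isoPullback_inv_snd, hz]
      · obtain ⟨z, -, hz⟩ := Scheme.Pullback.exists_preimage_pullback y x hy
        refine Or.inr ⟨HV'.isoPullback.inv z, ?_⟩
        rw [← Scheme.Hom.comp_apply, HV'.isoPullback_inv_snd, hz]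
  have hc : c = (h'.isPushout.isoIsPushout _ _ hP.isPushout).hom :=
    h'.hom_ext (by simp) (by simp)
  have : IsIso c := by rw [hc]; infer_instance
  exact IsPullback.of_iso (IsPullback.of_hasPullback π s) (asIso c).symm (Iso.refl _) (Iso.refl _)
    (Iso.refl _) (by simp [hc₁]) (by simp [hc₂]) (by simp) (by simp)

end IsGluing

/-! ### Localizations and plane charts under base change -/

open Polynomial

section Localization

/-- The map `A[1/a] → A'[1/a']` induced by a ring homomorphism that takes `a` to `a'`. -/
noncomputable def locMap {A A' : Type u} [CommRing A] [CommRing A'] (φ : A →+* A') {a : A} {a' : A'}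
    (h : φ a = a') : Localization.Away a →+* Localization.Away a' :=
  Localization.awayLift ((algebraMap A' (Localization.Away a')).comp φ) a
    (by rw [RingHom.comp_apply, h]; exact IsUnit.of_mul_eq_one _ (invCoord_mul a'))

variable {A A' : Type u} [CommRing A] [CommRing A'] (φ : A →+* A') {a : A} {a' : A'} (h : φ a = a')

@[simp] theorem locMap_loc (x : A) : locMap φ h (loc a x) = loc a' (φ x) :=
  awayLift_loc _ _ (by rw [RingHom.comp_apply, h]; exact IsUnit.of_mul_eq_one _ (invCoord_mul a')) _

@[simp] theorem locMap_invCoord : locMap φ h (invCoord a) = invCoord a' :=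
  awayLift_inv _ _ (by rw [RingHom.comp_apply, h]; exact IsUnit.of_mul_eq_one _ (invCoord_mul a')) _
    (by rw [RingHom.comp_apply, h]; exact invCoord_mul a')

theorem range_spec_away {A : Type u} [CommRing A] (a : A) (L : Type u) [CommRing L] [Algebra A L]
    [IsLocalization.Away a L] : Set.range (Spec.map (CommRingCat.ofHom (algebraMap A L))) =
      (PrimeSpectrum.basicOpen a : Set (PrimeSpectrum A)) :=
  PrimeSpectrum.localization_away_comap_range L a

theorem isOpenImmersion_spec_away {A : Type u} [CommRing A] (a : A) (L : Type u) [CommRing L]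
    [Algebra A L] [IsLocalization.Away a L] :
    IsOpenImmersion (Spec.map (CommRingCat.ofHom (algebraMap A L))) :=
  IsOpenImmersion.of_isLocalization a

/-- The preimage of a basic open set is a basic open set, as a cartesian square. -/
theorem isPullback_spec_away {L L' : Type u} [CommRing L] [CommRing L'] [Algebra A L]
    [Algebra A' L'] [IsLocalization.Away a L] [IsLocalization.Away a' L'] (ψ : L →+* L')
    (hψ : ψ.comp (algebraMap A L) = (algebraMap A' L').comp φ) (h : φ a = a') :
    IsPullback (Spec.map (CommRingCat.ofHom (algebraMap A' L'))) (Spec.map (CommRingCat.ofHom ψ))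
      (Spec.map (CommRingCat.ofHom φ)) (Spec.map (CommRingCat.ofHom (algebraMap A L))) := by
  have := isOpenImmersion_spec_away a L
  have := isOpenImmersion_spec_away a' L'
  refine (IsOpenImmersion.isPullback _ _ _ _ ?_ ?_).flip
  · rw [← Spec.map_comp, ← Spec.map_comp, ← CommRingCat.ofHom_comp, ← CommRingCat.ofHom_comp, hψ]
  · refine TopologicalSpace.Opens.ext ?_
    refine Eq.trans ?_ (range_spec_away a' L').symm
    rw [TopologicalSpace.Opens.map_coe]
    refine (congrArg _ (range_spec_away a L)).trans ?_
    rw [← h]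
    rfl

theorem isPullback_spec_locMap :
    IsPullback (Spec.map (CommRingCat.ofHom (algebraMap A' (Localization.Away a'))))
      (Spec.map (CommRingCat.ofHom (locMap φ h))) (Spec.map (CommRingCat.ofHom φ))
      (Spec.map (CommRingCat.ofHom (algebraMap A (Localization.Away a)))) :=
  isPullback_spec_away φ (locMap φ h) (RingHom.ext fun x => locMap_loc φ h x) h

theorem away_hom_ext {S : Type u} [CommRing S] {f g : Localization.Away a →+* S}
    (h : ∀ x, f (loc a x) = g (loc a x)) : f = g :=
  IsLocalization.ringHom_ext (Submonoid.powers a) (RingHom.ext h)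

end Localization

section PlaneBaseChange

variable {R k : Type u} [CommRing R] [CommRing k] (f : R →+* k) {p : R[X][X]} {q : k[X][X]}

/-- Base change of the coordinate ring of a plane chart. -/
noncomputable def planeMap (h : p.map (mapRingHom f) = q) : PlaneRing p →+* PlaneRing q :=
  AdjoinRoot.lift ((AdjoinRoot.of q).comp (mapRingHom f)) (sndCoord q) (by
    rw [← Polynomial.eval₂_map, h]; exact AdjoinRoot.eval₂_root q)

variable (h : p.map (mapRingHom f) = q)

@[simp] theorem planeMap_fst : planeMap f h (fstCoord p) = fstCoord q := by
  simp [planeMap, fstCoord]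

@[simp] theorem planeMap_snd : planeMap f h (sndCoord p) = sndCoord q := by
  simp [planeMap, sndCoord]

@[simp] theorem planeMap_algebraMap (r : R) :
    planeMap f h (algebraMap R _ r) = algebraMap k _ (f r) := by
  rw [AdjoinRoot.algebraMap_eq', AdjoinRoot.algebraMap_eq', RingHom.comp_apply, RingHom.comp_apply]
  simp [planeMap]

/-- Over a `k`-algebra, the solutions of `p` are solutions of its base change `q`. -/
theorem planeMap_rel (h : p.map (mapRingHom f) = q) {T : Type u} [CommRing T] (g : k →+* T)
    (φ : PlaneRing p →+* T) (hφ : ∀ r, g (f r) = φ (algebraMap R _ r)) :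
    q.eval₂ (eval₂RingHom g (φ (fstCoord p))) (φ (sndCoord p)) = 0 := by
  have e := congrArg φ (planeRel p)
  rw [Polynomial.hom_eval₂, map_zero] at e
  rw [← h, Polynomial.eval₂_map, ← e]
  congr 1
  refine Polynomial.ringHom_ext (fun r => ?_) ?_
  · simpa using hφ r
  · simp

/-- Plane charts commute with base change. -/
theorem isPullback_planeMap :
    IsPullback (Spec.map (CommRingCat.ofHom (planeMap f h))) (planeChartToBase q)
      (planeChartToBase p) (Spec.map (CommRingCat.ofHom f)) := by
  refine isPullback_SpecMap_of_isPushout _ _ _ _ (IsPushout.flip ?_)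
  have rel (s : PushoutCocone (CommRingCat.ofHom f)
      (CommRingCat.ofHom (algebraMap R (PlaneRing p)))) :=
    planeMap_rel f h s.inl.hom s.inr.hom (fun r => congr($(s.condition).hom r))
  refine ⟨⟨?_⟩, ⟨PushoutCocone.IsColimit.mk _ (fun s => CommRingCat.ofHom
    (@planeLift k _ s.pt _ s.inl.hom.toAlgebra q _ _ (rel s))) ?_ ?_ ?_⟩⟩
  · ext r
    exact (planeMap_algebraMap f h r).symm
  · intro s
    ext r
    let := s.inl.hom.toAlgebra
    exact planeLift_algebraMap q _ _ (rel s) r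
  · intro s
    let := s.inl.hom.toAlgebra
    refine CommRingCat.hom_ext (planeRing_hom_ext (fun r => ?_) ?_ ?_)
    · refine (congrArg _ (planeMap_algebraMap f h r)).trans ?_
      exact (planeLift_algebraMap q _ _ (rel s) _).trans congr($(s.condition).hom r)
    · exact (congrArg _ (planeMap_fst f h)).trans (planeLift_fst q _ _ (rel s))
    · exact (congrArg _ (planeMap_snd f h)).trans (planeLift_snd q _ _ (rel s))
  · intro s m h₁ h₂
    let := s.inl.hom.toAlgebra
    refine CommRingCat.hom_ext (planeRing_hom_ext (fun r => ?_) ?_ ?_)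
    · exact (congr($(h₁).hom r)).trans (planeLift_algebraMap q _ _ (rel s) _).symm
    · have e : m.hom (planeMap f h (fstCoord p)) = s.inr.hom (fstCoord p) :=
        congr($(h₂).hom (fstCoord p))
      rw [planeMap_fst] at e
      exact e.trans (planeLift_fst q _ _ (rel s)).symm
    · have e : m.hom (planeMap f h (sndCoord p)) = s.inr.hom (sndCoord p) :=
        congr($(h₂).hom (sndCoord p))
      rw [planeMap_snd] at e
      exact e.trans (planeLift_snd q _ _ (rel s)).symm

end PlaneBaseChange

/-! ### The resolved model under base change -/

section ModelBaseChange

variable {R k : Type u} [CommRing R] [CommRing k] (f : R →+* k) (a₂ a₄ : R)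

theorem map_chartTX : (chartTX a₂ a₄).map (mapRingHom f) = chartTX (f a₂) (f a₄) := by
  simp [chartTX, Polynomial.map_sub, Polynomial.map_mul]

theorem map_chartSY : (chartSY a₂ a₄).map (mapRingHom f) = chartSY (f a₂) (f a₄) := by
  simp [chartSY, Polynomial.map_sub, Polynomial.map_mul]

theorem map_chartSZ : (chartSZ a₂ a₄).map (mapRingHom f) = chartSZ (f a₂) (f a₄) := by
  simp [chartSZ, Polynomial.map_sub, Polynomial.map_mul]

/-- The inclusion of the chart `y₁ = e₁ = 1`. -/
noncomputable def chartSZToAux : planeChart (chartSZ a₂ a₄) ⟶ resolvedModelAux a₂ a₄ :=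
  pushout.inr _ _

theorem isGluing_resolvedModelAux : IsGluing
    (Spec.map (CommRingCat.ofHom (algebraMap (PlaneRing (chartSY a₂ a₄))
      (Localization.Away (sndCoord (chartSY a₂ a₄))))))
    (Spec.map (CommRingCat.ofHom (szToSY a₂ a₄))) (chartSYToAux a₂ a₄)
    (chartSZToAux a₂ a₄) :=
  isGluing_pushout _ _

theorem chartSYToAux_toBase :
    chartSYToAux a₂ a₄ ≫ resolvedModelAuxToBase a₂ a₄ = planeChartToBase _ :=
  pushout.inl_desc _ _ _

theorem chartSZToAux_toBase :
    chartSZToAux a₂ a₄ ≫ resolvedModelAuxToBase a₂ a₄ = planeChartToBase _ :=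
  pushout.inr_desc _ _ _

/-- The inclusion of the chart `x₁ = z = 1`. -/
noncomputable def chartTXToModel : planeChart (chartTX a₂ a₄) ⟶ resolvedModel a₂ a₄ :=
  pushout.inl _ _

/-- The inclusion of the open subscheme `y₁ ≠ 0`. -/
noncomputable def auxToModel : resolvedModelAux a₂ a₄ ⟶ resolvedModel a₂ a₄ :=
  pushout.inr _ _

theorem isGluing_resolvedModel : IsGluing
    (Spec.map (CommRingCat.ofHom (algebraMap (PlaneRing (chartTX a₂ a₄))
      (Localization.Away (fstCoord (chartTX a₂ a₄)))))) (overlapToAux a₂ a₄)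
    (chartTXToModel a₂ a₄) (auxToModel a₂ a₄) :=
  isGluing_pushout _ _

theorem chartTXToModel_toBase :
    chartTXToModel a₂ a₄ ≫ resolvedModelToBase a₂ a₄ = planeChartToBase _ :=
  pushout.inl_desc _ _ _

theorem auxToModel_toBase :
    auxToModel a₂ a₄ ≫ resolvedModelToBase a₂ a₄ = resolvedModelAuxToBase a₂ a₄ :=
  pushout.inr_desc _ _ _

theorem specMap_comp_eq {A B C D : Type u} [CommRing A] [CommRing B] [CommRing C] [CommRing D]
    {f : A →+* B} {g : B →+* D} {f' : A →+* C} {g' : C →+* D} (h : g.comp f = g'.comp f') :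
    Spec.map (CommRingCat.ofHom g) ≫ Spec.map (CommRingCat.ofHom f) =
      Spec.map (CommRingCat.ofHom g') ≫ Spec.map (CommRingCat.ofHom f') := by
  rw [← Spec.map_comp, ← Spec.map_comp, ← CommRingCat.ofHom_comp, ← CommRingCat.ofHom_comp, h]

/-- The coordinate change between the charts `y₁ = z = 1` and `y₁ = e₁ = 1` commutes with base
change. -/
theorem szToSY_naturality :
    (szToSY (f a₂) (f a₄)).comp (planeMap f (map_chartSZ f a₂ a₄)) =
      (locMap (planeMap f (map_chartSY f a₂ a₄)) (planeMap_snd f _)).comp (szToSY a₂ a₄) := by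
  refine planeRing_hom_ext (fun r => ?_) ?_ ?_
  · simp only [RingHom.comp_apply, planeMap_algebraMap, szToSY, planeLift_algebraMap]
    rw [IsScalarTower.algebraMap_apply k (PlaneRing (chartSY (f a₂) (f a₄))),
      IsScalarTower.algebraMap_apply R (PlaneRing (chartSY a₂ a₄))]
    exact ((locMap_loc _ _ _).trans (by rw [planeMap_algebraMap])).symm
  · simp [szToSY]
  · simp [szToSY]

/-- The coordinate change between the charts `x₁ = z = 1` and `y₁ = z = 1` commutes with base
change. -/
theorem syToTX_naturality :
    (syToTX (f a₂) (f a₄)).comp (planeMap f (map_chartSY f a₂ a₄)) =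
      (locMap (planeMap f (map_chartTX f a₂ a₄)) (planeMap_fst f _)).comp (syToTX a₂ a₄) := by
  refine planeRing_hom_ext (fun r => ?_) ?_ ?_
  · simp only [RingHom.comp_apply, planeMap_algebraMap, syToTX, planeLift_algebraMap]
    rw [IsScalarTower.algebraMap_apply k (PlaneRing (chartTX (f a₂) (f a₄))),
      IsScalarTower.algebraMap_apply R (PlaneRing (chartTX a₂ a₄))]
    exact ((locMap_loc _ _ _).trans (by rw [planeMap_algebraMap])).symm
  · simp [syToTX]
  · simp [syToTX]

theorem locMap_comp_algebraMap {A A' : Type u} [CommRing A] [CommRing A'] (φ : A →+* A') {a : A}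
    {a' : A'} (h : φ a = a') : (locMap φ h).comp (algebraMap A _) = (algebraMap A' _).comp φ :=
  RingHom.ext fun x => locMap_loc φ h x

/-- The open subscheme `y₁ ≠ 0` of the resolved model commutes with base change. -/
theorem exists_isPullback_resolvedModelAux : ∃ F : resolvedModelAux (f a₂) (f a₄) ⟶
    resolvedModelAux a₂ a₄,
    IsPullback F (resolvedModelAuxToBase (f a₂) (f a₄)) (resolvedModelAuxToBase a₂ a₄)
      (Spec.map (CommRingCat.ofHom f)) ∧
    chartSYToAux (f a₂) (f a₄) ≫ F =
      Spec.map (CommRingCat.ofHom (planeMap f (map_chartSY f a₂ a₄))) ≫ chartSYToAux a₂ a₄ := by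
  have h := isGluing_resolvedModelAux a₂ a₄
  have h' := isGluing_resolvedModelAux (f a₂) (f a₄)
  have comm := specMap_comp_eq (szToSY_naturality f a₂ a₄)
  obtain ⟨F, hF₁, hF₂⟩ := h'.exists_desc
    (Spec.map (CommRingCat.ofHom (planeMap f (map_chartSY f a₂ a₄))) ≫ chartSYToAux a₂ a₄)
    (Spec.map (CommRingCat.ofHom (planeMap f (map_chartSZ f a₂ a₄))) ≫ chartSZToAux a₂ a₄) (by
      rw [← reassoc_of% specMap_comp_eq (locMap_comp_algebraMap (planeMap f (map_chartSY f a₂ a₄))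
        (planeMap_snd f (map_chartSY f a₂ a₄))), reassoc_of% comm, h.isPullback.w])
  refine ⟨F, h.isPullback_base h' hF₁ hF₂ ?_ ?_ ?_ (isPullback_spec_locMap _ (planeMap_snd f _))
    comm, hF₁⟩
  · refine h'.hom_ext ?_ ?_
    · rw [reassoc_of% hF₁, chartSYToAux_toBase, reassoc_of% chartSYToAux_toBase]
      exact (isPullback_planeMap f _).w
    · rw [reassoc_of% hF₂, chartSZToAux_toBase, reassoc_of% chartSZToAux_toBase]
      exact (isPullback_planeMap f _).w
  · rw [chartSYToAux_toBase, chartSYToAux_toBase]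
    exact isPullback_planeMap f _
  · rw [chartSZToAux_toBase, chartSZToAux_toBase]
    exact isPullback_planeMap f _

/-- The resolved model commutes with base change. -/
theorem exists_isPullback_resolvedModel : ∃ F : resolvedModel (f a₂) (f a₄) ⟶ resolvedModel a₂ a₄,
    IsPullback F (resolvedModelToBase (f a₂) (f a₄)) (resolvedModelToBase a₂ a₄)
      (Spec.map (CommRingCat.ofHom f)) := by
  have h := isGluing_resolvedModel a₂ a₄
  have h' := isGluing_resolvedModel (f a₂) (f a₄)
  obtain ⟨G, hG, hG'⟩ := exists_isPullback_resolvedModelAux f a₂ a₄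
  have comm : overlapToAux (f a₂) (f a₄) ≫ G = Spec.map (CommRingCat.ofHom
      (locMap (planeMap f (map_chartTX f a₂ a₄)) (planeMap_fst f _))) ≫ overlapToAux a₂ a₄ := by
    rw [overlapToAux, overlapToAux, Category.assoc, hG',
      reassoc_of% specMap_comp_eq (syToTX_naturality f a₂ a₄)]
  obtain ⟨F, hF₁, hF₂⟩ := h'.exists_desc
    (Spec.map (CommRingCat.ofHom (planeMap f (map_chartTX f a₂ a₄))) ≫ chartTXToModel a₂ a₄)
    (G ≫ auxToModel a₂ a₄) (by
      rw [← reassoc_of% specMap_comp_eq (locMap_comp_algebraMap (planeMap f (map_chartTX f a₂ a₄))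
        (planeMap_fst f (map_chartTX f a₂ a₄))), reassoc_of% comm, h.isPullback.w])
  refine ⟨F, h.isPullback_base h' hF₁ hF₂ ?_ ?_ ?_ (isPullback_spec_locMap _ (planeMap_fst f _))
    comm⟩
  · refine h'.hom_ext ?_ ?_
    · rw [reassoc_of% hF₁, chartTXToModel_toBase, reassoc_of% chartTXToModel_toBase]
      exact (isPullback_planeMap f _).w
    · rw [reassoc_of% hF₂, auxToModel_toBase, reassoc_of% auxToModel_toBase]
      exact hG.w
  · rw [chartTXToModel_toBase, chartTXToModel_toBase]
    exact isPullback_planeMap f _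
  · rw [auxToModel_toBase, auxToModel_toBase]
    exact hG

end ModelBaseChange

/-! ### Smooth algebras over a field -/

section SmoothAlgebras

open TensorProduct

/-- An étale algebra over a domain is reduced: it is flat, hence contained in its generic fiber,
which is étale over a field. -/
theorem isReduced_of_isStandardEtale (R S : Type u) [CommRing R] [IsDomain R] [CommRing S]
    [Algebra R S] [Algebra.IsStandardEtale R S] : IsReduced S := by
  have := Algebra.FormallyUnramified.isReduced_of_field (FractionRing R) (FractionRing R ⊗[R] S)
  exact isReduced_of_injective
    (Algebra.TensorProduct.includeRight : S →ₐ[R] FractionRing R ⊗[R] S)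
    (Algebra.TensorProduct.includeRight_injective (IsFractionRing.injective R (FractionRing R)))

/-- A standard étale algebra `S` over a normal domain is integrally closed, tested on square
roots: if `u / v` is a square root of an element of `S`, then it lies in `S`. -/
theorem dvd_of_sq_eq_of_isStandardEtale (R : Type u) {S : Type u} [CommRing R] [IsDomain R]
    [CommRing S] [Algebra R S] [Algebra.IsStandardEtale R S] [IsIntegrallyClosed R] {u v a : S}
    (h : u ^ 2 = a * v ^ 2) (hv : v ∈ nonZeroDivisors S) : v ∣ u := by
  let K := FractionRing R
  have hfin : Module.Finite K (K ⊗[R] S) := Algebra.FormallyUnramified.finite_of_free _ _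
  have : Module.Flat S (S ⊗[R] K) := inferInstance
  -- the generic fiber is a finite algebra over a field, so the nonzerodivisor `v` divides `u` there
  have hsmul (z : S ⊗[R] K) : v • z = (v ⊗ₜ[R] (1 : K)) * z := by
    induction z with
    | zero => simp
    | add x y hx hy => rw [smul_add, mul_add, hx, hy]
    | tmul x y =>
      rw [TensorProduct.smul_tmul', Algebra.TensorProduct.tmul_mul_tmul, one_mul, smul_eq_mul]
  have hinj' : Function.Injective (fun x : S ⊗[R] K => (v ⊗ₜ[R] (1 : K)) * x) := by
    intro x y hxy
    refine Module.Flat.isSMulRegular_of_nonZeroDivisors hv ?_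
    change v • x = v • y
    rw [hsmul, hsmul]
    exact hxy
  let e := Algebra.TensorProduct.comm R K S
  have hinj : Function.Injective (LinearMap.mulLeft K ((1 : K) ⊗ₜ[R] v)) := by
    intro x y hxy
    refine e.injective (hinj' ?_)
    have := congrArg e hxy
    simpa [e] using this
  obtain ⟨q', hq'⟩ := LinearMap.surjective_of_injective hinj ((1 : K) ⊗ₜ[R] u)
  obtain ⟨q, hq⟩ : ∃ q : S ⊗[R] K, (v ⊗ₜ[R] (1 : K)) * q = u ⊗ₜ[R] 1 :=
    ⟨e q', by simpa [e] using congrArg e hq'⟩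
  have hq2 : q ^ 2 = a ⊗ₜ[R] (1 : K) := by
    refine hinj' (hinj' ?_)
    have h₁ : (v ⊗ₜ[R] (1 : K)) * ((v ⊗ₜ[R] (1 : K)) * q ^ 2) = (u ⊗ₜ[R] 1) ^ 2 := by
      rw [← hq]; ring
    refine h₁.trans ?_
    rw [Algebra.TensorProduct.tmul_pow, h]
    simp only [Algebra.TensorProduct.tmul_mul_tmul, one_pow, mul_one]
    congr 1
    ring
  have hint : IsIntegral S q := by
    refine IsIntegral.of_pow two_pos ?_
    rw [hq2]
    exact isIntegral_algebraMap (R := S) (A := S ⊗[R] K) (x := a)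
  -- taking integral closures commutes with smooth base change
  obtain ⟨w, hw⟩ := (TensorProduct.toIntegralClosure_bijective_of_smooth
    (R := R) (S := S) (B := K)).2 ⟨q, hint⟩
  have hw' : (Algebra.TensorProduct.map (AlgHom.id S S) (integralClosure R K).val) w = q :=
    congrArg Subtype.val hw
  have aux : ∀ z : S ⊗[R] integralClosure R K, ∃ s : S,
      (Algebra.TensorProduct.map (AlgHom.id S S) (integralClosure R K).val) z =
        s ⊗ₜ[R] (1 : K) := by
    intro z
    induction z with
    | zero => exact ⟨0, by simp⟩
    | add x y hx hy =>
      obtain ⟨s, hs⟩ := hx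
      obtain ⟨t, ht⟩ := hy
      exact ⟨s + t, by rw [map_add, hs, ht, TensorProduct.add_tmul]⟩
    | tmul x y =>
      obtain ⟨r, hr⟩ := (IsIntegrallyClosed.isIntegral_iff (R := R) (K := K)).mp y.2
      refine ⟨r • x, ?_⟩
      rw [Algebra.TensorProduct.map_tmul, AlgHom.id_apply, Subalgebra.coe_val, ← hr,
        Algebra.algebraMap_eq_smul_one, TensorProduct.smul_tmul]
  -- and `R` is its own integral closure in `K`, so `q` lies in `S`
  obtain ⟨s, hs⟩ := aux w
  rw [hw'] at hs
  refine ⟨s, ?_⟩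
  have hS : Function.Injective (Algebra.TensorProduct.includeLeft : S →ₐ[S] S ⊗[R] K) :=
    Algebra.TensorProduct.includeLeft_injective (IsFractionRing.injective R K)
  refine hS ?_
  simp only [Algebra.TensorProduct.includeLeft_apply]
  rw [← hq, hs, Algebra.TensorProduct.tmul_mul_tmul, mul_one]

/-- An ideal of a smooth algebra is the unit ideal if it contains a power of each `f` for which the
localization away from `f` is étale over a polynomial ring. -/
theorem eq_top_of_forall_isStandardEtale (k : Type u) {S : Type u} [Field k] [CommRing S]
    [Algebra k S] [Algebra.Smooth k S] (I : Ideal S)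
    (h : ∀ (f : S) (n : ℕ) [Algebra (MvPolynomial (Fin n) k) (Localization.Away f)]
      [Algebra.IsStandardEtale (MvPolynomial (Fin n) k) (Localization.Away f)],
      ∃ m : ℕ, f ^ m ∈ I) : I = ⊤ := by
  by_contra H
  obtain ⟨m, hm, e⟩ := Ideal.exists_le_maximal _ H
  obtain ⟨f, hfm, n, _, _, _⟩ :=
    Algebra.IsSmoothAt.exists_isStandardEtale_mvPolynomial (R := k) (p := m)
  obtain ⟨r, hr⟩ := h f n
  exact hfm (hm.isPrime.mem_of_pow_mem r (e hr))

/-- A smooth algebra over a field is reduced, since it is locally étale over a polynomial ring. -/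
theorem isReduced_of_smooth (k S : Type u) [Field k] [CommRing S] [Algebra k S]
    [Algebra.Smooth k S] : IsReduced S := by
  refine ⟨fun x hx => ?_⟩
  have h : LinearMap.ker (LinearMap.toSpanSingleton S S x) = ⊤ := by
    refine eq_top_of_forall_isStandardEtale k _ fun f n _ _ => ?_
    have := isReduced_of_isStandardEtale (MvPolynomial (Fin n) k) (Localization.Away f)
    have h0 := (hx.map (algebraMap S (Localization.Away f))).eq_zero
    obtain ⟨⟨_, m, rfl⟩, hm⟩ := (IsLocalization.map_eq_zero_iff (Submonoid.powers f) _ _).mp h0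
    exact ⟨m, by simpa using hm⟩
  simpa using (Ideal.eq_top_iff_one _).mp h

/-- A smooth algebra over a field is normal, tested on square roots. -/
theorem dvd_of_sq_eq_of_smooth (k : Type u) {S : Type u} [Field k] [CommRing S] [Algebra k S]
    [Algebra.Smooth k S] {u v a : S} (h : u ^ 2 = a * v ^ 2) (hv : v ∈ nonZeroDivisors S) :
    v ∣ u := by
  have key : Submodule.comap (LinearMap.toSpanSingleton S S u) (Ideal.span {v}) = ⊤ := by
    refine eq_top_of_forall_isStandardEtale k _ fun f n _ _ => ?_
    let ι := algebraMap S (Localization.Away f)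
    have hv' : ι v ∈ nonZeroDivisors (Localization.Away f) := by
      rw [mem_nonZeroDivisors_iff_right]
      intro x hx
      refine Module.Flat.isSMulRegular_of_nonZeroDivisors (M := Localization.Away f) hv ?_
      simpa [Algebra.smul_def, mul_comm] using hx
    obtain ⟨w, hw⟩ := dvd_of_sq_eq_of_isStandardEtale (MvPolynomial (Fin n) k)
      (u := ι u) (v := ι v) (a := ι a) (by rw [← map_pow, h, map_mul, map_pow]) hv'
    obtain ⟨⟨w, ⟨_, m, rfl⟩⟩, hm⟩ := IsLocalization.surj (Submonoid.powers f) w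
    have e : ι (f ^ m * u) = ι (v * w) := by
      rw [map_mul, map_mul, hw, ← hm]
      ring
    obtain ⟨⟨_, r, rfl⟩, hr⟩ := (IsLocalization.eq_iff_exists (Submonoid.powers f) _).mp e
    refine ⟨r + m, ?_⟩
    rw [Submodule.mem_comap, LinearMap.toSpanSingleton_apply, smul_eq_mul,
      Ideal.mem_span_singleton]
    exact ⟨f ^ r * w, by linear_combination hr⟩
  simpa [Ideal.mem_span_singleton] using (Ideal.eq_top_iff_one _).mp key

end SmoothAlgebras

/-! ### Smoothness of the divisor `4a₄ = a₂²` -/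

section ResidualDiscriminant

open Polynomial

variable {k A : Type u} [Field k] [NeZero (2 : k)] [CommRing A] [Algebra k A] [Algebra.Smooth k A]

/-- If the chart `xt² = x² + a₂x + a₄` of the resolved model is smooth, then so is the divisor
`4a₄ = a₂²`.  Its points `t = 0`, `x = -a₂/2` are the nodes of the fibers.  By smoothness, this
section over the divisor extends to its first infinitesimal neighborhood, as a map that need not
be compatible with the identity of the base; since the equation is a difference of squares to first
order, it forces `4a₄ - a₂²` to vanish under this map, which is thus a retraction of the
neighborhood to the divisor. -/
theorem smooth_residual (a₂ a₄ : A) [Algebra.Smooth k (PlaneRing (chartTX a₂ a₄))] :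
    Algebra.Smooth k (A ⧸ Ideal.span {4 * a₄ - a₂ ^ 2}) := by
  set δ := 4 * a₄ - a₂ ^ 2 with hδ
  let I : Ideal A := Ideal.span {δ}
  let π := Ideal.Quotient.mkₐ k I
  have hδ0 : π δ = 0 := Ideal.Quotient.eq_zero_iff_mem.mpr (Ideal.mem_span_singleton_self δ)
  obtain ⟨c, hc⟩ : ∃ c : A, 2 * c = 1 := ⟨algebraMap k A 2⁻¹, by
    rw [← map_ofNat (algebraMap k A), ← map_mul, mul_inv_cancel₀ two_ne_zero, map_one]⟩
  -- the section `t = 0`, `x = -a₂/2` over the divisor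
  have hrel : (chartTX a₂ a₄).eval₂ (eval₂RingHom (algebraMap A (A ⧸ I)) 0)
      (-(π c * π a₂)) = 0 := by
    rw [eval_chartTX]
    have h₁ : 2 * π c = 1 := by rw [← map_ofNat π, ← map_mul, hc, map_one]
    have h₂ : 4 * π a₄ - π a₂ ^ 2 = 0 := by
      rw [← hδ0, hδ, map_sub, map_mul, map_pow, map_ofNat]
    change _ - (_ + π a₂ * _ + π a₄) = _
    linear_combination (-π c ^ 2) * h₂ + (-π c * π a₂ ^ 2 + π a₄ * (2 * π c + 1)) * h₁
  let ev₀ : PlaneRing (chartTX a₂ a₄) →+* A ⧸ I := planeLift _ 0 (-(π c * π a₂)) hrel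
  let ev : PlaneRing (chartTX a₂ a₄) →ₐ[k] A ⧸ I := { ev₀ with
    commutes' := fun r => by
      rw [IsScalarTower.algebraMap_apply k A]
      exact planeLift_algebraMap _ _ _ hrel _ }
  have hev₁ : ev (fstCoord _) = 0 := planeLift_fst _ _ _ hrel
  have hev₂ : ev (sndCoord _) = -(π c * π a₂) := planeLift_snd _ _ _ hrel
  have hev₃ : ∀ a, ev (algebraMap A _ a) = π a := planeLift_algebraMap _ _ _ hrel
  let ν := π.kerSquareLift
  have hν : RingHom.ker ν ^ 2 = ⊥ := by
    change RingHom.ker (AlgHom.kerSquareLift π).toRingHom ^ 2 = ⊥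
    rw [AlgHom.ker_kerSquareLift, Ideal.cotangentIdeal_square]
  have hν' : Function.Surjective ν := by
    intro x
    obtain ⟨a, rfl⟩ := Ideal.Quotient.mk_surjective x
    exact ⟨Ideal.Quotient.mk _ a, rfl⟩
  have hmul : ∀ x y, ν x = 0 → ν y = 0 → x * y = 0 := by
    intro x y hx hy
    exact hν.le (pow_two (RingHom.ker ν) ▸ Ideal.mul_mem_mul hx hy)
  -- its extension to the first infinitesimal neighborhood
  let h := Algebra.FormallySmooth.liftOfSurjective ev ν hν' ⟨2, hν⟩
  have hh : ∀ x, ν (h x) = ev x := fun x =>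
    Algebra.FormallySmooth.liftOfSurjective_apply ev ν hν' ⟨2, hν⟩ x
  let α : A →ₐ[k] A ⧸ RingHom.ker π.toRingHom ^ 2 := h.comp (IsScalarTower.toAlgHom k A _)
  have hα : ∀ a, ν (α a) = π a := fun a => (hh _).trans (hev₃ a)
  have hαδ : α δ = 0 := by
    have rel := congrArg h (planeRel (chartTX a₂ a₄))
    rw [eval_chartTX, map_zero] at rel
    simp only [map_sub, map_add, map_mul, map_pow] at rel
    change h (sndCoord _) * h (fstCoord _) ^ 2 -
      (h (sndCoord _) ^ 2 + α a₂ * h (sndCoord _) + α a₄) = 0 at rel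
    have e₁ : h (fstCoord _) * h (fstCoord _) = 0 :=
      hmul _ _ ((hh _).trans hev₁) ((hh _).trans hev₁)
    -- `t` and `x + a₂/2` vanish on the divisor, so their squares vanish on its first
    -- neighborhood, while `4(xt² - (x² + a₂x + a₄)) = 4xt² - (2x + a₂)² - (4a₄ - a₂²)`
    have e₂ : ν (h (sndCoord _) + α c * α a₂) = 0 := by
      rw [map_add, hh, hev₂, map_mul, hα, hα, neg_add_cancel]
    have e₃ := hmul _ _ e₂ e₂
    have e₄ : 2 * α c = 1 := by rw [← map_ofNat α, ← map_mul, hc, map_one]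
    rw [hδ, map_sub, map_mul, map_pow, map_ofNat]
    linear_combination (-4) * rel + 4 * h (sndCoord _) * e₁ - 4 * e₃ +
      (4 * h (sndCoord _) * α a₂ + α a₂ ^ 2 * (2 * α c + 1)) * e₄
  have : Algebra.FormallySmooth k (A ⧸ I) := by
    refine Algebra.FormallySmooth.of_split π (Ideal.Quotient.liftₐ I α fun a ha => ?_) ?_
    · obtain ⟨b, rfl⟩ := Ideal.mem_span_singleton.mp ha
      rw [map_mul, hαδ, zero_mul]
    · ext x
      obtain ⟨a, rfl⟩ := Ideal.Quotient.mk_surjective x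
      exact hα a
  exact { finitePresentation := Algebra.FinitePresentation.quotient ⟨{δ}, by simp⟩ }

end ResidualDiscriminant

/-! ### Smooth fibers -/

section SmoothFibers

open Polynomial

/-- If Newton's method applies to the equation `p(u, v) = 0` to first order, then the plane curve
`p = 0` is smooth: the tautological solution modulo `p` lifts to one modulo `p²`. -/
theorem smooth_planeRing {R : Type u} [CommRing R] (p a b w : R[X][X])
    (h : p.eval₂ (eval₂RingHom (algebraMap R R[X][X]) (C X - p * a)) (X - p * b) = p ^ 2 * w) :
    Algebra.Smooth R (PlaneRing p) := by
  let f : R[X][X] →ₐ[R] PlaneRing p := { AdjoinRoot.mk p with commutes' := fun _ => rfl }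
  have hfp : f p = 0 := AdjoinRoot.mk_self
  have : Algebra.FormallySmooth R R[X][X] := Algebra.FormallySmooth.comp R R[X] R[X][X]
  let q : R[X][X] →ₐ[R] R[X][X] ⧸ RingHom.ker f.toRingHom ^ 2 := Ideal.Quotient.mkₐ R _
  have hq : q (p ^ 2 * w) = 0 := Ideal.Quotient.eq_zero_iff_mem.mpr
    (Ideal.mul_mem_right _ _ (Ideal.pow_mem_pow hfp 2))
  have rel : p.eval₂ (eval₂RingHom (algebraMap R _) (q (C X - p * a))) (q (X - p * b)) = 0 := by
    rw [← hq, ← h, ← AlgHom.coe_toRingHom q, Polynomial.hom_eval₂]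
    congr 1
    refine Polynomial.ringHom_ext (fun r => ?_) ?_
    · simp only [coe_eval₂RingHom, eval₂_C, RingHom.comp_apply]
      exact (q.commutes r).symm
    · simp only [coe_eval₂RingHom, eval₂_X, RingHom.comp_apply]
  let g : PlaneRing p →ₐ[R] R[X][X] ⧸ RingHom.ker f.toRingHom ^ 2 :=
    { planeLift p _ _ rel with commutes' := planeLift_algebraMap p _ _ rel }
  have hν (x : R[X][X]) : f.kerSquareLift (q x) = f x := rfl
  have : Algebra.FormallySmooth R (PlaneRing p) := by
    refine Algebra.FormallySmooth.of_split f g (AlgHom.coe_ringHom_injective ?_)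
    refine planeRing_hom_ext (fun r => ?_) ?_ ?_
    · exact (f.kerSquareLift.comp g).commutes r
    · refine (congrArg f.kerSquareLift (planeLift_fst p _ _ rel)).trans ?_
      rw [hν, map_sub, map_mul, hfp, zero_mul, sub_zero]
      rfl
    · refine (congrArg f.kerSquareLift (planeLift_snd p _ _ rel)).trans ?_
      rw [hν, map_sub, map_mul, hfp, zero_mul, sub_zero]
      rfl
  have : Algebra.FinitePresentation R (PlaneRing p) :=
    have := Algebra.FinitePresentation.trans R R[X] R[X][X]
    Algebra.FinitePresentation.quotient ⟨{p}, by simp⟩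
  exact {}

/-- If two elements of `R[u, v] / (p)` have no common zero, they generate the unit ideal modulo
`p`. -/
theorem exists_bezout {R : Type u} [CommRing R] (p x y : R[X][X])
    (h : ∀ (K : Type u) [Field K] [Algebra R K] (u v : K),
      p.eval₂ (eval₂RingHom (algebraMap R K) u) v = 0 →
      x.eval₂ (eval₂RingHom (algebraMap R K) u) v = 0 →
      y.eval₂ (eval₂RingHom (algebraMap R K) u) v = 0 → False) :
    ∃ a b c : R[X][X], a * x + b * y = 1 + c * p := by
  have key : Ideal.span {x, y, p} = ⊤ := by
    by_contra H
    obtain ⟨m, hm, e⟩ := Ideal.exists_le_maximal _ H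
    let := Ideal.Quotient.field m
    have hφ (z : R[X][X]) : z.eval₂ (eval₂RingHom (algebraMap R (R[X][X] ⧸ m))
        (Ideal.Quotient.mk m (C X))) (Ideal.Quotient.mk m X) = Ideal.Quotient.mk m z := by
      have : eval₂RingHom (eval₂RingHom (algebraMap R (R[X][X] ⧸ m))
          (Ideal.Quotient.mk m (C X))) (Ideal.Quotient.mk m X) = Ideal.Quotient.mk m := by
        refine Polynomial.ringHom_ext (fun r => ?_) (by simp)
        simp only [coe_eval₂RingHom, eval₂_C]
        have : eval₂RingHom (algebraMap R (R[X][X] ⧸ m)) (Ideal.Quotient.mk m (C X)) =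
            (Ideal.Quotient.mk m).comp C := by
          refine Polynomial.ringHom_ext (fun r => ?_) (by simp)
          simp only [coe_eval₂RingHom, eval₂_C]
          rfl
        exact congr($this r)
      exact congr($this z)
    have hz (z : R[X][X]) (hz : z ∈ ({x, y, p} : Set R[X][X])) : z ∈ m := e (Ideal.subset_span hz)
    refine h (R[X][X] ⧸ m) (Ideal.Quotient.mk m (C X)) (Ideal.Quotient.mk m X) ?_ ?_ ?_ <;>
      rw [hφ, Ideal.Quotient.eq_zero_iff_mem] <;> exact hz _ (by simp)
  obtain ⟨a, z, hz, e⟩ := Ideal.mem_span_insert.mp ((Ideal.eq_top_iff_one _).mp key)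
  obtain ⟨b, c, rfl⟩ := Ideal.mem_span_pair.mp hz
  exact ⟨a, b, -c, by linear_combination -e⟩

/-- A property of morphisms that is local on the source may be tested on the pieces of a gluing. -/
theorem IsGluing.of_pieces (P : MorphismProperty Scheme.{u}) [IsZariskiLocalAtSource P]
    {W U V X S : Scheme.{u}} {i : W ⟶ U} {j : W ⟶ V} {a : U ⟶ X} {b : V ⟶ X}
    (h : IsGluing i j a b) {f : X ⟶ S} (ha : P (a ≫ f)) (hb : P (b ≫ f)) : P f := by
  have := h.isOpenImmersion_left
  have := h.isOpenImmersion_right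
  rw [IsZariskiLocalAtSource.iff_of_openCover (P := P) (pairCover a b h.covers)]
  rintro (_ | _)
  · exact hb
  · exact ha

variable {k : Type u} [Field k] [NeZero (2 : k)] {a₂ a₄ : k}

/-- The assumptions on the coefficients are inherited by field extensions. -/
theorem ne_zero_of_disc {K : Type u} [Field K] [Algebra k K] (h : a₄ * (a₂ ^ 2 - 4 * a₄) ≠ 0) :
    (2 : K) ≠ 0 ∧ algebraMap k K a₄ ≠ 0 ∧ algebraMap k K a₂ ^ 2 - 4 * algebraMap k K a₄ ≠ 0 := by
  have h2 : algebraMap k K 2 ≠ 0 := (_root_.map_ne_zero _).mpr two_ne_zero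
  have h' : algebraMap k K (a₄ * (a₂ ^ 2 - 4 * a₄)) ≠ 0 := (_root_.map_ne_zero _).mpr h
  simp only [map_mul, map_sub, map_pow, map_ofNat] at h' h2
  exact ⟨h2, left_ne_zero_of_mul h', right_ne_zero_of_mul h'⟩

/-- The coefficients `a`, `b` of the Newton step satisfy `a ∂p/∂u + b ∂p/∂v = 1 + cp`; the cofactor
of `p²` is then the second-order remainder of the Taylor expansion, minus `c`. -/
theorem smooth_chartTX (h : a₄ * (a₂ ^ 2 - 4 * a₄) ≠ 0) :
    Algebra.Smooth k (PlaneRing (chartTX a₂ a₄)) := by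
  obtain ⟨a, b, c, e⟩ := exists_bezout (R := k) (chartTX a₂ a₄) (2 * X * C X)
    ((C X) ^ 2 - 2 * X - C (C a₂)) (by
      intro K _ _ u v h₀ h₁ h₂
      obtain ⟨n₂, n₄, nδ⟩ := ne_zero_of_disc (K := K) h
      rw [eval_chartTX] at h₀
      simp only [eval₂_mul, eval₂_sub, eval₂_pow, eval₂_X, eval₂_C, eval₂_ofNat,
        coe_eval₂RingHom, mul_eq_zero, n₂, false_or] at h₁ h₂
      obtain rfl | rfl := h₁
      · exact n₄ (by linear_combination -h₀)
      · exact nδ (by linear_combination (-2 * v + -algebraMap k K a₂) * h₂ + 4 * h₀))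
  have hp : chartTX a₂ a₄ = X * (C X) ^ 2 - (X ^ 2 + C (C a₂) * X + C (C a₄)) := rfl
  refine smooth_planeRing _ a b
    (X * a ^ 2 + 2 * a * b * C X - b ^ 2 - chartTX a₂ a₄ * a ^ 2 * b - c) ?_
  rw [eval_chartTX]
  change _ * _ - (_ + C (C a₂) * _ + C (C a₄)) = _
  linear_combination -(chartTX a₂ a₄) * e - hp

theorem smooth_chartSY (h : a₄ * (a₂ ^ 2 - 4 * a₄) ≠ 0) :
    Algebra.Smooth k (PlaneRing (chartSY a₂ a₄)) := by
  obtain ⟨a, b, c, e⟩ := exists_bezout (R := k) (chartSY a₂ a₄)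
    (-3 * (C (X : k[X])) ^ 2 * X ^ 2 - 2 * C (C a₂) * C X * X - C (C a₄))
    (1 - 2 * (C X) ^ 3 * X - C (C a₂) * (C X) ^ 2) (by
      intro K _ _ u v h₀ h₁ h₂
      obtain ⟨n₂, n₄, nδ⟩ := ne_zero_of_disc (K := K) h
      rw [eval_chartSY] at h₀
      simp only [eval₂_mul, eval₂_sub, eval₂_pow, eval₂_X, eval₂_C, eval₂_ofNat, eval₂_neg,
        eval₂_one, coe_eval₂RingHom] at h₁ h₂
      -- `x = uv` satisfies `x² = a₄` and `a₂x = -2a₄`, which implies `a₂²a₄ = 4a₄²`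
      set A₂ := algebraMap k K a₂
      set A₄ := algebraMap k K a₄
      have e₁ : (u * v) ^ 2 - A₄ = 0 := by
        linear_combination (2 * (u * v) + A₂) * u * h₀ - ((u * v) ^ 2 + A₂ * (u * v) + A₄) * h₂
      have e₂ : 2 * A₂ * (u * v) + 4 * A₄ = 0 := by linear_combination -h₁ - 3 * e₁
      refine mul_ne_zero n₂ (mul_ne_zero n₄ nδ) ?_
      linear_combination (A₂ * (u * v) - 2 * A₄) * e₂ - 2 * A₂ ^ 2 * e₁)
  have hp : chartSY a₂ a₄ =
    X - C X * (X ^ 2 * (C X) ^ 2 + C (C a₂) * X * C X + C (C a₄)) := rfl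
  refine smooth_planeRing _ a b (-6 * X * b * C X ^ 2 * a - X * a ^ 2 * C (C a₂) +
    6 * X * chartSY a₂ a₄ * b * C X * a ^ 2 - 2 * X * chartSY a₂ a₄ ^ 2 * b * a ^ 3 -
    3 * X ^ 2 * C X * a ^ 2 + X ^ 2 * chartSY a₂ a₄ * a ^ 3 - 2 * b * C X * a * C (C a₂) -
    b ^ 2 * C X ^ 3 + chartSY a₂ a₄ * b * a ^ 2 * C (C a₂) +
    3 * chartSY a₂ a₄ * b ^ 2 * C X ^ 2 * a - 3 * chartSY a₂ a₄ ^ 2 * b ^ 2 * C X * a ^ 2 +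
    chartSY a₂ a₄ ^ 3 * b ^ 2 * a ^ 3 - c) ?_
  rw [eval_chartSY]
  change _ - _ * (_ + C (C a₂) * _ * _ + C (C a₄)) = _
  set F := chartSY a₂ a₄
  linear_combination -F * e - hp

theorem smooth_chartSZ (h : a₄ * (a₂ ^ 2 - 4 * a₄) ≠ 0) :
    Algebra.Smooth k (PlaneRing (chartSZ a₂ a₄)) := by
  obtain ⟨a, b, c, e⟩ := exists_bezout (R := k) (chartSZ a₂ a₄)
    (-3 * (C (X : k[X])) ^ 2 - 2 * C (C a₂) * C X * X - C (C a₄) * X ^ 2)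
    (1 - C (C a₂) * (C X) ^ 2 - 2 * C (C a₄) * C X * X) (by
      intro K _ _ u v h₀ h₁ h₂
      obtain ⟨n₂, n₄, nδ⟩ := ne_zero_of_disc (K := K) h
      rw [eval_chartSZ] at h₀
      simp only [eval₂_mul, eval₂_sub, eval₂_pow, eval₂_X, eval₂_C, eval₂_ofNat, eval₂_neg,
        eval₂_one, coe_eval₂RingHom] at h₁ h₂
      -- the Euler relation for the homogeneous cubic, whose derivative in the third variable
      -- is `2v`
      have hv : v = 0 := (mul_eq_zero.mp (show 2 * v = 0 by
        linear_combination 3 * h₀ - u * h₁ - v * h₂)).resolve_left n₂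
      subst hv
      have hu : u = 0 := pow_eq_zero_iff three_ne_zero |>.mp (by linear_combination -h₀)
      subst hu
      simp at h₂)
  have hp : chartSZ a₂ a₄ =
    X - C X * ((C X) ^ 2 + C (C a₂) * C X * X + C (C a₄) * X ^ 2) := rfl
  refine smooth_planeRing _ a b (-2 * X * b * a * C (C a₄) - X * a ^ 2 * C (C a₂) -
    2 * b * C X * a * C (C a₂) - b ^ 2 * C X * C (C a₄) - 3 * C X * a ^ 2 +
    chartSZ a₂ a₄ * b * a ^ 2 * C (C a₂) + chartSZ a₂ a₄ * b ^ 2 * a * C (C a₄) +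
    chartSZ a₂ a₄ * a ^ 3 - c) ?_
  rw [eval_chartSZ]
  change _ - _ * (_ + C (C a₂) * _ * _ + C (C a₄) * _) = _
  set F := chartSZ a₂ a₄
  linear_combination -F * e - hp

/-- The resolved model over a field is smooth if the discriminant does not vanish. -/
theorem smooth_resolvedModelToBase (h : a₄ * (a₂ ^ 2 - 4 * a₄) ≠ 0) :
    Smooth (resolvedModelToBase a₂ a₄) := by
  have hS {p : k[X][X]} (hp : Algebra.Smooth k (PlaneRing p)) : Smooth (planeChartToBase p) := by
    refine (HasRingHomProperty.Spec_iff (P := @Smooth)).mpr ?_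
    exact (RingHom.smooth_algebraMap ..).mpr hp
  have : IsZariskiLocalAtSource @Smooth.{u} :=
    HasRingHomProperty.instIsZariskiLocalAtSource (P := @Smooth.{u}) (Q := RingHom.Smooth)
  have h₁ := isGluing_resolvedModel a₂ a₄
  have h₂ := isGluing_resolvedModelAux a₂ a₄
  refine h₁.of_pieces @Smooth ?_ ?_
  · rw [chartTXToModel_toBase]
    exact hS (smooth_chartTX h)
  · rw [auxToModel_toBase]
    refine h₂.of_pieces @Smooth ?_ ?_
    · rw [chartSYToAux_toBase]
      exact hS (smooth_chartSY h)
    · rw [chartSZToAux_toBase]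
      exact hS (smooth_chartSZ h)

end SmoothFibers

/-! ### Affine schemes glued from basic open subschemes -/

section AffineGluing

variable {A T : Type u} [CommRing A] [CommRing T]

/-- If `φ : A → T` is a localization away from `f`, exhibited by an inverse `γ` of the induced map
`A[1/f] → T`, then `Spec T` is the basic open subscheme `D(f)` of `Spec A`. -/
theorem isOpenImmersion_and_range_of_inverse (φ : A →+* T) (f : A) (γ : T →+* Localization.Away f)
    (u : T) (hu : φ f * u = 1) (h₁ : γ.comp φ = algebraMap A _)
    (h₂ : ∀ F : Localization.Away f →+* T, (∀ x, F (loc f x) = φ x) → F (invCoord f) = u →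
      F.comp γ = RingHom.id T) :
    IsOpenImmersion (Spec.map (CommRingCat.ofHom φ)) ∧
      Set.range (Spec.map (CommRingCat.ofHom φ)) =
        (PrimeSpectrum.basicOpen f : Set (PrimeSpectrum A)) := by
  have hf : IsUnit (φ f) := IsUnit.of_mul_eq_one _ hu
  let F := Localization.awayLift φ f hf
  have hF := awayLift_loc f φ hf
  let e : T ≃+* Localization.Away f := RingEquiv.ofRingHom γ F
    (away_hom_ext fun x => by
      rw [RingHom.comp_apply, hF, ← RingHom.comp_apply, h₁]; rfl)
    (h₂ F hF (awayLift_inv f φ hf u hu))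
  let := φ.toAlgebra
  have : IsLocalization.Away f T :=
    IsLocalization.isLocalization_of_algEquiv (Submonoid.powers f)
      (AlgEquiv.ofRingEquiv (f := e.symm) (fun x => hF x) : Localization.Away f ≃ₐ[A] T)
  exact ⟨isOpenImmersion_spec_away f T, range_spec_away f T⟩

/-- An affine scheme is glued from two basic open subschemes that cover it. -/
theorem isGluing_spec {T₁ T₂ : Type u} [CommRing T₁] [CommRing T₂] {φ : A →+* T₁} {ψ : A →+* T₂}
    {f g : A} (hφ : IsOpenImmersion (Spec.map (CommRingCat.ofHom φ)) ∧
      Set.range (Spec.map (CommRingCat.ofHom φ)) =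
        (PrimeSpectrum.basicOpen f : Set (PrimeSpectrum A)))
    (hψ : IsOpenImmersion (Spec.map (CommRingCat.ofHom ψ)) ∧
      Set.range (Spec.map (CommRingCat.ofHom ψ)) =
        (PrimeSpectrum.basicOpen g : Set (PrimeSpectrum A)))
    (hfg : IsCoprime f g) {W : Scheme.{u}} {i : W ⟶ Spec (CommRingCat.of T₁)}
    {j : W ⟶ Spec (CommRingCat.of T₂)} [IsOpenImmersion i]
    (w : i ≫ Spec.map (CommRingCat.ofHom φ) = j ≫ Spec.map (CommRingCat.ofHom ψ))
    (hi : Set.range i = (PrimeSpectrum.basicOpen (φ g) : Set (PrimeSpectrum T₁))) :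
    IsGluing i j (Spec.map (CommRingCat.ofHom φ)) (Spec.map (CommRingCat.ofHom ψ)) := by
  obtain ⟨hφ₁, hφ₂⟩ := hφ
  obtain ⟨hψ₁, hψ₂⟩ := hψ
  refine ⟨hφ₁, hψ₁, (IsOpenImmersion.isPullback _ _ _ _ w ?_).flip, fun x => ?_⟩
  · refine TopologicalSpace.Opens.ext ?_
    refine Eq.trans ?_ hi.symm
    rw [TopologicalSpace.Opens.map_coe]
    refine (congrArg _ hψ₂).trans ?_
    rfl
  · rw [hφ₂, hψ₂]
    by_contra! H
    obtain ⟨u, v, e⟩ := hfg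
    refine x.isPrime.ne_top ((Ideal.eq_top_iff_one _).mpr (e ▸ ?_))
    exact add_mem (Ideal.mul_mem_left _ _ (not_not.mp H.1))
      (Ideal.mul_mem_left _ _ (not_not.mp H.2))

end AffineGluing

/-! ### Nodal fibers -/

section NodalFibers

open Polynomial

section WeierstrassCharts

variable {R : Type u} [CommRing R] (a₂ a₄ : R)

/-- The inclusion of the chart `z = 1` in the Weierstrass model. -/
noncomputable def chartXYToModel : planeChart (chartXY a₂ a₄) ⟶ weierstrassModel a₂ a₄ :=
  pushout.inl _ _

/-- The inclusion of the chart `y = 1` in the Weierstrass model. -/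
noncomputable def chartXZToModel : planeChart (chartXZ a₂ a₄) ⟶ weierstrassModel a₂ a₄ :=
  pushout.inr _ _

theorem isGluing_weierstrassModel : IsGluing
    (Spec.map (CommRingCat.ofHom (algebraMap (PlaneRing (chartXY a₂ a₄))
      (Localization.Away (sndCoord (chartXY a₂ a₄))))))
    (Spec.map (CommRingCat.ofHom (xzToXY a₂ a₄))) (chartXYToModel a₂ a₄)
    (chartXZToModel a₂ a₄) :=
  isGluing_pushout _ _

theorem chartXYToModel_toBase :
    chartXYToModel a₂ a₄ ≫ weierstrassModelToBase a₂ a₄ = planeChartToBase _ :=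
  pushout.inl_desc _ _ _

theorem chartXZToModel_toBase :
    chartXZToModel a₂ a₄ ≫ weierstrassModelToBase a₂ a₄ = planeChartToBase _ :=
  pushout.inr_desc _ _ _

end WeierstrassCharts

variable {k : Type u} [Field k] (r : k)

/-- The chart `x₁ = z = 1` of the resolved model of `y² = x(x + r)²`, as an open subscheme of the
affine curve: `(X, y) = (x + r, xt)`. -/
noncomputable def nodalToTX :
    PlaneRing (chartXY (-r) 0) →+* PlaneRing (chartTX (2 * r) (r ^ 2)) :=
  planeLift _ (sndCoord _ + algebraMap k _ r) (sndCoord _ * fstCoord _) (by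
    have h := planeRel (chartTX (2 * r) (r ^ 2))
    rw [eval_chartTX] at h
    rw [eval_chartXY]
    simp only [map_neg, map_zero, map_mul, map_pow, map_ofNat] at h ⊢
    linear_combination sndCoord (chartTX (2 * r) (r ^ 2)) * h)

/-- The chart `y₁ = z = 1` of the resolved model of `y² = x(x + r)²`, as an open subscheme of the
affine curve: `(X, y) = (ys + r, y)`. -/
noncomputable def nodalToSY :
    PlaneRing (chartXY (-r) 0) →+* PlaneRing (chartSY (2 * r) (r ^ 2)) :=
  planeLift _ (sndCoord _ * fstCoord _ + algebraMap k _ r) (sndCoord _) (by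
    have h := planeRel (chartSY (2 * r) (r ^ 2))
    rw [eval_chartSY] at h
    rw [eval_chartXY]
    simp only [map_neg, map_zero, map_mul, map_pow, map_ofNat] at h ⊢
    linear_combination sndCoord (chartSY (2 * r) (r ^ 2)) * h)

/-- The chart `y₁ = e₁ = 1` of the resolved model of `y² = x(x + r)²`, as a chart of the Weierstrass
model: `(X, z) = (s + rz, z)`. -/
noncomputable def nodalToSZ :
    PlaneRing (chartXZ (-r) 0) →+* PlaneRing (chartSZ (2 * r) (r ^ 2)) :=
  planeLift _ (fstCoord _ + algebraMap k _ r * sndCoord _) (sndCoord _) (by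
    have h := planeRel (chartSZ (2 * r) (r ^ 2))
    rw [eval_chartSZ] at h
    rw [eval_chartXZ]
    simp only [map_neg, map_zero, map_mul, map_pow, map_ofNat] at h ⊢
    linear_combination h)

variable {r}

theorem algebraMap_eq_loc {A : Type u} [CommRing A] [Algebra k A] (f : A) (c : k) :
    algebraMap k (Localization.Away f) c = loc f (algebraMap k A c) :=
  IsScalarTower.algebraMap_apply k A _ c

/-- The chart `x₁ = z = 1` is the locus `x = X - r ≠ 0` of the affine cubic; the inverse of `x` is
`(t² - x - 2r) / r²`. -/
theorem nodalToTX_spec (hr : r ≠ 0) :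
    IsOpenImmersion (Spec.map (CommRingCat.ofHom (nodalToTX r))) ∧
      Set.range (Spec.map (CommRingCat.ofHom (nodalToTX r))) =
        (PrimeSpectrum.basicOpen (fstCoord (chartXY (-r) 0) - algebraMap k _ r) :
          Set (PrimeSpectrum (PlaneRing (chartXY (-r) 0)))) := by
  set f := fstCoord (chartXY (-r) 0) - algebraMap k _ r with hf
  have h := locRel f
  have i := invCoord_mul f
  rw [eval_chartXY] at h
  have i' : (loc f (fstCoord (chartXY (-r) 0)) - algebraMap k _ r) * invCoord f = 1 := by
    rw [← i, algebraMap_eq_loc f, ← map_sub]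
  have rel : (chartTX (2 * r) (r ^ 2)).eval₂ (eval₂RingHom (algebraMap k (Localization.Away f))
      (loc f (sndCoord _) * invCoord f)) (loc f (fstCoord _) - algebraMap k _ r) = 0 := by
    rw [eval_chartTX]
    simp only [map_neg, map_zero, map_mul, map_pow, map_ofNat] at h ⊢
    linear_combination invCoord f * h + (loc f (sndCoord _) ^ 2 * invCoord f +
      loc f (fstCoord _) ^ 2) * i'
  have H := planeRel (chartTX (2 * r) (r ^ 2))
  rw [eval_chartTX] at H
  simp only [map_mul, map_pow, map_ofNat] at H
  have hr' : algebraMap k (PlaneRing (chartTX (2 * r) (r ^ 2))) r * algebraMap k _ r⁻¹ = 1 := by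
    rw [← map_mul, mul_inv_cancel₀ hr, map_one]
  have hu : nodalToTX r f * ((fstCoord _ ^ 2 - sndCoord _ - 2 * algebraMap k _ r) *
      algebraMap k _ r⁻¹ ^ 2) = 1 := by
    simp only [hf, nodalToTX, map_sub, planeLift_fst, planeLift_algebraMap]
    linear_combination algebraMap k _ r⁻¹ ^ 2 * H +
      (algebraMap k (PlaneRing (chartTX (2 * r) (r ^ 2))) r * algebraMap k _ r⁻¹ + 1) * hr'
  refine isOpenImmersion_and_range_of_inverse _ f (planeLift _ _ _ rel) _ hu
    (planeRing_hom_ext (fun c => ?_) ?_ ?_) fun F hF hF' => ?_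
  · simp only [RingHom.comp_apply, nodalToTX, planeLift_algebraMap]
    exact algebraMap_eq_loc f c
  · simp only [RingHom.comp_apply, nodalToTX, planeLift_fst, map_add, planeLift_snd,
      planeLift_algebraMap]
    ring
  · simp only [RingHom.comp_apply, nodalToTX, planeLift_fst, map_mul, planeLift_snd]
    linear_combination loc f (sndCoord _) * i'
  · have hc (c : k) : F (algebraMap k _ c) = algebraMap k _ c := by
      rw [algebraMap_eq_loc f, hF, nodalToTX, planeLift_algebraMap]
    refine planeRing_hom_ext (fun c => ?_) ?_ ?_
    · simp only [RingHom.comp_apply, planeLift_algebraMap, hc, RingHom.id_apply]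
    · simp only [RingHom.comp_apply, planeLift_fst, map_mul, hF, hF', RingHom.id_apply]
      simp only [hf, map_sub] at hu
      simp only [nodalToTX, planeLift_snd, planeLift_fst, planeLift_algebraMap] at hu ⊢
      linear_combination fstCoord _ * hu
    · simp only [RingHom.comp_apply, planeLift_snd, map_sub, hF, hc, RingHom.id_apply]
      simp only [nodalToTX, planeLift_fst]
      ring

/-- The chart `y₁ = z = 1` is the locus `X ≠ 0` of the affine cubic, the complement of the node; the
inverse of `X` is `(1 - s²X) / r`. -/
theorem nodalToSY_spec (hr : r ≠ 0) :
    IsOpenImmersion (Spec.map (CommRingCat.ofHom (nodalToSY r))) ∧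
      Set.range (Spec.map (CommRingCat.ofHom (nodalToSY r))) =
        (PrimeSpectrum.basicOpen (fstCoord (chartXY (-r) 0)) :
          Set (PrimeSpectrum (PlaneRing (chartXY (-r) 0)))) := by
  set f := fstCoord (chartXY (-r) 0) with hf
  have h := locRel f
  have i := invCoord_mul f
  rw [eval_chartXY] at h
  simp only [map_neg, map_zero, ← hf] at h
  have e : loc f (sndCoord (chartXY (-r) 0)) * (loc f (sndCoord _) * invCoord f ^ 2) +
      algebraMap k _ r = loc f f := by
    linear_combination invCoord f ^ 2 * h +
      (loc f f - algebraMap k _ r) * (loc f f * invCoord f + 1) * i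
  have rel : (chartSY (2 * r) (r ^ 2)).eval₂ (eval₂RingHom (algebraMap k (Localization.Away f))
      (loc f (sndCoord _) * invCoord f ^ 2)) (loc f (sndCoord _)) = 0 := by
    rw [eval_chartSY]
    simp only [map_mul, map_pow, map_ofNat]
    set X := loc f f
    set w := invCoord f
    set y := loc f (sndCoord (chartXY (-r) 0))
    set R := algebraMap k (Localization.Away f) r
    linear_combination -(y * w ^ 2) * (y * (y * w ^ 2) + R + X) * e - y * (X * w + 1) * i
  have H := planeRel (chartSY (2 * r) (r ^ 2))
  rw [eval_chartSY] at H
  simp only [map_mul, map_pow, map_ofNat] at H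
  have hr' : algebraMap k (PlaneRing (chartSY (2 * r) (r ^ 2))) r * algebraMap k _ r⁻¹ = 1 := by
    rw [← map_mul, mul_inv_cancel₀ hr, map_one]
  have hu : nodalToSY r f * ((1 - fstCoord _ ^ 2 * (sndCoord _ * fstCoord _ + algebraMap k _ r)) *
      algebraMap k _ r⁻¹) = 1 := by
    simp only [hf, nodalToSY, planeLift_fst]
    linear_combination fstCoord _ * algebraMap k _ r⁻¹ * H + hr'
  refine isOpenImmersion_and_range_of_inverse _ f (planeLift _ _ _ rel) _ hu
    (planeRing_hom_ext (fun c => ?_) ?_ ?_) fun F hF hF' => ?_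
  · simp only [RingHom.comp_apply, nodalToSY, planeLift_algebraMap]
    exact algebraMap_eq_loc f c
  · simp only [RingHom.comp_apply, nodalToSY, planeLift_fst, map_add, planeLift_snd,
      planeLift_algebraMap, map_mul]
    exact e
  · simp only [RingHom.comp_apply, nodalToSY, planeLift_snd]
  · have hc (c : k) : F (algebraMap k _ c) = algebraMap k _ c := by
      rw [algebraMap_eq_loc f, hF, nodalToSY, planeLift_algebraMap]
    refine planeRing_hom_ext (fun c => ?_) ?_ ?_
    · simp only [RingHom.comp_apply, planeLift_algebraMap, hc, RingHom.id_apply]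
    · simp only [RingHom.comp_apply, planeLift_fst, map_mul, map_pow, hF, hF', RingHom.id_apply]
      simp only [hf, nodalToSY, planeLift_snd, planeLift_fst] at hu ⊢
      set s := fstCoord (chartSY (2 * r) (r ^ 2))
      set y := sndCoord (chartSY (2 * r) (r ^ 2))
      set R := algebraMap k (PlaneRing (chartSY (2 * r) (r ^ 2))) r
      set U := (1 - s ^ 2 * (y * s + R)) * algebraMap k _ r⁻¹
      linear_combination U ^ 2 * H + s * ((y * s + R) * U + 1) * hu
    · simp only [RingHom.comp_apply, planeLift_snd, hF, RingHom.id_apply]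
      simp only [nodalToSY, planeLift_snd]

theorem planeChartToBase_comp {R : Type u} [CommRing R] {p q : R[X][X]}
    (φ : PlaneRing p →+* PlaneRing q) (h : ∀ r : R, φ (algebraMap R _ r) = algebraMap R _ r) :
    Spec.map (CommRingCat.ofHom φ) ≫ planeChartToBase p = planeChartToBase q := by
  rw [planeChartToBase, planeChartToBase, ← Spec.map_comp, ← CommRingCat.ofHom_comp]
  congr 2
  exact RingHom.ext h

theorem isIso_spec_of_inverse {A T : Type u} [CommRing A] [CommRing T] (φ : A →+* T) (ψ : T →+* A)
    (h₁ : ψ.comp φ = RingHom.id A) (h₂ : φ.comp ψ = RingHom.id T) :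
    IsIso (Spec.map (CommRingCat.ofHom φ)) :=
  inferInstanceAs (IsIso (Spec.map (RingEquiv.ofRingHom φ ψ h₂ h₁).toCommRingCatIso.hom))

theorem isIso_nodalToSZ : IsIso (Spec.map (CommRingCat.ofHom (nodalToSZ r))) := by
  have rel : (chartSZ (2 * r) (r ^ 2)).eval₂ (eval₂RingHom (algebraMap k
      (PlaneRing (chartXZ (-r) 0))) (fstCoord _ - algebraMap k _ r * sndCoord _))
      (sndCoord _) = 0 := by
    have h := planeRel (chartXZ (-r) 0)
    rw [eval_chartXZ] at h
    rw [eval_chartSZ]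
    simp only [map_neg, map_zero, map_mul, map_pow, map_ofNat] at h ⊢
    linear_combination h
  refine isIso_spec_of_inverse _ (planeLift _ _ _ rel) (planeRing_hom_ext ?_ ?_ ?_)
    (planeRing_hom_ext ?_ ?_ ?_) <;>
  simp [nodalToSZ]

theorem nodalToSY_snd : nodalToSY r (sndCoord _) = sndCoord _ :=
  planeLift_snd _ _ _ _

/-- The charts are isomorphic over `y ≠ 0`, with `s = (X - r) / y`. -/
theorem isIso_locMap_nodalToSY :
    IsIso (Spec.map (CommRingCat.ofHom (locMap (nodalToSY r) nodalToSY_snd))) := by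
  have h := locRel (sndCoord (chartXY (-r) 0))
  have i := invCoord_mul (sndCoord (chartXY (-r) 0))
  rw [eval_chartXY] at h
  simp only [map_neg, map_zero] at h
  set X := loc (sndCoord (chartXY (-r) 0)) (fstCoord (chartXY (-r) 0))
  set R := algebraMap k (Localization.Away (sndCoord (chartXY (-r) 0))) r
  have rel : (chartSY (2 * r) (r ^ 2)).eval₂ (eval₂RingHom
      (algebraMap k (Localization.Away (sndCoord (chartXY (-r) 0))))
      ((X - R) * invCoord (sndCoord (chartXY (-r) 0))))
      (loc (sndCoord (chartXY (-r) 0)) (sndCoord _)) = 0 := by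
    rw [eval_chartSY]
    simp only [map_mul, map_pow, map_ofNat]
    set w := invCoord (sndCoord (chartXY (-r) 0))
    set Y := loc (sndCoord (chartXY (-r) 0)) (sndCoord _)
    change Y - (X - R) * w * (Y ^ 2 * ((X - R) * w) ^ 2 + 2 * R * Y * ((X - R) * w) + R ^ 2) = 0
    linear_combination w * h - (Y + (X - R) ^ 2 * w * (X - R) * (Y * w + 1) +
      2 * R * (X - R) ^ 2 * w) * i
  have j := invCoord_mul (sndCoord (chartSY (2 * r) (r ^ 2)))
  have hunit : IsUnit (planeLift _ _ _ rel (sndCoord _)) := by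
    rw [planeLift_snd]
    exact IsUnit.of_mul_eq_one _ i
  have hinv : Localization.awayLift _ _ hunit (invCoord (sndCoord (chartSY (2 * r) (r ^ 2)))) =
      invCoord (sndCoord (chartXY (-r) 0)) :=
    awayLift_inv _ _ hunit _ (by rw [planeLift_snd]; exact i)
  have hloc := awayLift_loc _ _ hunit
  refine isIso_spec_of_inverse _ (Localization.awayLift _ _ hunit)
    (away_hom_ext fun x => ?_) (away_hom_ext fun x => ?_)
  · rw [RingHom.comp_apply, locMap_loc, hloc]
    refine DFunLike.congr_fun (planeRing_hom_ext (f := (planeLift _ _ _ rel).comp (nodalToSY r))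
      (g := algebraMap _ _) (fun c => ?_) ?_ ?_) x
    · simp only [RingHom.comp_apply, nodalToSY, planeLift_algebraMap]
      exact algebraMap_eq_loc _ c
    · simp only [RingHom.comp_apply, nodalToSY, planeLift_fst, map_add, map_mul, planeLift_snd,
        planeLift_algebraMap]
      linear_combination (X - R) * i
    · simp only [RingHom.comp_apply, nodalToSY, planeLift_snd]
  · rw [RingHom.comp_apply, hloc]
    refine DFunLike.congr_fun (planeRing_hom_ext
      (f := (locMap (nodalToSY r) nodalToSY_snd).comp (planeLift _ _ _ rel))
      (g := algebraMap _ _) (fun c => ?_) ?_ ?_) x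
    · simp only [RingHom.comp_apply, planeLift_algebraMap]
      rw [algebraMap_eq_loc, locMap_loc]
      simp [nodalToSY]
    · simp only [RingHom.comp_apply, planeLift_fst, map_mul, map_sub, X, R]
      rw [locMap_invCoord, algebraMap_eq_loc, locMap_loc, locMap_loc]
      simp only [nodalToSY, planeLift_fst, planeLift_algebraMap, map_add, map_mul]
      linear_combination loc _ (fstCoord (chartSY (2 * r) (r ^ 2))) * j
    · rw [RingHom.comp_apply, planeLift_snd, locMap_loc, nodalToSY_snd]

/-- The resolved model of the nodal cubic `y² = x(x + r)²`, whose node lies away from `x = y = 0`,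
is the cubic itself. -/
theorem isIsoOver_nodal (hr : r ≠ 0) :
    IsIsoOver (resolvedModelToBase (2 * r) (r ^ 2)) (weierstrassModelToBase (-r) 0) := by
  have hw : (algebraMap _ (Localization.Away (fstCoord (chartTX (2 * r) (r ^ 2))))).comp
      (nodalToTX r) = (syToTX (2 * r) (r ^ 2)).comp (nodalToSY r) := by
    have i := invCoord_mul (fstCoord (chartTX (2 * r) (r ^ 2)))
    refine planeRing_hom_ext (fun c => ?_) ?_ ?_
    · simp only [RingHom.comp_apply, nodalToTX, nodalToSY, planeLift_algebraMap, syToTX]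
      exact (algebraMap_eq_loc _ c).symm
    · simp only [RingHom.comp_apply, nodalToTX, nodalToSY, planeLift_fst, syToTX, map_add, map_mul,
        planeLift_snd, planeLift_algebraMap, algebraMap_eq_loc]
      linear_combination -loc _ (sndCoord (chartTX (2 * r) (r ^ 2))) * i
    · simp only [RingHom.comp_apply, nodalToTX, nodalToSY, planeLift_snd, syToTX, map_mul]
  -- the charts `x₁ = z = 1` and `y₁ = z = 1` cover the affine cubic, since `X - (X - r) = r` is
  -- invertible
  have h₁ : IsGluing (Spec.map (CommRingCat.ofHom (algebraMap (PlaneRing (chartTX (2 * r) (r ^ 2)))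
      (Localization.Away (fstCoord (chartTX (2 * r) (r ^ 2)))))))
      (Spec.map (CommRingCat.ofHom (syToTX (2 * r) (r ^ 2))))
      (Spec.map (CommRingCat.ofHom (nodalToTX r)))
      (Spec.map (CommRingCat.ofHom (nodalToSY r))) := by
    refine isGluing_spec (nodalToTX_spec hr) (nodalToSY_spec hr) ?_ (specMap_comp_eq hw) ?_
    · refine ⟨-algebraMap k _ r⁻¹, algebraMap k _ r⁻¹, ?_⟩
      have hr' : algebraMap k (PlaneRing (chartXY (-r) 0)) r * algebraMap k _ r⁻¹ = 1 := by
        rw [← map_mul, mul_inv_cancel₀ hr, map_one]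
      linear_combination hr'
    · refine (range_spec_away (fstCoord (chartTX (2 * r) (r ^ 2))) _).trans ?_
      have H := planeRel (chartTX (2 * r) (r ^ 2))
      rw [eval_chartTX] at H
      simp only [map_mul, map_pow, map_ofNat] at H
      set t := fstCoord (chartTX (2 * r) (r ^ 2))
      set x := sndCoord (chartTX (2 * r) (r ^ 2))
      set R := algebraMap k (PlaneRing (chartTX (2 * r) (r ^ 2))) r with hR
      have e : nodalToTX r (fstCoord _) = x + R := planeLift_fst _ _ _ _
      have hsq : (x + R) ^ 2 = x * t ^ 2 := by linear_combination -H
      rw [e]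
      ext p
      refine not_congr ⟨fun ht => ?_, fun hx => ?_⟩
      · refine p.isPrime.mem_of_pow_mem 2 ?_
        rw [hsq]
        exact Ideal.mul_mem_left _ _ (Ideal.pow_mem_of_mem _ ht 2 two_pos)
      · have : x * t ^ 2 ∈ p.asIdeal := hsq ▸ Ideal.pow_mem_of_mem _ hx 2 two_pos
        refine p.isPrime.mem_of_pow_mem 2 ((p.isPrime.mem_or_mem this).resolve_left fun hx' => ?_)
        refine p.isPrime.ne_top (Ideal.eq_top_of_isUnit_mem _ ?_ ((IsUnit.mk0 r hr).map
          (algebraMap k (PlaneRing (chartTX (2 * r) (r ^ 2))))))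
        simpa using sub_mem hx hx'
  -- reassociate the gluing of the three charts, so that the affine cubic is glued first
  obtain ⟨d, hd₁, hd₂⟩ := h₁.exists_desc (chartTXToModel (2 * r) (r ^ 2))
    (chartSYToAux (2 * r) (r ^ 2) ≫ auxToModel (2 * r) (r ^ 2)) (by
      rw [(isGluing_resolvedModel (2 * r) (r ^ 2)).isPullback.w, overlapToAux, Category.assoc])
  have P₂ := (isGluing_resolvedModel (2 * r) (r ^ 2)).isPushout.flip
  rw [← hd₁, overlapToAux] at P₂
  have P₅ := (isGluing_resolvedModelAux (2 * r) (r ^ 2)).isPushout.flip.paste_vert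
    (P₂.of_left hd₂.symm h₁.isPushout.flip)
  -- the result is the gluing of the two charts of the Weierstrass model
  have P₀ := (isGluing_weierstrassModel (-r) 0).isPushout.flip
  have := isIso_locMap_nodalToSY (r := r)
  have := isIso_nodalToSZ (r := r)
  have P₆ := IsPushout.of_iso P₅
    (asIso (Spec.map (CommRingCat.ofHom (locMap (nodalToSY r) nodalToSY_snd))))
    (asIso (Spec.map (CommRingCat.ofHom (nodalToSZ r)))) (Iso.refl _) (Iso.refl _)
    (f' := Spec.map (CommRingCat.ofHom (xzToXY (-r) 0)))
    (g' := Spec.map (CommRingCat.ofHom (algebraMap (PlaneRing (chartXY (-r) 0))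
        (Localization.Away (sndCoord (chartXY (-r) 0))))))
    (inl' := inv (Spec.map (CommRingCat.ofHom (nodalToSZ r))) ≫ chartSZToAux _ _ ≫ auxToModel _ _)
    (inr' := d) ?_ ?_ ?_ ?_
  · refine ⟨P₆.isoIsPushout _ _ P₀, P₆.hom_ext ?_ ?_⟩
    · rw [P₆.inl_isoIsPushout_hom_assoc]
      rw [chartXZToModel_toBase, Category.assoc, Category.assoc, auxToModel_toBase,
        chartSZToAux_toBase, IsIso.eq_inv_comp]
      exact planeChartToBase_comp _ (planeLift_algebraMap _ _ _ _)
    · rw [P₆.inr_isoIsPushout_hom_assoc]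
      rw [chartXYToModel_toBase]
      refine h₁.hom_ext ?_ ?_
      · rw [reassoc_of% hd₁, chartTXToModel_toBase]
        exact planeChartToBase_comp _ (planeLift_algebraMap _ _ _ _)
      · rw [reassoc_of% hd₂, auxToModel_toBase, chartSYToAux_toBase]
        exact planeChartToBase_comp _ (planeLift_algebraMap _ _ _ _)
  · refine specMap_comp_eq (planeRing_hom_ext (fun c => ?_) ?_ ?_)
    · simp only [RingHom.comp_apply, nodalToSZ, planeLift_algebraMap, szToSY, xzToXY]
      rw [algebraMap_eq_loc, algebraMap_eq_loc, locMap_loc]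
      simp [nodalToSY]
    · have i := invCoord_mul (sndCoord (chartSY (2 * r) (r ^ 2)))
      simp only [RingHom.comp_apply, nodalToSZ, planeLift_fst, planeLift_snd, szToSY, xzToXY,
        map_add, map_mul, planeLift_algebraMap]
      rw [locMap_loc, locMap_invCoord, algebraMap_eq_loc]
      simp only [nodalToSY, planeLift_fst, map_add, map_mul]
      linear_combination -loc _ (fstCoord (chartSY (2 * r) (r ^ 2))) * i
    · simp only [RingHom.comp_apply, nodalToSZ, planeLift_snd, szToSY, xzToXY, locMap_invCoord]
  · rw [Iso.refl_hom, Category.comp_id, asIso_hom]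
    exact specMap_comp_eq (locMap_comp_algebraMap _ _).symm
  · simp
  · simp

end NodalFibers

/-! ### Closed subschemes of a glued scheme -/

section ClosedSubschemes

theorem comap_inf_of_isOpenImmersion {X U : Scheme.{u}} (I J : X.IdealSheafData) (a : U ⟶ X)
    [IsOpenImmersion a] : (I ⊓ J).comap a = I.comap a ⊓ J.comap a := by
  ext V : 2
  simp only [Scheme.IdealSheafData.ideal_comap_of_isOpenImmersion,
    Scheme.IdealSheafData.ideal_inf, Pi.inf_apply, Ideal.comap_inf]

/-- The ideal of the restriction of a closed subscheme is the restriction of its ideal. -/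
theorem comap_ker_of_isPullback {Z Z' X U : Scheme.{u}} {p : Z' ⟶ Z} {f : Z' ⟶ U} {σ : Z ⟶ X}
    {a : U ⟶ X} [IsClosedImmersion σ] (h : IsPullback p f σ a) : σ.ker.comap a = f.ker := by
  rw [← Scheme.IdealSheafData.ker_fst_of_isClosedImmersion, ← h.flip.isoPullback_hom_fst,
    Scheme.Hom.ker_comp_of_isIso]

namespace IsGluing

variable {W U V X : Scheme.{u}} {i : W ⟶ U} {j : W ⟶ V} {a : U ⟶ X} {b : V ⟶ X}

theorem ideal_ext (h : IsGluing i j a b) {I J : X.IdealSheafData} (ha : I.comap a = J.comap a)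
    (hb : I.comap b = J.comap b) : I = J := by
  have := h.isOpenImmersion_left
  have := h.isOpenImmersion_right
  have key {Y : Scheme.{u}} (c : Y ⟶ X) [IsOpenImmersion c] (hc : I.comap c = J.comap c)
      (V : Y.affineOpens) : I.ideal ⟨c ''ᵁ V, V.2.image_of_isOpenImmersion c⟩ =
        J.ideal ⟨c ''ᵁ V, V.2.image_of_isOpenImmersion c⟩ := by
    have e := congrArg (fun K => K.ideal V) hc
    simp only [Scheme.IdealSheafData.ideal_comap_of_isOpenImmersion] at e
    exact Ideal.comap_injective_of_surjective _
      (ConcreteCategory.bijective_of_isIso (c.appIso V).inv).2 e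
  refine Scheme.IdealSheafData.ext_of_iSup_eq_top
    (Sum.elim (fun V : U.affineOpens => ⟨a ''ᵁ V, V.2.image_of_isOpenImmersion a⟩)
      (fun V : V.affineOpens => ⟨b ''ᵁ V, V.2.image_of_isOpenImmersion b⟩)) ?_ ?_
  · refine top_le_iff.mp fun x _ => TopologicalSpace.Opens.mem_iSup.mpr ?_
    obtain ⟨y, rfl⟩ | ⟨y, rfl⟩ := h.covers x
    · obtain ⟨V, hV, hy, -⟩ := U.isBasis_affineOpens.exists_subset_of_mem_open
        (Set.mem_univ y) isOpen_univ
      obtain ⟨V, hV', rfl⟩ := hV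
      exact ⟨Sum.inl ⟨V, hV'⟩, y, hy, rfl⟩
    · obtain ⟨V', hV, hy, -⟩ := V.isBasis_affineOpens.exists_subset_of_mem_open
        (Set.mem_univ y) isOpen_univ
      obtain ⟨V', hV', rfl⟩ := hV
      exact ⟨Sum.inr ⟨V', hV'⟩, y, hy, rfl⟩
  · rintro (V | V)
    · exact key a ha V
    · exact key b hb V

/-- A morphism to a glued scheme is a closed immersion if it is one over each piece. -/
theorem isClosedImmersion (h : IsGluing i j a b) {Z Z₁ Z₂ : Scheme.{u}} {p : Z₁ ⟶ Z} {q : Z₂ ⟶ Z}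
    {f : Z₁ ⟶ U} {g : Z₂ ⟶ V} {σ : Z ⟶ X} (ha : IsPullback p f σ a) (hb : IsPullback q g σ b)
    (hf : IsClosedImmersion f) (hg : IsClosedImmersion g) : IsClosedImmersion σ := by
  have := h.isOpenImmersion_left
  have := h.isOpenImmersion_right
  rw [IsZariskiLocalAtTarget.iff_of_openCover (P := @IsClosedImmersion) (pairCover a b h.covers)]
  rintro (_ | _)
  · change IsClosedImmersion (pullback.snd σ b)
    rw [← hb.isoPullback_inv_snd]
    infer_instance
  · change IsClosedImmersion (pullback.snd σ a)
    rw [← ha.isoPullback_inv_snd]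
    infer_instance

theorem range_snd (h : IsGluing i j a b) : Set.range j = b ⁻¹' Set.range a := by
  ext x
  constructor
  · rintro ⟨w, rfl⟩
    exact ⟨i w, by rw [← Scheme.Hom.comp_apply, h.isPullback.w, Scheme.Hom.comp_apply]⟩
  · rintro ⟨y, hy⟩
    obtain ⟨w, -, hw⟩ := Scheme.Pullback.exists_preimage_pullback y x hy
    exact ⟨h.isPullback.isoPullback.inv w, by
      rw [← hw, ← Scheme.Hom.comp_apply, h.isPullback.isoPullback_inv_snd]⟩

/-- The preimages of the pieces under a morphism that factors through the first piece. -/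
theorem isPullback_comp_left (h : IsGluing i j a b) {Z : Scheme.{u}} (f : Z ⟶ U) :
    IsPullback (𝟙 Z) f (f ≫ a) a := by
  have := h.isOpenImmersion_left
  have := (IsPullback.of_vert_isIso (show CommSq f (𝟙 Z) (𝟙 U) f from ⟨by simp⟩)).flip
  simpa using this.paste_vert (IsKernelPair.id_of_mono a)

theorem isPullback_comp_right (h : IsGluing i j a b) {Z Z' : Scheme.{u}} {f : Z ⟶ U} {p : Z' ⟶ Z}
    {q : Z' ⟶ W} (H : IsPullback p q f i) : IsPullback p (q ≫ j) (f ≫ a) b :=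
  (H.flip.paste_horiz h.isPullback.flip).flip

end IsGluing

/-- The scheme `X` is the union of two closed subschemes `C₀` and `C₁` whose intersection is the
closed subscheme `Z`, all of them given by closed immersions. -/
structure IsUnionMeetingIn {C₀ C₁ Z X : Scheme.{u}} (σ₀ : C₀ ⟶ X) (σ₁ : C₁ ⟶ X) (τ : Z ⟶ X) :
    Prop where
  isClosedImmersion₀ : IsClosedImmersion σ₀
  isClosedImmersion₁ : IsClosedImmersion σ₁
  isClosedImmersion_inter : IsClosedImmersion τ
  ker_inf_ker : σ₀.ker ⊓ σ₁.ker = ⊥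
  ker_sup_ker : σ₀.ker ⊔ σ₁.ker = τ.ker

/-- Being a union with given intersection can be tested on the pieces of a gluing. -/
theorem IsGluing.isUnionMeetingIn {W U V X : Scheme.{u}} {i : W ⟶ U} {j : W ⟶ V} {a : U ⟶ X}
    {b : V ⟶ X} (h : IsGluing i j a b) {C₀ C₁ Z C₀' C₁' Z' C₀'' C₁'' Z'' : Scheme.{u}}
    {σ₀ : C₀ ⟶ X} {σ₁ : C₁ ⟶ X} {τ : Z ⟶ X} {f₀ : C₀' ⟶ U} {f₁ : C₁' ⟶ U} {f : Z' ⟶ U}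
    {g₀ : C₀'' ⟶ V} {g₁ : C₁'' ⟶ V} {g : Z'' ⟶ V}
    {p₀ : C₀' ⟶ C₀} {p₁ : C₁' ⟶ C₁} {p : Z' ⟶ Z} {q₀ : C₀'' ⟶ C₀} {q₁ : C₁'' ⟶ C₁} {q : Z'' ⟶ Z}
    (H₀ : IsPullback p₀ f₀ σ₀ a) (H₁ : IsPullback p₁ f₁ σ₁ a) (H : IsPullback p f τ a)
    (H₀' : IsPullback q₀ g₀ σ₀ b) (H₁' : IsPullback q₁ g₁ σ₁ b) (H' : IsPullback q g τ b)
    (hU : IsUnionMeetingIn f₀ f₁ f) (hV : IsUnionMeetingIn g₀ g₁ g) :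
    IsUnionMeetingIn σ₀ σ₁ τ := by
  have := h.isOpenImmersion_left
  have := h.isOpenImmersion_right
  have c₀ := h.isClosedImmersion H₀ H₀' hU.1 hV.1
  have c₁ := h.isClosedImmersion H₁ H₁' hU.2 hV.2
  have c := h.isClosedImmersion H H' hU.3 hV.3
  refine ⟨c₀, c₁, c, h.ideal_ext ?_ ?_, h.ideal_ext ?_ ?_⟩
  · rw [comap_inf_of_isOpenImmersion, comap_ker_of_isPullback H₀, comap_ker_of_isPullback H₁,
      hU.ker_inf_ker, Scheme.IdealSheafData.comap_bot]
  · rw [comap_inf_of_isOpenImmersion, comap_ker_of_isPullback H₀', comap_ker_of_isPullback H₁',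
      hV.ker_inf_ker, Scheme.IdealSheafData.comap_bot]
  · rw [Scheme.IdealSheafData.comap_sup, comap_ker_of_isPullback H₀, comap_ker_of_isPullback H₁,
      hU.ker_sup_ker, comap_ker_of_isPullback H]
  · rw [Scheme.IdealSheafData.comap_sup, comap_ker_of_isPullback H₀', comap_ker_of_isPullback H₁',
      hV.ker_sup_ker, comap_ker_of_isPullback H']

variable {A T₀ T₁ T : Type u} [CommRing A] [CommRing T₀] [CommRing T₁] [CommRing T]

theorem ker_spec_ideal (φ : A →+* T) :
    (Spec.map (CommRingCat.ofHom φ)).ker.ideal ⟨⊤, isAffineOpen_top _⟩ =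
      (RingHom.ker φ).comap (Scheme.ΓSpecIso (CommRingCat.of A)).hom.hom := by
  rw [Scheme.Hom.ker_apply]
  ext x
  have e := congr($(Scheme.ΓSpecIso_naturality (CommRingCat.ofHom φ)).hom x)
  simp only [CommRingCat.hom_comp, RingHom.comp_apply, CommRingCat.hom_ofHom] at e
  rw [RingHom.mem_ker, Ideal.mem_comap, RingHom.mem_ker]
  refine (map_eq_zero_iff _ (ConcreteCategory.bijective_of_isIso
    (Scheme.ΓSpecIso (CommRingCat.of T)).hom).1).symm.trans ?_
  exact Eq.congr_left e

theorem isUnionMeetingIn_spec {φ₀ : A →+* T₀} {φ₁ : A →+* T₁} {φ : A →+* T}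
    (h₀ : Function.Surjective φ₀) (h₁ : Function.Surjective φ₁) (h : Function.Surjective φ)
    (h_inf : RingHom.ker φ₀ ⊓ RingHom.ker φ₁ = ⊥)
    (h_sup : RingHom.ker φ₀ ⊔ RingHom.ker φ₁ = RingHom.ker φ) :
    IsUnionMeetingIn (Spec.map (CommRingCat.ofHom φ₀)) (Spec.map (CommRingCat.ofHom φ₁))
      (Spec.map (CommRingCat.ofHom φ)) := by
  have hb := ConcreteCategory.bijective_of_isIso (Scheme.ΓSpecIso (CommRingCat.of A)).hom
  refine ⟨.spec_of_surjective _ h₀, .spec_of_surjective _ h₁, .spec_of_surjective _ h,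
    Scheme.IdealSheafData.ext_of_isAffine ?_, Scheme.IdealSheafData.ext_of_isAffine ?_⟩
  · rw [Scheme.IdealSheafData.ideal_inf, Pi.inf_apply, ker_spec_ideal, ker_spec_ideal,
      ← Ideal.comap_inf, h_inf, Scheme.IdealSheafData.ideal_bot]
    refine (RingHom.injective_iff_ker_eq_bot _).mp hb.1
  · rw [Scheme.IdealSheafData.ideal_sup, Pi.sup_apply, ker_spec_ideal, ker_spec_ideal,
      ker_spec_ideal, ← h_sup]
    refine le_antisymm (sup_le (Ideal.comap_mono le_sup_left) (Ideal.comap_mono le_sup_right)) ?_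
    intro x hx
    obtain ⟨y, hy, z, hz, e⟩ := Submodule.mem_sup.mp hx
    obtain ⟨y, rfl⟩ := hb.2 y
    obtain ⟨z, rfl⟩ := hb.2 z
    rw [← map_add] at e
    rw [← hb.1 e]
    exact Submodule.add_mem_sup hy hz

/-- If the projection to `A ⧸ J` factors through `φ`, then `J` contains the kernel of `φ`. -/
theorem ker_eq_of_section (φ : A →+* T) (J : Ideal A) (hJ : J ≤ RingHom.ker φ) (ψ : T →+* A ⧸ J)
    (h : ψ.comp φ = Ideal.Quotient.mk J) : RingHom.ker φ = J := by
  refine le_antisymm (fun x hx => ?_) hJ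
  rw [← Ideal.Quotient.eq_zero_iff_mem, ← h, RingHom.comp_apply, (RingHom.mem_ker).mp hx, map_zero]

/-- An affine curve with equation `xe = 0` is the union of the curves `x = 0` and `e = 0`, provided
that `x` is a nonzerodivisor on the latter. -/
theorem isUnionMeetingIn_spec_of_mul_eq_zero [IsDomain T₁] {φ₀ : A →+* T₀} {φ₁ : A →+* T₁}
    {φ : A →+* T} (h₀ : Function.Surjective φ₀) (h₁ : Function.Surjective φ₁)
    (h : Function.Surjective φ) {x e : A} (hxe : x * e = 0) (hx : φ₁ x ≠ 0)
    (k₀ : RingHom.ker φ₀ = Ideal.span {x}) (k₁ : RingHom.ker φ₁ = Ideal.span {e})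
    (k : RingHom.ker φ = Ideal.span {x, e}) :
    IsUnionMeetingIn (Spec.map (CommRingCat.ofHom φ₀)) (Spec.map (CommRingCat.ofHom φ₁))
      (Spec.map (CommRingCat.ofHom φ)) := by
  refine isUnionMeetingIn_spec h₀ h₁ h ?_ ?_
  · refine eq_bot_iff.mpr fun y hy => ?_
    obtain ⟨hy₀, hy₁⟩ := Submodule.mem_inf.mp hy
    rw [k₀] at hy₀
    obtain ⟨z, rfl⟩ := Ideal.mem_span_singleton.mp hy₀
    have hz : z ∈ RingHom.ker φ₁ := by
      rw [RingHom.mem_ker, map_mul] at hy₁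
      exact (mul_eq_zero.mp hy₁).resolve_left hx
    rw [k₁] at hz
    obtain ⟨w, rfl⟩ := Ideal.mem_span_singleton.mp hz
    rw [← mul_assoc, hxe, zero_mul]
    exact zero_mem _
  · rw [k₀, k₁, k, Ideal.span_insert]

/-- Where only one of the two closed subschemes is present. -/
theorem isUnionMeetingIn_spec_of_subsingleton [Subsingleton T₀] [Subsingleton T] {φ₀ : A →+* T₀}
    {φ₁ : A →+* T₁} {φ : A →+* T} (h₁ : Function.Bijective φ₁) :
    IsUnionMeetingIn (Spec.map (CommRingCat.ofHom φ₀)) (Spec.map (CommRingCat.ofHom φ₁))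
      (Spec.map (CommRingCat.ofHom φ)) := by
  have k₀ : RingHom.ker φ₀ = ⊤ := (Ideal.eq_top_iff_one _).mpr (Subsingleton.elim _ _)
  have k : RingHom.ker φ = ⊤ := (Ideal.eq_top_iff_one _).mpr (Subsingleton.elim _ _)
  refine isUnionMeetingIn_spec (fun _ => ⟨0, Subsingleton.elim _ _⟩) h₁.2
    (fun _ => ⟨0, Subsingleton.elim _ _⟩) ?_ ?_
  · rw [(RingHom.injective_iff_ker_eq_bot _).mp h₁.1, inf_bot_eq]
  · rw [k₀, k, top_sup_eq]

theorem IsUnionMeetingIn.isTwoLinesMeetingIn {k : Type u} [Field k] {X : Scheme.{u}}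
    {f : X ⟶ Spec (CommRingCat.of k)} [Algebra k T] {σ₀ σ₁ : projLine k ⟶ X}
    {τ : Spec (CommRingCat.of T) ⟶ X} (h : IsUnionMeetingIn σ₀ σ₁ τ)
    (h₀ : σ₀ ≫ f = projLineToBase k) (h₁ : σ₁ ≫ f = projLineToBase k)
    (hτ : τ ≫ f = Spec.map (CommRingCat.ofHom (algebraMap k T))) : IsTwoLinesMeetingIn f T := by
  obtain ⟨c₀, c₁, c, h_inf, h_sup⟩ := h
  have key {Z : Scheme.{u}} (σ : Z ⟶ X) [IsClosedImmersion σ] :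
      IsIsoOver (σ.ker.subschemeι ≫ f) (σ ≫ f) := by
    refine ⟨(asIso σ.toImage).symm, ?_⟩
    rw [Iso.symm_hom, asIso_inv, IsIso.inv_comp_eq, σ.toImage_imageι_assoc]
  refine ⟨σ₀.ker, σ₁.ker, h_inf, h₀ ▸ key σ₀, h₁ ▸ key σ₁, ?_⟩
  rw [h_sup, ← hτ]
  exact key τ

end ClosedSubschemes

/-! ### The projective line and the ranges of coordinate changes -/

section Ranges

variable {A B : Type u} [CommRing A] [CommRing B]

/-- In the situation of `isOpenImmersion_of_inverse`, the image of `Spec A[1/a]` in `Spec B` is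
`D(b)`. -/
theorem range_of_inverse (a : A) (b : B)
    (f : B →+* Localization.Away a) (g : A →+* Localization.Away b)
    (b' : Localization.Away a) (hb : f b * b' = 1) (a' : Localization.Away b) (ha : g a * a' = 1)
    (H₁ : ∀ F : Localization.Away a →+* Localization.Away b, (∀ x, F (loc a x) = g x) →
      F (invCoord a) = a' → F.comp f = algebraMap B _)
    (H₂ : ∀ G : Localization.Away b →+* Localization.Away a, (∀ x, G (loc b x) = f x) →
      G (invCoord b) = b' → G.comp g = algebraMap A _) :
    Set.range (Spec.map (CommRingCat.ofHom f)) =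
      (PrimeSpectrum.basicOpen b : Set (PrimeSpectrum B)) := by
  have ug : IsUnit (g a) := IsUnit.of_mul_eq_one _ ha
  refine (isOpenImmersion_and_range_of_inverse f b (Localization.awayLift g a ug) b' hb
    (H₁ _ (awayLift_loc a g ug) (awayLift_inv a g ug a' ha)) fun G hG hG' =>
      away_hom_ext fun x => ?_).2
  rw [RingHom.comp_apply, awayLift_loc, ← RingHom.comp_apply, H₂ G hG hG', RingHom.id_apply]

open Polynomial

variable {k : Type u} [CommRing k] (a₂ a₄ : k)

theorem range_szToSY : Set.range (Spec.map (CommRingCat.ofHom (szToSY a₂ a₄))) =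
    (PrimeSpectrum.basicOpen (sndCoord (chartSZ a₂ a₄)) :
      Set (PrimeSpectrum (PlaneRing (chartSZ a₂ a₄)))) := by
  refine range_of_inverse (sndCoord (chartSY a₂ a₄)) _ _ (syToSZ a₂ a₄) (loc _ (sndCoord _)) ?_
    (loc _ (sndCoord _)) ?_ ?_ ?_
  · simpa [szToSY, mul_comm] using invCoord_mul (sndCoord (chartSY a₂ a₄))
  · simpa [syToSZ, mul_comm] using invCoord_mul (sndCoord (chartSZ a₂ a₄))
  · intro F hF hF'
    refine planeRing_hom_ext (fun r => ?_) ?_ ?_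
    · rw [RingHom.comp_apply, szToSY, planeLift_algebraMap,
        IsScalarTower.algebraMap_apply k (PlaneRing (chartSY a₂ a₄)), hF, syToSZ,
        planeLift_algebraMap, IsScalarTower.algebraMap_apply k (PlaneRing (chartSZ a₂ a₄))]
    · simp only [RingHom.comp_apply, szToSY, planeLift_fst, hF, syToSZ]
    · simp only [RingHom.comp_apply, szToSY, planeLift_snd, hF']
  · intro F hF hF'
    refine planeRing_hom_ext (fun r => ?_) ?_ ?_
    · rw [RingHom.comp_apply, syToSZ, planeLift_algebraMap,
        IsScalarTower.algebraMap_apply k (PlaneRing (chartSZ a₂ a₄)), hF, szToSY,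
        planeLift_algebraMap, IsScalarTower.algebraMap_apply k (PlaneRing (chartSY a₂ a₄))]
    · simp only [RingHom.comp_apply, syToSZ, planeLift_fst, hF, szToSY]
    · simp only [RingHom.comp_apply, syToSZ, planeLift_snd, hF']

theorem range_syToTX : Set.range (Spec.map (CommRingCat.ofHom (syToTX a₂ a₄))) =
    (PrimeSpectrum.basicOpen (fstCoord (chartSY a₂ a₄)) :
      Set (PrimeSpectrum (PlaneRing (chartSY a₂ a₄)))) := by
  have i := invCoord_mul (fstCoord (chartTX a₂ a₄))
  have j := invCoord_mul (fstCoord (chartSY a₂ a₄))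
  refine range_of_inverse (fstCoord (chartTX a₂ a₄)) _ _ (txToSY a₂ a₄) (loc _ (fstCoord _)) ?_
    (loc _ (fstCoord _)) ?_ ?_ ?_
  · simpa [syToTX, mul_comm] using i
  · simpa [txToSY, mul_comm] using j
  · intro F hF hF'
    refine planeRing_hom_ext (fun r => ?_) ?_ ?_
    · rw [RingHom.comp_apply, syToTX, planeLift_algebraMap,
        IsScalarTower.algebraMap_apply k (PlaneRing (chartTX a₂ a₄)), hF, txToSY,
        planeLift_algebraMap, IsScalarTower.algebraMap_apply k (PlaneRing (chartSY a₂ a₄))]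
    · simp only [RingHom.comp_apply, syToTX, planeLift_fst, hF']
    · simp only [RingHom.comp_apply, syToTX, planeLift_snd, hF, map_mul, txToSY, planeLift_fst]
      linear_combination loc _ (sndCoord (chartSY a₂ a₄)) * j
  · intro F hF hF'
    refine planeRing_hom_ext (fun r => ?_) ?_ ?_
    · rw [RingHom.comp_apply, txToSY, planeLift_algebraMap,
        IsScalarTower.algebraMap_apply k (PlaneRing (chartSY a₂ a₄)), hF, syToTX,
        planeLift_algebraMap, IsScalarTower.algebraMap_apply k (PlaneRing (chartTX a₂ a₄))]
    · simp only [RingHom.comp_apply, txToSY, planeLift_fst, hF']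
    · simp only [RingHom.comp_apply, txToSY, planeLift_snd, hF, map_mul, syToTX, planeLift_fst]
      linear_combination loc _ (sndCoord (chartTX a₂ a₄)) * i

variable (k)

theorem lineChange_X : lineChange k X = invCoord X := by simp [lineChange]

theorem lineChange_C (c : k) : lineChange k (C c) = algebraMap k _ c := by simp [lineChange]

theorem range_lineChange : Set.range (Spec.map (CommRingCat.ofHom (lineChange k))) =
    (PrimeSpectrum.basicOpen (X : k[X]) : Set (PrimeSpectrum k[X])) := by
  have h : lineChange k X * loc X X = 1 := by rw [lineChange_X, mul_comm, invCoord_mul]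
  have H (F : Localization.Away (X : k[X]) →+* Localization.Away (X : k[X]))
      (hF : ∀ x, F (loc X x) = lineChange k x) (hF' : F (invCoord X) = loc X X) :
      F.comp (lineChange k) = algebraMap _ _ := by
    refine Polynomial.ringHom_ext (fun c => ?_) ?_
    · rw [RingHom.comp_apply, lineChange_C, IsScalarTower.algebraMap_apply k k[X],
        Polynomial.algebraMap_eq, hF, lineChange_C, IsScalarTower.algebraMap_apply k k[X]]
      rfl
    · rw [RingHom.comp_apply, lineChange_X, hF']
  exact range_of_inverse X X _ (lineChange k) _ h _ h H H

/-- The affine line `X ≠ ∞` in the projective line. -/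
noncomputable def lineZero : Spec (CommRingCat.of k[X]) ⟶ projLine k := pushout.inl _ _

/-- The affine line `X ≠ 0` in the projective line. -/
noncomputable def lineInfty : Spec (CommRingCat.of k[X]) ⟶ projLine k := pushout.inr _ _

theorem isGluing_projLine : IsGluing
    (Spec.map (CommRingCat.ofHom (algebraMap k[X] (Localization.Away (X : k[X])))))
    (Spec.map (CommRingCat.ofHom (lineChange k))) (lineZero k) (lineInfty k) :=
  isGluing_pushout _ _

theorem lineZero_toBase :
    lineZero k ≫ projLineToBase k = Spec.map (CommRingCat.ofHom (algebraMap k k[X])) :=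
  pushout.inl_desc _ _ _

theorem lineInfty_toBase :
    lineInfty k ≫ projLineToBase k = Spec.map (CommRingCat.ofHom (algebraMap k k[X])) :=
  pushout.inr_desc _ _ _

end Ranges

/-! ### The two lines in a fiber with `a₄ = 0` -/

section Lines

open Polynomial

variable {k : Type u} [Field k] (a : k)

/-- The chart `x₁ = z = 1` of the line `x = 0`, with coordinate `t`. -/
noncomputable def zeroLineTX : PlaneRing (chartTX a 0) →+* k[X] :=
  planeLift _ X 0 (by rw [eval_chartTX]; simp)

/-- The chart `y₁ = z = 1` of the line `x = 0`, with coordinate `s`. -/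
noncomputable def zeroLineSY : PlaneRing (chartSY a 0) →+* k[X] :=
  planeLift _ X 0 (by rw [eval_chartSY]; simp)

/-- The chart `x₁ = z = 1` of the line `x = t² - a`, with coordinate `t`. -/
noncomputable def lineTX : PlaneRing (chartTX a 0) →+* k[X] :=
  planeLift _ X (X ^ 2 - C a) (by rw [eval_chartTX, map_zero, Polynomial.algebraMap_eq]; ring)

/-- The chart `y₁ = z = 1` of the line `x = t² - a`, with coordinate `s = 1 / t`. -/
noncomputable def lineSY : PlaneRing (chartSY a 0) →+* Localization.Away (X : k[X]) :=
  planeLift _ (loc X X) (loc X (1 - C a * X ^ 2) * invCoord X ^ 3) (by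
    have i := invCoord_mul (X : k[X])
    rw [eval_chartSY, map_zero, algebraMap_eq_loc, Polynomial.algebraMap_eq]
    simp only [map_sub, map_mul, map_pow, map_one]
    set s := loc (X : k[X]) X
    set w := invCoord (X : k[X])
    set A := loc (X : k[X]) (C a)
    linear_combination (-(1 - A * s ^ 2) ^ 2 * w ^ 3 * (s ^ 2 * w ^ 2 + s * w + 1)) * i)

/-- The chart `y₁ = e₁ = 1` of the line `x = t² - a`, with coordinate `s = 1 / t`. -/
noncomputable def lineSZ :
    PlaneRing (chartSZ a 0) →+* Localization.Away (1 - C a * X ^ 2 : k[X]) :=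
  planeLift _ (loc _ X) (loc _ (X ^ 3) * invCoord _) (by
    have i := invCoord_mul (1 - C a * X ^ 2 : k[X])
    rw [eval_chartSZ, map_zero, algebraMap_eq_loc, Polynomial.algebraMap_eq]
    simp only [map_sub, map_mul, map_pow, map_one] at i ⊢
    linear_combination loc _ X ^ 3 * i)

/-- The intersection of the lines `x = 0` and `x = t² - a`. -/
noncomputable def interTX : PlaneRing (chartTX a 0) →+* AdjoinRoot (X ^ 2 - C a) :=
  planeLift _ (AdjoinRoot.root _) 0 (by rw [eval_chartTX]; simp)

theorem lineSY_algebraMap (c : k) : lineSY a (algebraMap k _ c) = algebraMap k _ c :=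
  planeLift_algebraMap _ _ _ _ _

theorem lineSY_fst : lineSY a (fstCoord _) = loc X X :=
  planeLift_fst _ _ _ _

theorem lineSY_snd : lineSY a (sndCoord _) = loc X (1 - C a * X ^ 2) * invCoord X ^ 3 :=
  planeLift_snd _ _ _ _

theorem isUnit_lineSY : IsUnit (((algebraMap _ (Localization.Away (lineSY a (sndCoord _)))).comp
    (algebraMap k[X] (Localization.Away (X : k[X])))) (1 - C a * X ^ 2)) := by
  refine IsUnit.of_mul_eq_one (loc _ (invCoord X ^ 3) * invCoord _) ?_
  rw [← mul_assoc, RingHom.comp_apply, ← map_mul]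
  exact (congrArg (fun x => loc _ x * invCoord _) (lineSY_snd a).symm).trans (invCoord_mul _)

/-- The inclusion of the overlap of the charts of the line `x = t² - a` in its chart
`y₁ = e₁ = 1`. -/
noncomputable def lineOverlap : Localization.Away (1 - C a * X ^ 2 : k[X]) →+*
    Localization.Away (lineSY a (sndCoord _)) :=
  Localization.awayLift _ _ (isUnit_lineSY a)

/-- The affine line with coordinate `s = 1 / t` is covered by the loci `s ≠ 0` and `1 - as² ≠ 0`, on
which `y` and `z` are regular, respectively; here `y = (1 - as²) / s³` and `z = 1 / y`. -/
theorem isGluing_line : IsGluing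
    (Spec.map (CommRingCat.ofHom (algebraMap _ (Localization.Away (lineSY a (sndCoord _))))))
    (Spec.map (CommRingCat.ofHom (lineOverlap a)))
    (Spec.map (CommRingCat.ofHom (algebraMap k[X] (Localization.Away (X : k[X])))))
    (Spec.map (CommRingCat.ofHom (algebraMap k[X]
      (Localization.Away (1 - C a * X ^ 2 : k[X]))))) := by
  refine isGluing_spec (f := X) (g := 1 - C a * X ^ 2)
    ⟨isOpenImmersion_spec_away (X : k[X]) _, range_spec_away (X : k[X]) _⟩
    ⟨isOpenImmersion_spec_away (1 - C a * X ^ 2 : k[X]) _,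
      range_spec_away (1 - C a * X ^ 2 : k[X]) _⟩ ⟨C a * X, 1, by ring⟩
    (specMap_comp_eq ?_) ?_
  · exact RingHom.ext fun x => (awayLift_loc _ _ (isUnit_lineSY a) x).symm
  · refine (range_spec_away (lineSY a (sndCoord _)) _).trans ?_
    have i := invCoord_mul (X : k[X])
    rw [lineSY_snd]
    ext p
    refine not_congr ⟨fun h => (p.isPrime.mem_or_mem h).resolve_right fun h' => ?_,
      fun h => Ideal.mul_mem_right _ _ h⟩
    refine p.isPrime.ne_top ((Ideal.eq_top_iff_one _).mpr (i ▸ ?_))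
    exact Ideal.mul_mem_left _ _ (p.isPrime.mem_of_pow_mem _ h')

/-- The two charts of the line `x = t² - a` are compatible with `z = 1 / y`. -/
theorem lineOverlap_comp :
    (lineOverlap a).comp (lineSZ a) = (locMap (lineSY a) rfl).comp (szToSY a 0) := by
  have hloc := awayLift_loc _ _ (isUnit_lineSY a)
  have hinv : lineOverlap a (invCoord _) = loc _ (invCoord X ^ 3) * invCoord _ :=
    awayLift_inv _ _ (isUnit_lineSY a) _ (by
      rw [← mul_assoc, RingHom.comp_apply, ← map_mul]
      exact (congrArg (fun x => loc _ x * invCoord _) (lineSY_snd a).symm).trans (invCoord_mul _))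
  refine planeRing_hom_ext (fun c => ?_) ?_ ?_
  · rw [RingHom.comp_apply, RingHom.comp_apply, lineSZ, planeLift_algebraMap, szToSY,
      planeLift_algebraMap, algebraMap_eq_loc, algebraMap_eq_loc, locMap_loc, lineSY_algebraMap]
    refine (hloc _).trans ?_
    rw [algebraMap_eq_loc]
    rfl
  · rw [RingHom.comp_apply, RingHom.comp_apply, lineSZ, planeLift_fst, szToSY,
      planeLift_fst, locMap_loc]
    refine (hloc _).trans ?_
    rw [lineSY_fst]
    rfl
  · rw [RingHom.comp_apply, RingHom.comp_apply, lineSZ, planeLift_snd, szToSY,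
      planeLift_snd, locMap_invCoord, map_mul, hinv]
    refine (congrArg (· * _) (hloc _)).trans ?_
    have i := congrArg (fun x => loc (lineSY a (sndCoord _)) (x ^ 3)) (invCoord_mul (X : k[X]))
    simp only [one_pow, map_one, mul_pow, map_mul] at i
    rw [RingHom.comp_apply, map_pow, ← mul_assoc, i, one_mul]

/-- The part `y₁ ≠ 0` of the line `x = t² - a`. -/
theorem exists_line : ∃ ρ : Spec (CommRingCat.of k[X]) ⟶ resolvedModelAux a 0,
    IsPullback (Spec.map (CommRingCat.ofHom (algebraMap k[X] (Localization.Away (X : k[X])))))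
      (Spec.map (CommRingCat.ofHom (lineSY a))) ρ (chartSYToAux a 0) ∧
    IsPullback (Spec.map (CommRingCat.ofHom (algebraMap k[X]
      (Localization.Away (1 - C a * X ^ 2 : k[X])))))
      (Spec.map (CommRingCat.ofHom (lineSZ a))) ρ (chartSZToAux a 0) := by
  have h := isGluing_resolvedModelAux a 0
  have h' := isGluing_line a
  have HU := isPullback_spec_locMap (lineSY a) (a := sndCoord _) rfl
  obtain ⟨ρ, hρ₁, hρ₂⟩ := h'.exists_desc
    (Spec.map (CommRingCat.ofHom (lineSY a)) ≫ chartSYToAux a 0)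
    (Spec.map (CommRingCat.ofHom (lineSZ a)) ≫ chartSZToAux a 0) (by
      rw [reassoc_of% HU.w, h.isPullback.w, reassoc_of% specMap_comp_eq (lineOverlap_comp a)])
  refine ⟨ρ, h.isPullback_left h' hρ₁ hρ₂ (k := Spec.map (CommRingCat.ofHom
    (locMap (lineSY a) rfl))) ?_, h.symm.isPullback_left h'.symm hρ₂ hρ₁ HU⟩
  have := h'.isOpenImmersion_snd
  refine (IsOpenImmersion.isPullback _ _ _ _ (specMap_comp_eq (lineOverlap_comp a)) ?_).flip
  refine TopologicalSpace.Opens.ext ?_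
  refine Eq.trans ?_ h'.range_snd.symm
  rw [TopologicalSpace.Opens.map_coe]
  refine (congrArg _ (range_szToSY a 0)).trans ?_
  refine Eq.trans ?_ (congrArg _ (range_spec_away (X : k[X]) (Localization.Away (X : k[X])))).symm
  have key (q : Ideal (Localization.Away (1 - C a * X ^ 2 : k[X]))) (hq : q.IsPrime) :
      lineSZ a (sndCoord _) ∈ q ↔ loc _ X ∈ q := by
    have i := invCoord_mul (1 - C a * X ^ 2 : k[X])
    have e : lineSZ a (sndCoord _) = loc _ X ^ 3 * invCoord _ := by
      rw [← map_pow]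
      exact planeLift_snd _ _ _ _
    rw [e]
    refine ⟨fun h => hq.mem_of_pow_mem 3 ((hq.mem_or_mem h).resolve_right fun h' => ?_),
      fun h => Ideal.mul_mem_right _ _ (Ideal.pow_mem_of_mem _ h 3 three_pos)⟩
    exact hq.ne_top ((Ideal.eq_top_iff_one _).mpr (i ▸ Ideal.mul_mem_left _ _ h'))
  ext p
  exact not_congr (key p.asIdeal p.isPrime)

end Lines

/-! ### Local equations of the two lines -/

section Lines

open Polynomial

theorem mem_range_of_polynomial {k A T : Type u} [CommRing k] [CommRing A] [CommRing T]
    (φ : A →+* T) (χ : k[X] →+* T) (hC : ∀ c, χ (C c) ∈ φ.range) (hX : χ X ∈ φ.range) (f : k[X]) :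
    χ f ∈ φ.range := by
  induction f using Polynomial.induction_on with
  | C c => exact hC c
  | add p q hp hq => rw [map_add]; exact add_mem hp hq
  | monomial n c _ => rw [map_mul, map_pow]; exact mul_mem (hC c) (pow_mem hX _)

/-- A map to a localization `T[1/r]` is surjective if its image contains `T` and `1/r`. -/
theorem surjective_away {A T : Type u} [CommRing A] [CommRing T] {r : T}
    (φ : A →+* Localization.Away r) (h : ∀ x, loc r x ∈ φ.range) (hr : invCoord r ∈ φ.range) :
    Function.Surjective φ := by
  intro y
  obtain ⟨⟨x, ⟨_, n, rfl⟩⟩, hx⟩ := IsLocalization.surj (Submonoid.powers r) y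
  have i := congrArg (· ^ n) (invCoord_mul r)
  have e : y = loc r x * invCoord r ^ n := by
    simp only [mul_pow, one_pow] at i
    simp only [map_pow] at hx
    linear_combination invCoord r ^ n * hx - y * i
  rw [e]
  exact mul_mem (h x) (pow_mem hr n)

variable {k : Type u} [Field k] (a : k)

theorem zeroLineTX_algebraMap (c : k) : zeroLineTX a (algebraMap k _ c) = C c :=
  planeLift_algebraMap _ _ _ _ _

theorem zeroLineTX_fst : zeroLineTX a (fstCoord _) = X := planeLift_fst _ _ _ _

theorem zeroLineTX_snd : zeroLineTX a (sndCoord _) = 0 := planeLift_snd _ _ _ _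

theorem zeroLineSY_algebraMap (c : k) : zeroLineSY a (algebraMap k _ c) = C c :=
  planeLift_algebraMap _ _ _ _ _

theorem zeroLineSY_fst : zeroLineSY a (fstCoord _) = X := planeLift_fst _ _ _ _

theorem zeroLineSY_snd : zeroLineSY a (sndCoord _) = 0 := planeLift_snd _ _ _ _

theorem lineTX_algebraMap (c : k) : lineTX a (algebraMap k _ c) = C c :=
  planeLift_algebraMap _ _ _ _ _

theorem lineTX_fst : lineTX a (fstCoord _) = X := planeLift_fst _ _ _ _

theorem lineTX_snd : lineTX a (sndCoord _) = X ^ 2 - C a := planeLift_snd _ _ _ _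

theorem lineSZ_algebraMap (c : k) : lineSZ a (algebraMap k _ c) = loc _ (C c) :=
  (planeLift_algebraMap _ _ _ _ _).trans (algebraMap_eq_loc _ c)

theorem lineSZ_fst : lineSZ a (fstCoord _) = loc _ X := planeLift_fst _ _ _ _

theorem lineSZ_snd : lineSZ a (sndCoord _) = loc _ (X ^ 3) * invCoord _ := planeLift_snd _ _ _ _

theorem interTX_algebraMap (c : k) : interTX a (algebraMap k _ c) = algebraMap k _ c :=
  planeLift_algebraMap _ _ _ _ _

theorem interTX_fst : interTX a (fstCoord _) = AdjoinRoot.root _ := planeLift_fst _ _ _ _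

theorem interTX_snd : interTX a (sndCoord _) = 0 := planeLift_snd _ _ _ _

/-- The intersection of the lines `x = 0` and `x = t² - a` in the chart `y₁ = z = 1`, where it is
the locus `t ≠ 0`. -/
noncomputable def interSY :
    PlaneRing (chartSY a 0) →+* Localization.Away (interTX a (fstCoord _)) :=
  (locMap (interTX a) rfl).comp (syToTX a 0)

theorem interSY_algebraMap (c : k) : interSY a (algebraMap k _ c) = loc _ (algebraMap k _ c) := by
  rw [interSY, RingHom.comp_apply, syToTX, planeLift_algebraMap, algebraMap_eq_loc, locMap_loc,
    interTX_algebraMap]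

theorem interSY_fst : interSY a (fstCoord _) = invCoord _ := by
  rw [interSY, RingHom.comp_apply, syToTX, planeLift_fst, locMap_invCoord]

theorem interSY_snd : interSY a (sndCoord _) = 0 := by
  rw [interSY, RingHom.comp_apply, syToTX, planeLift_snd, map_mul, locMap_loc, interTX_snd]
  exact (congrArg (· * _) (map_zero _)).trans (zero_mul _)

theorem loc_self {A : Type u} [CommRing A] (r : A) : loc r r = loc r (r ^ 2) * invCoord r := by
  simp only [map_pow]
  linear_combination -loc r r * invCoord_mul r

theorem root_sq : AdjoinRoot.root (X ^ 2 - C a) ^ 2 = algebraMap k _ a := by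
  have h := AdjoinRoot.eval₂_root (X ^ 2 - C a : k[X])
  simp only [eval₂_sub, eval₂_pow, eval₂_X, eval₂_C] at h
  exact sub_eq_zero.mp h

/-- In the chart `x₁ = z = 1`, the equation is `x(t² - a - x) = 0`. -/
theorem isUnionMeetingIn_TX : IsUnionMeetingIn (Spec.map (CommRingCat.ofHom (zeroLineTX a)))
    (Spec.map (CommRingCat.ofHom (lineTX a))) (Spec.map (CommRingCat.ofHom (interTX a))) := by
  have H := planeRel (chartTX a 0)
  rw [eval_chartTX, map_zero] at H
  set t := fstCoord (chartTX a 0) with ht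
  set x := sndCoord (chartTX a 0) with hx
  set A := algebraMap k (PlaneRing (chartTX a 0)) a with hA
  have hmk (J : Ideal (PlaneRing (chartTX a 0))) (c : k) :
      Ideal.Quotient.mk J (algebraMap k _ c) = algebraMap k _ c := rfl
  have s₀ : Function.Surjective (zeroLineTX a) := fun f =>
    mem_range_of_polynomial (zeroLineTX a) (RingHom.id _)
      (fun c => ⟨_, zeroLineTX_algebraMap a c⟩) ⟨_, zeroLineTX_fst a⟩ f
  have s₁ : Function.Surjective (lineTX a) := fun f =>
    mem_range_of_polynomial (lineTX a) (RingHom.id _)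
      (fun c => ⟨_, lineTX_algebraMap a c⟩) ⟨_, lineTX_fst a⟩ f
  have s : Function.Surjective (interTX a) := by
    intro f
    obtain ⟨f, rfl⟩ := AdjoinRoot.mk_surjective f
    exact mem_range_of_polynomial (interTX a) (AdjoinRoot.mk _)
      (fun c => ⟨_, interTX_algebraMap a c⟩) ⟨_, interTX_fst a⟩ f
  refine isUnionMeetingIn_spec_of_mul_eq_zero s₀ s₁ s (x := x) (e := t ^ 2 - A - x)
    (by linear_combination H) ?_ ?_ ?_ ?_
  · rw [lineTX_snd]
    exact X_pow_sub_C_ne_zero two_pos a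
  · refine ker_eq_of_section _ _ ?_ (eval₂RingHom (algebraMap k _) (Ideal.Quotient.mk _ t))
      (planeRing_hom_ext (fun c => ?_) ?_ ?_)
    · rw [Ideal.span_singleton_le_iff_mem, RingHom.mem_ker, zeroLineTX_snd]
    · rw [RingHom.comp_apply, zeroLineTX_algebraMap, hmk]
      simp
    · rw [RingHom.comp_apply, zeroLineTX_fst]
      exact eval₂_X _ _
    · rw [RingHom.comp_apply, zeroLineTX_snd, map_zero, eq_comm, Ideal.Quotient.eq_zero_iff_mem]
      exact Ideal.mem_span_singleton_self _
  · refine ker_eq_of_section _ _ ?_ (eval₂RingHom (algebraMap k _) (Ideal.Quotient.mk _ t))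
      (planeRing_hom_ext (fun c => ?_) ?_ ?_)
    · rw [Ideal.span_singleton_le_iff_mem, RingHom.mem_ker, map_sub, map_sub, map_pow, lineTX_snd,
        lineTX_fst, lineTX_algebraMap, sub_self]
    · rw [RingHom.comp_apply, lineTX_algebraMap, hmk]
      simp
    · rw [RingHom.comp_apply, lineTX_fst]
      exact eval₂_X _ _
    · rw [RingHom.comp_apply, lineTX_snd]
      simp only [map_sub, map_pow, coe_eval₂RingHom, eval₂_X, eval₂_C]
      rw [← hmk, ← map_pow, ← map_sub, Ideal.Quotient.eq]
      exact Ideal.mem_span_singleton_self _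
  · have hxJ : Ideal.Quotient.mk (Ideal.span {x, t ^ 2 - A - x}) x = 0 :=
      Ideal.Quotient.eq_zero_iff_mem.mpr (Ideal.subset_span (by simp))
    have heJ : Ideal.Quotient.mk (Ideal.span {x, t ^ 2 - A - x}) (t ^ 2 - A - x) = 0 :=
      Ideal.Quotient.eq_zero_iff_mem.mpr (Ideal.subset_span (by simp))
    refine ker_eq_of_section _ _ ?_ (AdjoinRoot.lift (algebraMap k _) (Ideal.Quotient.mk _ t) ?_)
      (planeRing_hom_ext (fun c => ?_) ?_ ?_)
    · rw [Ideal.span_le]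
      rintro _ (rfl | rfl)
      · exact interTX_snd a
      · rw [SetLike.mem_coe, RingHom.mem_ker, map_sub, map_sub, map_pow, interTX_snd,
          interTX_fst, interTX_algebraMap, sub_zero]
        exact sub_eq_zero.mpr (root_sq a)
    · simp only [eval₂_sub, eval₂_pow, eval₂_X, eval₂_C]
      rw [← hmk, ← map_pow, ← map_sub]
      rw [map_sub, hxJ, sub_zero] at heJ
      exact heJ
    · refine Eq.trans ?_ (hmk _ c).symm
      rw [RingHom.comp_apply, interTX_algebraMap, AdjoinRoot.algebraMap_eq]
      simp
    · rw [RingHom.comp_apply, interTX_fst, AdjoinRoot.lift_root]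
    · rw [RingHom.comp_apply, interTX_snd, map_zero, hxJ]

/-- In the chart `y₁ = z = 1`, the equation is `y(1 - as² - ys³) = 0`.  On the second component, `s`
is invertible with inverse `ys² + as`; on the intersection, it is invertible with inverse `as`. -/
theorem isUnionMeetingIn_SY : IsUnionMeetingIn (Spec.map (CommRingCat.ofHom (zeroLineSY a)))
    (Spec.map (CommRingCat.ofHom (lineSY a))) (Spec.map (CommRingCat.ofHom (interSY a))) := by
  have H := planeRel (chartSY a 0)
  rw [eval_chartSY, map_zero] at H
  have i := invCoord_mul (X : k[X])
  set s := fstCoord (chartSY a 0) with hs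
  set y := sndCoord (chartSY a 0) with hy
  set A := algebraMap k (PlaneRing (chartSY a 0)) a with hA
  have hmk (J : Ideal (PlaneRing (chartSY a 0))) (c : k) :
      Ideal.Quotient.mk J (algebraMap k _ c) = algebraMap k _ c := rfl
  have s₀ : Function.Surjective (zeroLineSY a) := fun f =>
    mem_range_of_polynomial (zeroLineSY a) (RingHom.id _)
      (fun c => ⟨_, zeroLineSY_algebraMap a c⟩) ⟨_, zeroLineSY_fst a⟩ f
  have s₁ : Function.Surjective (lineSY a) := by
    refine surjective_away _ (fun f => mem_range_of_polynomial (lineSY a) (algebraMap k[X] _)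
      (fun c => ⟨_, (lineSY_algebraMap a c).trans (algebraMap_eq_loc _ c)⟩) ⟨_, lineSY_fst a⟩ f)
      ⟨y * s ^ 2 + A * s, ?_⟩
    rw [map_add, map_mul, map_mul, map_pow, lineSY_snd, lineSY_fst, lineSY_algebraMap,
      algebraMap_eq_loc, Polynomial.algebraMap_eq]
    simp only [map_sub, map_mul, map_pow, map_one]
    set S := loc (X : k[X]) X
    set w := invCoord (X : k[X])
    linear_combination ((1 - loc X (C a) * S ^ 2) * w * (S * w + 1) - loc X (C a) * S) * i
  -- `t = a / t`, as `t² = a`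
  have hroot : loc (interTX a (fstCoord _)) (AdjoinRoot.root (X ^ 2 - C a)) =
      loc _ (algebraMap k _ a) * invCoord _ := by
    rw [← root_sq]
    generalize hr : interTX a (fstCoord _) = r
    obtain rfl : r = AdjoinRoot.root _ := hr.symm.trans (interTX_fst a)
    exact loc_self _
  have s₂ : Function.Surjective (interSY a) := by
    refine surjective_away _ (fun f => ?_) ⟨_, interSY_fst a⟩
    obtain ⟨f, rfl⟩ := AdjoinRoot.mk_surjective f
    refine mem_range_of_polynomial (interSY a) ((algebraMap _ _).comp (AdjoinRoot.mk _))
      (fun c => ⟨_, interSY_algebraMap a c⟩) ⟨A * s, ?_⟩ f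
    rw [map_mul, interSY_algebraMap, interSY_fst]
    exact hroot.symm
  have : IsDomain (Localization.Away (X : k[X])) :=
    IsLocalization.isDomain_localization (powers_le_nonZeroDivisors_of_noZeroDivisors X_ne_zero)
  refine isUnionMeetingIn_spec_of_mul_eq_zero s₀ s₁ s₂ (x := y) (e := 1 - A * s ^ 2 - y * s ^ 3)
    (by linear_combination H) ?_ ?_ ?_ ?_
  · rw [lineSY_snd]
    refine mul_ne_zero (fun h => ?_) (pow_ne_zero 3 (right_ne_zero_of_mul_eq_one i))
    have h' := IsLocalization.injective (Localization.Away (X : k[X]))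
      (powers_le_nonZeroDivisors_of_noZeroDivisors X_ne_zero) (h.trans (map_zero _).symm)
    simpa using congrArg (eval 0) h'
  · refine ker_eq_of_section _ _ ?_ (eval₂RingHom (algebraMap k _) (Ideal.Quotient.mk _ s))
      (planeRing_hom_ext (fun c => ?_) ?_ ?_)
    · rw [Ideal.span_singleton_le_iff_mem, RingHom.mem_ker, zeroLineSY_snd]
    · rw [RingHom.comp_apply, zeroLineSY_algebraMap, hmk]
      simp
    · rw [RingHom.comp_apply, zeroLineSY_fst]
      exact eval₂_X _ _
    · rw [RingHom.comp_apply, zeroLineSY_snd, map_zero, eq_comm, Ideal.Quotient.eq_zero_iff_mem]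
      exact Ideal.mem_span_singleton_self _
  · have heJ : Ideal.Quotient.mk (Ideal.span {1 - A * s ^ 2 - y * s ^ 3})
        (1 - A * s ^ 2 - y * s ^ 3) = 0 :=
      Ideal.Quotient.eq_zero_iff_mem.mpr (Ideal.mem_span_singleton_self _)
    set J := Ideal.span {1 - A * s ^ 2 - y * s ^ 3}
    have hu : eval₂RingHom (algebraMap k _) (Ideal.Quotient.mk J s) X *
        Ideal.Quotient.mk J (y * s ^ 2 + A * s) = 1 := by
      simp only [coe_eval₂RingHom, eval₂_X, map_sub, map_mul, map_pow, map_one, map_add] at heJ ⊢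
      linear_combination -heJ
    have hl := awayLift_loc X (eval₂RingHom (algebraMap k _) (Ideal.Quotient.mk J s))
      (IsUnit.of_mul_eq_one _ hu)
    refine ker_eq_of_section _ _ ?_ (Localization.awayLift _ X (IsUnit.of_mul_eq_one _ hu))
      (planeRing_hom_ext (fun c => ?_) ?_ ?_)
    · rw [Ideal.span_singleton_le_iff_mem, RingHom.mem_ker]
      simp only [map_sub, map_mul, map_pow, map_one]
      rw [hs, hy, lineSY_fst, lineSY_snd, hA, lineSY_algebraMap, algebraMap_eq_loc,
        Polynomial.algebraMap_eq]
      simp only [map_sub, map_mul, map_pow, map_one]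
      set S := loc (X : k[X]) X
      set w := invCoord (X : k[X])
      linear_combination (-(1 - loc X (C a) * S ^ 2) * (S ^ 2 * w ^ 2 + S * w + 1)) * i
    · rw [RingHom.comp_apply, lineSY_algebraMap, algebraMap_eq_loc, hl, hmk]
      simp
    · rw [RingHom.comp_apply, lineSY_fst, hl]
      exact eval₂_X _ _
    · rw [RingHom.comp_apply, lineSY_snd, map_mul, map_pow, hl,
        awayLift_inv _ _ (IsUnit.of_mul_eq_one _ hu) _ hu]
      simp only [coe_eval₂RingHom, eval₂_sub, eval₂_mul, eval₂_pow, eval₂_X, eval₂_C,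
        eval₂_one] at hu ⊢
      rw [← hmk J a, ← hA]
      simp only [map_sub, map_mul, map_pow, map_one, map_add] at heJ hu ⊢
      set s' := Ideal.Quotient.mk J s
      set y' := Ideal.Quotient.mk J y
      set A' := Ideal.Quotient.mk J A
      set w := y' * s' ^ 2 + A' * s' with hw
      linear_combination w ^ 3 * heJ + y' * ((s' * w) ^ 2 + s' * w + 1) * hu
  · have heJ : Ideal.Quotient.mk (Ideal.span {y, 1 - A * s ^ 2 - y * s ^ 3})
        (1 - A * s ^ 2 - y * s ^ 3) = 0 :=
      Ideal.Quotient.eq_zero_iff_mem.mpr (Ideal.subset_span (by simp))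
    have hyJ : Ideal.Quotient.mk (Ideal.span {y, 1 - A * s ^ 2 - y * s ^ 3}) y = 0 :=
      Ideal.Quotient.eq_zero_iff_mem.mpr (Ideal.subset_span (by simp))
    have hJ : Ideal.span {y, 1 - A * s ^ 2 - y * s ^ 3} ≤ RingHom.ker (interSY a) := by
      rw [Ideal.span_le]
      rintro _ (rfl | rfl)
      · exact interSY_snd a
      · rw [SetLike.mem_coe, RingHom.mem_ker]
        simp only [map_sub, map_mul, map_pow, map_one]
        rw [hs, hy, hA, interSY_snd, interSY_fst, interSY_algebraMap]
        have i' := invCoord_mul (interTX a (fstCoord _))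
        rw [congrArg (loc (interTX a (fstCoord _))) (interTX_fst a), hroot] at i'
        linear_combination -i'
    set J := Ideal.span {y, 1 - A * s ^ 2 - y * s ^ 3}
    simp only [map_sub, map_mul, map_pow, map_one] at heJ
    have hr : (X ^ 2 - C a).eval₂ (algebraMap k _) (Ideal.Quotient.mk J (A * s)) = 0 := by
      simp only [eval₂_sub, eval₂_pow, eval₂_X, eval₂_C]
      rw [← hmk J a, ← hA, map_mul]
      linear_combination -Ideal.Quotient.mk J A * heJ - Ideal.Quotient.mk J A *
        Ideal.Quotient.mk J s ^ 3 * hyJ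
    have hu : AdjoinRoot.lift (algebraMap k _) (Ideal.Quotient.mk J (A * s)) hr
        (interTX a (fstCoord _)) * Ideal.Quotient.mk J s = 1 := by
      rw [interTX_fst, AdjoinRoot.lift_root, map_mul]
      linear_combination -heJ - Ideal.Quotient.mk J s ^ 3 * hyJ
    refine ker_eq_of_section _ _ hJ (Localization.awayLift _ _ (IsUnit.of_mul_eq_one _ hu))
      (planeRing_hom_ext (fun c => ?_) ?_ ?_)
    · refine Eq.trans ?_ (hmk _ c).symm
      rw [RingHom.comp_apply, interSY_algebraMap, awayLift_loc, AdjoinRoot.algebraMap_eq,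
        AdjoinRoot.lift_of]
    · rw [RingHom.comp_apply, interSY_fst, awayLift_inv _ _ (IsUnit.of_mul_eq_one _ hu) _ hu]
    · rw [RingHom.comp_apply, interSY_snd, map_zero, hyJ]

end Lines

/-! ### Fibers with `a₄ = 0` -/

section Lines

open Polynomial

variable {k : Type u} [Field k] (a : k)

/-- In the chart `y₁ = e₁ = 1`, the fiber consists of the line `x = t² - a` alone. -/
theorem bijective_lineSZ : Function.Bijective (lineSZ a) := by
  have H := planeRel (chartSZ a 0)
  rw [eval_chartSZ, map_zero] at H
  have i := invCoord_mul (1 - C a * X ^ 2 : k[X])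
  set s := fstCoord (chartSZ a 0) with hs
  set z := sndCoord (chartSZ a 0) with hz
  set A := algebraMap k (PlaneRing (chartSZ a 0)) a with hA
  have hu : eval₂RingHom (algebraMap k _) s (1 - C a * X ^ 2) *
      (1 + A * s ^ 2 + A ^ 2 * s * z) = 1 := by
    simp only [coe_eval₂RingHom, eval₂_sub, eval₂_mul, eval₂_pow, eval₂_X, eval₂_C, eval₂_one]
    rw [← hA]
    linear_combination A ^ 2 * s * H
  have hl := awayLift_loc _ _ (IsUnit.of_mul_eq_one _ hu)
  have hi := awayLift_inv _ _ (IsUnit.of_mul_eq_one _ hu) _ hu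
  set ψ := Localization.awayLift _ _ (IsUnit.of_mul_eq_one _ hu)
  have h₁ : ψ.comp (lineSZ a) = RingHom.id _ := by
    refine planeRing_hom_ext (fun c => ?_) ?_ ?_
    · rw [RingHom.comp_apply, lineSZ_algebraMap, hl]
      exact eval₂_C _ _
    · rw [RingHom.comp_apply, lineSZ_fst, hl]
      exact eval₂_X _ _
    · rw [RingHom.comp_apply, lineSZ_snd, map_mul, hl, hi, RingHom.id_apply]
      simp only [coe_eval₂RingHom, eval₂_sub, eval₂_mul, eval₂_pow, eval₂_X, eval₂_C,
        eval₂_one] at hu ⊢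
      rw [← hA] at hu
      rw [← hz]
      linear_combination z * hu - (1 + A * s ^ 2 + A ^ 2 * s * z) * H
  have h₂ : (lineSZ a).comp ψ = RingHom.id _ := by
    refine away_hom_ext fun f => ?_
    rw [RingHom.comp_apply, hl, RingHom.id_apply]
    refine RingHom.congr_fun (f := (lineSZ a).comp (eval₂RingHom (algebraMap k _) s))
      (g := algebraMap _ _) (Polynomial.ringHom_ext (fun c => ?_) ?_) f
    · rw [RingHom.comp_apply]
      exact (congrArg _ (eval₂_C _ _)).trans (lineSZ_algebraMap a c)
    · rw [RingHom.comp_apply]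
      exact (congrArg _ (eval₂_X _ _)).trans (lineSZ_fst a)
  exact ⟨Function.LeftInverse.injective (g := ψ) (RingHom.congr_fun h₁),
    Function.RightInverse.surjective (g := ψ) (RingHom.congr_fun h₂)⟩

/-- The line `x = 0` has no points in the chart `y₁ = e₁ = 1`. -/
theorem isUnionMeetingIn_SZ : IsUnionMeetingIn
    (Spec.map (CommRingCat.ofHom ((locMap (zeroLineSY a) rfl).comp (szToSY a 0))))
    (Spec.map (CommRingCat.ofHom (lineSZ a)))
    (Spec.map (CommRingCat.ofHom ((locMap (interSY a) rfl).comp (szToSY a 0)))) := by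
  have key {T : Type u} [CommRing T] {r : T} (h : r = 0) :
      Subsingleton (Localization.Away r) := by
    refine IsLocalization.subsingleton (M := Submonoid.powers r) ?_
    rw [← h]
    exact Submonoid.mem_powers r
  have := key (zeroLineSY_snd a)
  have := key (interSY_snd a)
  exact isUnionMeetingIn_spec_of_subsingleton (bijective_lineSZ a)

/-- The union of the two lines in the open subscheme `y₁ ≠ 0`. -/
theorem isUnionMeetingIn_aux {ρ : Spec (CommRingCat.of k[X]) ⟶ resolvedModelAux a 0}
    (h₁ : IsPullback
      (Spec.map (CommRingCat.ofHom (algebraMap k[X] (Localization.Away (X : k[X])))))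
      (Spec.map (CommRingCat.ofHom (lineSY a))) ρ (chartSYToAux a 0))
    (h₂ : IsPullback (Spec.map (CommRingCat.ofHom (algebraMap k[X]
        (Localization.Away (1 - C a * X ^ 2 : k[X])))))
      (Spec.map (CommRingCat.ofHom (lineSZ a))) ρ (chartSZToAux a 0)) :
    IsUnionMeetingIn (Spec.map (CommRingCat.ofHom (zeroLineSY a)) ≫ chartSYToAux a 0) ρ
      (Spec.map (CommRingCat.ofHom (interSY a)) ≫ chartSYToAux a 0) := by
  have h := isGluing_resolvedModelAux a 0
  have key {T : Type u} [CommRing T] (φ : PlaneRing (chartSY a 0) →+* T) :=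
    h.isPullback_comp_right (isPullback_spec_locMap φ (a := sndCoord _) rfl)
  simp only [← Spec.map_comp, ← CommRingCat.ofHom_comp] at key
  exact h.isUnionMeetingIn (h.isPullback_comp_left _) h₁ (h.isPullback_comp_left _)
    (key _) h₂ (key _) (isUnionMeetingIn_SY a) (isUnionMeetingIn_SZ a)

/-- A rational curve in the resolved model which meets the chart `x₁ = z = 1` in the graph of a
function of `t`. -/
theorem exists_projLine {a₂ a₄ : k} (u : PlaneRing (chartTX a₂ a₄) →+* k[X])
    (hu : u (fstCoord _) = X) (g : Spec (CommRingCat.of k[X]) ⟶ resolvedModelAux a₂ a₄)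
    (hg : Spec.map (CommRingCat.ofHom (lineChange k)) ≫ g =
      Spec.map (CommRingCat.ofHom (locMap u hu)) ≫ overlapToAux a₂ a₄)
    (hr : ∀ x, g x ∈ Set.range (overlapToAux a₂ a₄) →
      x ∈ (PrimeSpectrum.basicOpen (X : k[X]) : Set (PrimeSpectrum k[X]))) :
    ∃ σ : projLine k ⟶ resolvedModel a₂ a₄,
      IsPullback (lineZero k) (Spec.map (CommRingCat.ofHom u)) σ (chartTXToModel a₂ a₄) ∧
      IsPullback (lineInfty k) g σ (auxToModel a₂ a₄) := by
  have h := isGluing_resolvedModel a₂ a₄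
  have h' := isGluing_projLine k
  have HU := isPullback_spec_locMap u hu
  obtain ⟨σ, hσ₁, hσ₂⟩ := h'.exists_desc
    (Spec.map (CommRingCat.ofHom u) ≫ chartTXToModel a₂ a₄) (g ≫ auxToModel a₂ a₄) (by
      rw [reassoc_of% HU.w, h.isPullback.w, reassoc_of% hg])
  refine ⟨σ, h.isPullback_left h' hσ₁ hσ₂ (k := Spec.map (CommRingCat.ofHom (locMap u hu))) ?_,
    h.symm.isPullback_left h'.symm hσ₂ hσ₁ HU⟩
  have := h.isOpenImmersion_right
  refine (IsOpenImmersion.isPullback _ _ _ _ hg ?_).flip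
  refine TopologicalSpace.Opens.ext (Set.Subset.antisymm ?_ ?_)
  · intro x hx
    exact (Set.ext_iff.mp (range_lineChange k) x).mpr (hr x hx)
  · rintro _ ⟨x, rfl⟩
    exact ⟨Spec.map (CommRingCat.ofHom (locMap u hu)) x, by
      rw [← Scheme.Hom.comp_apply, ← hg, Scheme.Hom.comp_apply]⟩

/-- The projective line `x = 0`, with the affine coordinates `t` and `s = 1 / t`. -/
theorem exists_zeroLine : ∃ σ : projLine k ⟶ resolvedModel a 0,
    IsPullback (lineZero k) (Spec.map (CommRingCat.ofHom (zeroLineTX a))) σ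
      (chartTXToModel a 0) ∧
    IsPullback (lineInfty k) (Spec.map (CommRingCat.ofHom (zeroLineSY a)) ≫ chartSYToAux a 0) σ
      (auxToModel a 0) := by
  refine exists_projLine (zeroLineTX a) (zeroLineTX_fst a) _ ?_ ?_
  · have : (lineChange k).comp (zeroLineSY a) =
        (locMap (zeroLineTX a) (zeroLineTX_fst a)).comp (syToTX a 0) := by
      refine planeRing_hom_ext (fun c => ?_) ?_ ?_
      · rw [RingHom.comp_apply, RingHom.comp_apply, zeroLineSY_algebraMap, lineChange_C, syToTX,
          planeLift_algebraMap, algebraMap_eq_loc, algebraMap_eq_loc, locMap_loc,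
          zeroLineTX_algebraMap]
        rfl
      · rw [RingHom.comp_apply, RingHom.comp_apply, zeroLineSY_fst, lineChange_X, syToTX,
          planeLift_fst, locMap_invCoord]
      · rw [RingHom.comp_apply, RingHom.comp_apply, zeroLineSY_snd, map_zero, syToTX,
          planeLift_snd, map_mul, locMap_loc, zeroLineTX_snd]
        exact ((congrArg (· * _) (map_zero _)).trans (zero_mul _)).symm
    rw [overlapToAux, ← Category.assoc, specMap_comp_eq this, Category.assoc]
  · rintro x ⟨y, hy⟩
    rw [overlapToAux, Scheme.Hom.comp_apply, Scheme.Hom.comp_apply] at hy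
    have hx : Spec.map (CommRingCat.ofHom (zeroLineSY a)) x ∈
        Set.range (Spec.map (CommRingCat.ofHom (syToTX a 0))) :=
      ⟨y, (chartSYToAux a 0).isOpenEmbedding.injective hy⟩
    rw [range_syToTX] at hx
    have hx' : zeroLineSY a (fstCoord _) ∉ x.asIdeal := hx
    rwa [zeroLineSY_fst] at hx'

/-- The projective line `x = t² - a`, with the affine coordinates `t` and `s = 1 / t`. -/
theorem exists_lineModel {ρ : Spec (CommRingCat.of k[X]) ⟶ resolvedModelAux a 0}
    (h : IsPullback
      (Spec.map (CommRingCat.ofHom (algebraMap k[X] (Localization.Away (X : k[X])))))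
      (Spec.map (CommRingCat.ofHom (lineSY a))) ρ (chartSYToAux a 0)) :
    ∃ σ : projLine k ⟶ resolvedModel a 0,
      IsPullback (lineZero k) (Spec.map (CommRingCat.ofHom (lineTX a))) σ
        (chartTXToModel a 0) ∧
      IsPullback (lineInfty k) ρ σ (auxToModel a 0) := by
  refine exists_projLine (lineTX a) (lineTX_fst a) _ ?_ ?_
  · have hu : lineChange k X * loc X X = 1 := by rw [lineChange_X, mul_comm, invCoord_mul]
    have hl := awayLift_loc _ _ (IsUnit.of_mul_eq_one _ hu)
    have hi := awayLift_inv _ _ (IsUnit.of_mul_eq_one _ hu) _ hu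
    set l := Localization.awayLift _ _ (IsUnit.of_mul_eq_one _ hu)
    have e₁ : l.comp (algebraMap k[X] (Localization.Away (X : k[X]))) =
        lineChange k := RingHom.ext hl
    have e₂ : l.comp (lineSY a) =
        (locMap (lineTX a) (lineTX_fst a)).comp (syToTX a 0) := by
      have i := invCoord_mul (X : k[X])
      refine planeRing_hom_ext (fun c => ?_) ?_ ?_
      · rw [RingHom.comp_apply, RingHom.comp_apply, lineSY_algebraMap, algebraMap_eq_loc, hl,
          Polynomial.algebraMap_eq, lineChange_C, syToTX, planeLift_algebraMap, algebraMap_eq_loc,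
          algebraMap_eq_loc, locMap_loc, lineTX_algebraMap]
        rfl
      · rw [RingHom.comp_apply, RingHom.comp_apply, lineSY_fst, hl, lineChange_X, syToTX,
          planeLift_fst, locMap_invCoord]
      · rw [RingHom.comp_apply, RingHom.comp_apply, lineSY_snd, map_mul, hl, map_pow, hi, syToTX,
          planeLift_snd, map_mul, locMap_loc, locMap_loc, lineTX_snd, lineTX_fst]
        simp only [map_sub, map_mul, map_pow, map_one, lineChange_C, lineChange_X]
        rw [algebraMap_eq_loc, Polynomial.algebraMap_eq]
        set S := loc (X : k[X]) X
        set w := invCoord (X : k[X])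
        linear_combination -(loc X (C a) * S * (S * w + 1)) * i
    have : Spec.map (CommRingCat.ofHom l) ≫ Spec.map (CommRingCat.ofHom
        (algebraMap k[X] (Localization.Away (X : k[X])))) =
        Spec.map (CommRingCat.ofHom (lineChange k)) := by
      rw [← Spec.map_comp, ← CommRingCat.ofHom_comp, e₁]
    rw [overlapToAux, ← this, Category.assoc, h.w, ← Category.assoc, specMap_comp_eq e₂,
      Category.assoc]
  · rintro x ⟨y, hy⟩
    rw [overlapToAux, Scheme.Hom.comp_apply] at hy
    obtain ⟨z, hz, -⟩ := Scheme.Pullback.exists_preimage_pullback x _ hy.symm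
    rw [← range_spec_away (X : k[X]) (Localization.Away (X : k[X]))]
    refine ⟨h.isoPullback.inv z, ?_⟩
    rw [← hz, ← Scheme.Hom.comp_apply, h.isoPullback_inv_fst]

theorem IsUnionMeetingIn.comp_inv {X Y C₀ C₁ Z : Scheme.{u}} {σ₀ : C₀ ⟶ Y} {σ₁ : C₁ ⟶ Y} {τ : Z ⟶ Y}
    (h : IsUnionMeetingIn σ₀ σ₁ τ) (e : X ≅ Y) :
    IsUnionMeetingIn (σ₀ ≫ e.inv) (σ₁ ≫ e.inv) (τ ≫ e.inv) := by
  obtain ⟨c₀, c₁, c, h_inf, h_sup⟩ := h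
  have key {C : Scheme.{u}} (σ : C ⟶ Y) [IsClosedImmersion σ] :
      (σ ≫ e.inv).ker = σ.ker.comap e.hom :=
    (comap_ker_of_isPullback (p := 𝟙 C) (IsPullback.of_horiz_isIso ⟨by simp⟩)).symm
  refine ⟨inferInstance, inferInstance, inferInstance, ?_, ?_⟩
  · rw [key, key, ← comap_inf_of_isOpenImmersion, h_inf, Scheme.IdealSheafData.comap_bot]
  · rw [key, key, key, ← Scheme.IdealSheafData.comap_sup, h_sup]

/-- Over a field, the curve with `a₄ = 0` is the union of the lines `x = 0` and `x = t² - a₂`, which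
meet where `t² = a₂`. -/
theorem isTwoLinesMeetingIn_of_isIsoOver {Y : Scheme.{u}} {f : Y ⟶ Spec (CommRingCat.of k)}
    (hf : IsIsoOver f (resolvedModelToBase a 0)) :
    IsTwoLinesMeetingIn f (AdjoinRoot (X ^ 2 - C a)) := by
  obtain ⟨e, rfl⟩ := hf
  obtain ⟨ρ, h₁, h₂⟩ := exists_line a
  obtain ⟨σ₀, H₀, H₀'⟩ := exists_zeroLine a
  obtain ⟨σ₁, H₁, H₁'⟩ := exists_lineModel a h₁
  have h := isGluing_resolvedModel a 0
  have H' := h.isPullback_comp_right (isPullback_spec_locMap (interTX a) (a := fstCoord _) rfl)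
  rw [overlapToAux, ← Category.assoc, ← Spec.map_comp, ← CommRingCat.ofHom_comp] at H'
  have hU := h.isUnionMeetingIn H₀ H₁ (h.isPullback_comp_left _) H₀' H₁' H'
    (isUnionMeetingIn_TX a) (isUnionMeetingIn_aux a h₁ h₂)
  have hS {T : Type u} [CommRing T] [Algebra k T] {p : k[X][X]} (φ : PlaneRing p →+* T)
      (hφ : ∀ c, φ (algebraMap k _ c) = algebraMap k _ c) :
      Spec.map (CommRingCat.ofHom φ) ≫ planeChartToBase p =
        Spec.map (CommRingCat.ofHom (algebraMap k T)) := by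
    rw [planeChartToBase, ← Spec.map_comp, ← CommRingCat.ofHom_comp]
    exact congrArg (fun f => Spec.map (CommRingCat.ofHom f)) (RingHom.ext hφ)
  have h' := isGluing_projLine k
  refine (hU.comp_inv e).isTwoLinesMeetingIn ?_ ?_ ?_ <;>
    rw [Category.assoc, e.inv_hom_id_assoc]
  · refine h'.hom_ext ?_ ?_
    · rw [reassoc_of% H₀.w, chartTXToModel_toBase, lineZero_toBase]
      exact hS _ (zeroLineTX_algebraMap a)
    · rw [reassoc_of% H₀'.w, auxToModel_toBase, chartSYToAux_toBase, lineInfty_toBase]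
      exact hS _ (zeroLineSY_algebraMap a)
  · refine h'.hom_ext ?_ ?_
    · rw [reassoc_of% H₁.w, chartTXToModel_toBase, lineZero_toBase]
      exact hS _ (lineTX_algebraMap a)
    · rw [reassoc_of% H₁'.w, auxToModel_toBase, lineInfty_toBase]
      refine (isGluing_line a).hom_ext ?_ ?_
      · rw [reassoc_of% h₁.w, chartSYToAux_toBase, hS _ (lineSY_algebraMap a), ← Spec.map_comp,
          ← CommRingCat.ofHom_comp]
      · rw [reassoc_of% h₂.w, chartSZToAux_toBase,
          hS _ fun c => (lineSZ_algebraMap a c).trans (algebraMap_eq_loc _ c).symm, ← Spec.map_comp,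
          ← CommRingCat.ofHom_comp]
  · rw [Category.assoc, chartTXToModel_toBase]
    exact hS _ (interTX_algebraMap a)

end Lines

/-! ### Fiber types over a field -/

section FieldFibers

open Polynomial

variable {k : Type u} [Field k] {X Y S : Scheme.{u}}

theorem IsIsoOver.trans {Z : Scheme.{u}} {f : X ⟶ S} {g : Y ⟶ S} {h : Z ⟶ S}
    (H : IsIsoOver f g) (H' : IsIsoOver g h) : IsIsoOver f h := by
  obtain ⟨e, rfl⟩ := H
  obtain ⟨e', rfl⟩ := H'
  exact ⟨e ≪≫ e', by simp⟩

theorem IsIsoOver.smooth {f : X ⟶ S} {g : Y ⟶ S} (H : IsIsoOver f g) [Smooth g] : Smooth f := by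
  obtain ⟨e, rfl⟩ := H
  infer_instance

theorem IsTwoLinesMeetingIn.congr {f : X ⟶ Spec (CommRingCat.of k)} {A A' : Type u} [CommRing A]
    [Algebra k A] [CommRing A'] [Algebra k A'] (e : A ≃ₐ[k] A') (h : IsTwoLinesMeetingIn f A) :
    IsTwoLinesMeetingIn f A' := by
  obtain ⟨I₀, I₁, h, h₀, h₁, h₂⟩ := h
  refine ⟨I₀, I₁, h, h₀, h₁,
    h₂.trans ⟨Scheme.Spec.mapIso e.toRingEquiv.toCommRingCatIso.symm.op, ?_⟩⟩
  refine (Spec.map_comp _ _).symm.trans (congrArg Spec.map ?_)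
  ext c
  exact (e.symm_apply_eq.mpr (e.commutes c).symm)

/-- The algebra `k[X] / (X² - a)` is étale if `2a` is invertible. -/
theorem etale_adjoinRoot [NeZero (2 : k)] {a : k} (ha : a ≠ 0) :
    Algebra.Etale k (AdjoinRoot (Polynomial.X ^ 2 - C a)) := by
  let P : StandardEtalePair k :=
    { f := Polynomial.X ^ 2 - C a
      monic_f := monic_X_pow_sub_C a two_ne_zero
      g := 1
      cond := by
        -- `(X / 2a) (2X) - (X² - a) / a = 1`
        refine ⟨C (2 * a)⁻¹ * Polynomial.X, -C a⁻¹, 0, ?_⟩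
        have h2 : (2 : k) ≠ 0 := two_ne_zero
        have e : C (2 * a)⁻¹ * 2 = (C a⁻¹ : k[X]) := by
          rw [← C_ofNat, ← C_mul]
          congr 1
          field_simp
        have e' : C a⁻¹ * C a = (1 : k[X]) := by
          rw [← C_mul, inv_mul_cancel₀ ha, C_1]
        simp only [derivative_sub, derivative_X_pow, derivative_C, sub_zero, pow_zero]
        simp only [Nat.cast_ofNat, C_ofNat, Nat.reduceSub, pow_one]
        linear_combination Polynomial.X ^ 2 * e + e' }
  have h : IsUnit (AdjoinRoot.mk P.f P.g) := by
    rw [show P.g = 1 from rfl, map_one]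
    exact isUnit_one
  exact .of_equiv (P.equivAwayAdjoinRoot.trans
    ((IsLocalization.atUnit (AdjoinRoot P.f) (Localization.Away (AdjoinRoot.mk P.f P.g)) _
      h).restrictScalars k).symm)

theorem finrank_adjoinRoot (a : k) :
    Module.finrank k (AdjoinRoot (Polynomial.X ^ 2 - C a)) = 2 := by
  have h : (Polynomial.X ^ 2 - C a : k[X]) ≠ 0 := X_pow_sub_C_ne_zero two_pos a
  rw [(AdjoinRoot.powerBasis h).finrank, AdjoinRoot.powerBasis_dim, natDegree_X_pow_sub_C]

/-- The algebra `k[X] / (X²)` is the algebra of dual numbers. -/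
noncomputable def adjoinRootEquivDualNumber :
    AdjoinRoot (Polynomial.X ^ 2 - C (0 : k)) ≃ₐ[k] DualNumber k :=
  AlgEquiv.ofAlgHom
    (AdjoinRoot.liftAlgHom _ (Algebra.ofId k _) DualNumber.eps (by
      simp [pow_two]))
    (DualNumber.lift ⟨(Algebra.ofId k _, AdjoinRoot.root _), by
      exact (pow_two _).symm.trans ((root_sq 0).trans (map_zero _)), fun _ => mul_comm _ _⟩)
    (DualNumber.algHom_ext (by
      rw [AlgHom.comp_apply, DualNumber.lift_apply_eps, AdjoinRoot.liftAlgHom_root]; rfl))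
    (AdjoinRoot.algHom_ext (by
      rw [AlgHom.comp_apply, AdjoinRoot.liftAlgHom_root, DualNumber.lift_apply_eps]; rfl))

variable {f : X ⟶ Spec (CommRingCat.of k)} {a₂ a₄ : k}

theorem isTypeI2_of_isIsoOver [NeZero (2 : k)] (h : IsIsoOver f (resolvedModelToBase a₂ 0))
    (h₂ : a₂ ≠ 0) : IsTypeI2 f :=
  ⟨_, _, _, etale_adjoinRoot h₂, finrank_adjoinRoot a₂, isTwoLinesMeetingIn_of_isIsoOver _ h⟩

theorem isTypeIII_of_isIsoOver (h : IsIsoOver f (resolvedModelToBase (0 : k) 0)) : IsTypeIII f :=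
  (isTwoLinesMeetingIn_of_isIsoOver _ h).congr adjoinRootEquivDualNumber

theorem isTypeI2ns_of_isIsoOver [CharZero k] (h : IsIsoOver f (resolvedModelToBase a₂ 0))
    (h₂ : ¬ IsSquare a₂) : IsTypeI2ns f := by
  have : Fact (Irreducible (Polynomial.X ^ 2 - C a₂)) :=
    ⟨X_pow_sub_C_irreducible_of_prime Nat.prime_two fun b hb => h₂ ⟨b, by rw [← hb, pow_two]⟩⟩
  have : Module.Finite k (AdjoinRoot (Polynomial.X ^ 2 - C a₂)) :=
    Module.finite_of_finrank_pos (by rw [finrank_adjoinRoot]; exact two_pos)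
  exact ⟨_, AdjoinRoot.instField, inferInstance, inferInstance, finrank_adjoinRoot a₂,
    isTwoLinesMeetingIn_of_isIsoOver _ h⟩

theorem isTypeI1_of_isIsoOver [NeZero (2 : k)] (h : IsIsoOver f (resolvedModelToBase a₂ a₄))
    (h₂ : a₂ ≠ 0) (h₄ : 4 * a₄ - a₂ ^ 2 = 0) : IsTypeI1 f := by
  have h2 : (2 : k) ≠ 0 := two_ne_zero
  obtain ⟨r, rfl⟩ : ∃ r, a₂ = 2 * r := ⟨a₂ / 2, by field_simp⟩
  obtain rfl : a₄ = r ^ 2 := by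
    refine mul_left_cancel₀ (mul_ne_zero h2 h2) ?_
    linear_combination h₄
  have hr : r ≠ 0 := right_ne_zero_of_mul h₂
  exact ⟨-r, neg_ne_zero.mpr hr, h.trans (isIsoOver_nodal hr)⟩

end FieldFibers

/-! ### Reduced divisors -/

section ReducedDivisors

variable {A : Type u} [CommRing A]

/-- A reduced divisor is regular at its generic points. -/
theorem maximalIdeal_eq_span_of_mem_minimalPrimes {s : A} (hs : (Ideal.span {s}).IsRadical)
    {P : Ideal A} [P.IsPrime] (hP : P ∈ (Ideal.span {s}).minimalPrimes) {O : Type u} [CommRing O]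
    [IsLocalRing O] [Algebra A O] [IsLocalization.AtPrime O P] :
    IsLocalRing.maximalIdeal O = Ideal.span {algebraMap A O s} := by
  rw [← IsLocalization.AtPrime.map_eq_maximalIdeal P O,
    ← IsLocalization.AtPrime.radical_map_of_mem_minimalPrimes O P _ hP,
    ← IsLocalization.map_radical P.primeCompl, hs.radical, Ideal.map_span, Set.image_singleton]

/-- An element that lies in no minimal prime of a radical ideal is a nonzerodivisor modulo it. -/
theorem mem_of_mul_mem_of_notMem_minimalPrimes {I : Ideal A} (hI : I.IsRadical) {d : A}
    (hd : ∀ P ∈ I.minimalPrimes, d ∉ P) {x : A} (h : d * x ∈ I) : x ∈ I := by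
  rw [← hI.radical, ← Ideal.sInf_minimalPrimes, Ideal.mem_sInf]
  intro P hP
  exact (hP.1.1.mem_or_mem (hP.1.2 h)).resolve_left (hd P hP)

/-- If `a = 0` and `d = 0` are reduced divisors without common component, then `ad = 0` is the
reduced divisor underlying `a²d = 0`. -/
theorem radical_span_sq_mul {a d : A} (ha : (Ideal.span {a}).IsRadical)
    (hd : (Ideal.span {d}).IsRadical)
    (h : ∀ x, d * x ∈ Ideal.span {a} → x ∈ Ideal.span {a}) :
    (Ideal.span {a ^ 2 * d}).radical = Ideal.span {a * d} := by
  refine le_antisymm ?_ ?_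
  · rintro x ⟨n, hx⟩
    rw [Ideal.mem_span_singleton] at hx
    obtain ⟨y, rfl⟩ := Ideal.mem_span_singleton.mp (hd ⟨n, Ideal.mem_span_singleton.mpr
      ((Dvd.intro_left _ rfl).trans hx)⟩)
    obtain ⟨z, rfl⟩ := Ideal.mem_span_singleton.mp (h y (ha ⟨n, Ideal.mem_span_singleton.mpr
      ((Dvd.intro (a * d) (by ring)).trans hx)⟩))
    exact Ideal.mem_span_singleton.mpr ⟨z, by ring⟩
  · rw [Ideal.span_singleton_le_iff_mem]
    exact ⟨2, Ideal.mem_span_singleton.mpr ⟨d, by ring⟩⟩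

/-- If the class of `a` is a square in the function field of the smooth divisor `s = 0`, then it is
a square on the divisor. -/
theorem exists_eq_sq_add_mul_of_isSquare (k : Type u) [Field k] [Algebra k A] {s : A}
    [Algebra.Smooth k (A ⧸ Ideal.span {s})] {K : Type u} [Field K] (ev : A →+* K)
    (hev : RingHom.ker ev = Ideal.span {s}) (hK : ∀ z, ∃ u v, ev v ≠ 0 ∧ z * ev v = ev u) {a : A}
    (ha : IsSquare (ev a)) : ∃ w c, a = w ^ 2 + s * c := by
  obtain ⟨z, hz⟩ := ha
  obtain ⟨u, v, hv, huv⟩ := hK z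
  have : (Ideal.span {s}).IsPrime := hev ▸ RingHom.ker_isPrime ev
  have hmem (x : A) : Ideal.Quotient.mk (Ideal.span {s}) x = 0 ↔ ev x = 0 := by
    rw [Ideal.Quotient.eq_zero_iff_mem, ← hev, RingHom.mem_ker]
  have hv' : Ideal.Quotient.mk (Ideal.span {s}) v ≠ 0 := (hmem v).not.mpr hv
  have h : Ideal.Quotient.mk (Ideal.span {s}) u ^ 2 =
      Ideal.Quotient.mk (Ideal.span {s}) a * Ideal.Quotient.mk (Ideal.span {s}) v ^ 2 := by
    rw [← map_pow, ← map_pow, ← map_mul, ← sub_eq_zero, ← map_sub, hmem]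
    simp only [map_sub, map_mul, map_pow]
    rw [hz, ← huv]
    ring
  obtain ⟨w, hw⟩ := dvd_of_sq_eq_of_smooth k h (mem_nonZeroDivisors_of_ne_zero hv')
  obtain ⟨w, rfl⟩ := Ideal.Quotient.mk_surjective w
  have e : Ideal.Quotient.mk (Ideal.span {s}) (a - w ^ 2) = 0 := by
    refine (mul_eq_zero.mp ?_).resolve_right (pow_ne_zero 2 hv')
    rw [map_sub, map_pow, sub_mul, ← h, hw]
    ring
  obtain ⟨c, hc⟩ := Ideal.mem_span_singleton.mp (Ideal.Quotient.eq_zero_iff_mem.mp e)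
  exact ⟨w, c, by rw [← hc]; ring⟩

/-- Linear independence in the cotangent space, in terms of ideals. -/
theorem notMem_of_linearIndependent_cotangent {O : Type u} [CommRing O] [IsLocalRing O]
    {s t : O} (hs : s ∈ IsLocalRing.maximalIdeal O) (ht : t ∈ IsLocalRing.maximalIdeal O)
    (h : LinearIndependent (IsLocalRing.ResidueField O)
      ![(IsLocalRing.maximalIdeal O).toCotangent ⟨s, hs⟩,
        (IsLocalRing.maximalIdeal O).toCotangent ⟨t, ht⟩]) :
    s ∉ Ideal.span {t} ⊔ IsLocalRing.maximalIdeal O ^ 2 := by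
  intro hst
  obtain ⟨_, hx, y, hy, rfl⟩ := Submodule.mem_sup.mp hst
  obtain ⟨b, rfl⟩ := Ideal.mem_span_singleton.mp hx
  have e : (IsLocalRing.maximalIdeal O).toCotangent ⟨t * b + y, hs⟩ =
      IsLocalRing.residue O b • (IsLocalRing.maximalIdeal O).toCotangent ⟨t, ht⟩ := by
    refine Eq.trans ?_ (algebraMap_smul (IsLocalRing.ResidueField O) b _).symm
    rw [← map_smul, Ideal.toCotangent_eq]
    convert hy using 1
    simp only [Submodule.coe_smul, smul_eq_mul]
    ring
  refine one_ne_zero ((LinearIndependent.pair_iff.mp h 1 (-IsLocalRing.residue O b) ?_).1)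
  rw [one_smul, neg_smul, e, add_neg_cancel]

end ReducedDivisors

/-! ### Fibers of the resolved model -/

section Fibers

variable {B Y : Scheme.{u}} {φ : Y ⟶ B} {U : B.Opens} (hU : IsAffineOpen U)

theorem specMap_evaluation_fromSpec {p : B} (hp : p ∈ U) :
    Spec.map (B.evaluation U p hp) ≫ hU.fromSpec = B.fromSpecResidueField p := by
  rw [Scheme.evaluation, Spec.map_comp, Category.assoc, Scheme.fromSpecResidueField,
    ← hU.fromSpecStalk_eq_fromSpecStalk hp, IsAffineOpen.fromSpecStalk]

/-- The fiber over `p` is the resolved model over the residue field, with the values of the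
coefficients at `p`. -/
theorem isIsoOver_fiber {a₂ a₄ : Γ(B, U)} {e : resolvedModel a₂ a₄ ⟶ Y}
    (he : IsPullback e (resolvedModelToBase a₂ a₄) φ hU.fromSpec) {p : B} (hp : p ∈ U) :
    IsIsoOver (S := Spec (CommRingCat.of (B.residueField p))) (φ.fiberToSpecResidueField p)
      (resolvedModelToBase (B.evaluation U p hp a₂) (B.evaluation U p hp a₄)) := by
  obtain ⟨F, hF⟩ := exists_isPullback_resolvedModel (B.evaluation U p hp).hom a₂ a₄
  have H := hF.paste_horiz he
  have H' : IsPullback (φ.fiberι p) (φ.fiberToSpecResidueField p) φ (B.fromSpecResidueField p) :=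
    IsPullback.of_hasPullback _ _
  rw [← specMap_evaluation_fromSpec hU hp] at H'
  exact ⟨H'.isoIsPullback _ _ H, H'.isoIsPullback_hom_snd _ _ H⟩

end Fibers

/-! ### Points of affine open sets -/

section Points

variable {B : Scheme.{u}} {U : B.Opens} (hU : IsAffineOpen U)

theorem fromSpec_mem (y : PrimeSpectrum Γ(B, U)) : hU.fromSpec y ∈ U := by
  have : hU.fromSpec y ∈ Set.range hU.fromSpec := ⟨y, rfl⟩
  rwa [hU.range_fromSpec] at this

theorem primeIdealOf_fromSpec (y : PrimeSpectrum Γ(B, U)) :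
    hU.primeIdealOf ⟨hU.fromSpec y, fromSpec_mem hU y⟩ = y :=
  hU.fromSpec.isOpenEmbedding.injective (hU.fromSpec_primeIdealOf _)

theorem notMem_basicOpen_iff {p : B} (hp : p ∈ U) (f : Γ(B, U)) :
    p ∉ B.basicOpen f ↔ f ∈ (hU.primeIdealOf ⟨p, hp⟩).asIdeal := by
  rw [← not_iff_not, not_not]
  have h := hU.fromSpec_primeIdealOf ⟨p, hp⟩
  have : hU.primeIdealOf ⟨p, hp⟩ ∈ hU.fromSpec ⁻¹ᵁ B.basicOpen f ↔
      f ∉ (hU.primeIdealOf ⟨p, hp⟩).asIdeal := by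
    rw [hU.fromSpec_preimage_basicOpen]
    rfl
  rw [← this]
  change _ ↔ hU.fromSpec _ ∈ B.basicOpen f
  rw [h]

theorem notMem_basicOpen_iff_germ {p : B} (hp : p ∈ U) (f : Γ(B, U)) :
    p ∉ B.basicOpen f ↔
      B.presheaf.germ U p hp f ∈ IsLocalRing.maximalIdeal (B.presheaf.stalk p) := by
  rw [B.mem_basicOpen _ _ hp, IsLocalRing.mem_maximalIdeal, mem_nonunits_iff]

/-- At a generic point of a reduced divisor, its local equation generates the maximal ideal. -/
theorem maximalIdeal_stalk_eq {s : Γ(B, U)} (hs : (Ideal.span {s}).IsRadical) {p : B} (hp : p ∈ U)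
    (h : (hU.primeIdealOf ⟨p, hp⟩).asIdeal ∈ (Ideal.span {s}).minimalPrimes) :
    IsLocalRing.maximalIdeal (B.presheaf.stalk p) =
      Ideal.span {B.presheaf.germ U p hp s} := by
  let := B.presheaf.algebra_section_stalk ⟨p, hp⟩
  have := hU.isLocalization_stalk ⟨p, hp⟩
  exact maximalIdeal_eq_span_of_mem_minimalPrimes hs h

/-- The residue field at `p` consists of fractions of values at `p`. -/
theorem exists_mul_evaluation_eq (hU : IsAffineOpen U) {p : B} (hp : p ∈ U) (z : B.residueField p) :
    ∃ u v, B.evaluation U p hp v ≠ 0 ∧ z * B.evaluation U p hp v = B.evaluation U p hp u := by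
  let := B.presheaf.algebra_section_stalk ⟨p, hp⟩
  have := hU.isLocalization_stalk ⟨p, hp⟩
  obtain ⟨o, rfl⟩ := IsLocalRing.residue_surjective (R := B.presheaf.stalk p) z
  obtain ⟨⟨u, v⟩, h⟩ :=
    IsLocalization.surj (hU.primeIdealOf ⟨p, hp⟩).asIdeal.primeCompl o
  refine ⟨u, v, ?_, ?_⟩
  · rw [Ne, Scheme.evaluation_eq_zero_iff_notMem_basicOpen, notMem_basicOpen_iff hU hp]
    exact v.2
  · have := congrArg (IsLocalRing.residue (B.presheaf.stalk p)) h
    rw [map_mul] at this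
    exact this

theorem specializes_of_le {p : B} (hp : p ∈ U) {y : PrimeSpectrum Γ(B, U)}
    (h : y ≤ hU.primeIdealOf ⟨p, hp⟩) : hU.fromSpec y ⤳ p := by
  have := ((PrimeSpectrum.le_iff_specializes _ _).mp h).map hU.fromSpec.continuous
  rwa [hU.fromSpec_primeIdealOf ⟨p, hp⟩] at this

theorem primeIdealOf_le_of_specializes {p q : B} (hp : p ∈ U) (hq : q ∈ U) (h : q ⤳ p) :
    hU.primeIdealOf ⟨q, hq⟩ ≤ hU.primeIdealOf ⟨p, hp⟩ := by
  refine (PrimeSpectrum.le_iff_specializes _ _).mpr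
    (hU.fromSpec.isOpenEmbedding.isInducing.specializes_iff.mp ?_)
  rw [hU.fromSpec_primeIdealOf, hU.fromSpec_primeIdealOf]
  exact h

theorem subsingleton_of_not_nonempty (h : ¬ Nonempty U) : Subsingleton Γ(B, U) := by
  obtain rfl : U = ⊥ := by
    ext x
    exact ⟨fun hx => (h ⟨x, hx⟩).elim, fun hx => hx.elim⟩
  infer_instance

end Points

/-! ### Sections of line bundles -/

namespace LineBundle

variable {B : Scheme.{u}} {L : LineBundle B} {n : ℕ} {s : L.Family}

/-- Whether a section vanishes at a point can be tested in one trivialization. -/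
theorem IsSection.mem_zeroLocus_iff (hs : L.IsSection n s) {i : L.ι} {p : B}
    (hp : p ∈ (L.U i : B.Opens)) : p ∈ zeroLocus s ↔ p ∉ B.basicOpen (s i) := by
  refine ⟨fun h => h i hp, fun h j hj hpj => h ?_⟩
  have e := congrArg B.basicOpen (hs j i)
  rw [Scheme.basicOpen_res, Scheme.basicOpen_mul, Scheme.basicOpen_res,
    Scheme.basicOpen_of_isUnit _ ((L.g j i).isUnit.pow n)] at e
  have : p ∈ ((L.U j : B.Opens) ⊓ L.U i) ⊓ B.basicOpen (s j) := ⟨⟨hj, hp⟩, hpj⟩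
  rw [e] at this
  exact this.2.2

theorem isAffineOpen (L : LineBundle B) (i : L.ι) : IsAffineOpen (L.U i : B.Opens) := (L.U i).2

theorem exists_mem (L : LineBundle B) (p : B) : ∃ i, p ∈ (L.U i : B.Opens) := by
  have : p ∈ (⨆ i, (L.U i : B.Opens)) := by rw [L.cover]; trivial
  exact TopologicalSpace.Opens.mem_iSup.mp this

theorem IsSection.residualDisc {a₂ a₄ : L.Family} (h₂ : L.IsSection 2 a₂) (h₄ : L.IsSection 4 a₄) :
    L.IsSection 4 (residualDisc a₂ a₄) := by
  intro i j
  simp only [LineBundle.residualDisc, map_sub, map_mul, map_pow, map_ofNat]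
  rw [h₂ i j, h₄ i j]
  ring

/-- A nonzero section on an integral scheme defines an effective Cartier divisor. -/
theorem IsSection.isDivisor [IsIntegral B] (hs : L.IsSection n s) {i : L.ι} (hi : s i ≠ 0) :
    IsDivisor s := by
  intro j
  by_cases hj : Nonempty (L.U j : B.Opens)
  · have : Nonempty (L.U i : B.Opens) := by
      by_contra h
      have := subsingleton_of_not_nonempty h
      exact hi (Subsingleton.elim _ _)
    have hij : Nonempty ((L.U i : B.Opens) ⊓ L.U j : B.Opens) := by
      obtain ⟨⟨x, hx⟩⟩ := this
      obtain ⟨⟨y, hy⟩⟩ := hj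
      obtain ⟨z, hz⟩ := nonempty_preirreducible_inter (L.U i : B.Opens).2 (L.U j : B.Opens).2
        ⟨x, hx⟩ ⟨y, hy⟩
      exact ⟨z, hz⟩
    refine mem_nonZeroDivisors_of_ne_zero fun h => hi ?_
    have := hs i j
    rw [h, map_zero, mul_zero] at this
    exact (map_eq_zero_iff _ (map_injective_of_isIntegral B (homOfLE inf_le_left))).mp this
  · have := subsingleton_of_not_nonempty hj
    exact ⟨fun x _ => Subsingleton.elim _ _, fun x _ => Subsingleton.elim _ _⟩

/-- The generic points of the components of `V(s)` are the minimal primes of its local equation. -/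
theorem IsGenericPointOfComponent.mem_minimalPrimes (hs : L.IsSection n s) {η : B}
    (h : IsGenericPointOfComponent η (zeroLocus s)) {i : L.ι} (hη : η ∈ (L.U i : B.Opens)) :
    ((L.isAffineOpen i).primeIdealOf ⟨η, hη⟩).asIdeal ∈ (Ideal.span {s i}).minimalPrimes := by
  have key (y : PrimeSpectrum Γ(B, (L.U i : B.Opens))) :
      (L.isAffineOpen i).fromSpec y ∈ zeroLocus s ↔ Ideal.span {s i} ≤ y.asIdeal := by
    rw [hs.mem_zeroLocus_iff (fromSpec_mem _ y), notMem_basicOpen_iff (L.isAffineOpen i),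
      primeIdealOf_fromSpec, Ideal.span_singleton_le_iff_mem]
    exact fromSpec_mem _ y
  refine ⟨⟨((L.isAffineOpen i).primeIdealOf ⟨η, hη⟩).isPrime, ?_⟩, fun q hq hle => ?_⟩
  · rw [← key, (L.isAffineOpen i).fromSpec_primeIdealOf]
    exact h.1
  · have e := h.2 _ ((key ⟨q, hq.1⟩).mpr hq.2) (specializes_of_le (L.isAffineOpen i) hη hle)
    have := primeIdealOf_fromSpec (L.isAffineOpen i) ⟨q, hq.1⟩
    simp only [e] at this
    rw [this]

theorem isClosed_zeroLocus (s : L.Family) : IsClosed (zeroLocus s) := by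
  rw [← isOpen_compl_iff]
  have : (zeroLocus s)ᶜ = ⋃ i, (B.basicOpen (s i) : Set B) := by
    ext p
    simp only [zeroLocus, Set.mem_compl_iff, Set.mem_ofPred_eq, not_forall, not_not, Set.mem_iUnion]
    exact ⟨fun ⟨i, _, h⟩ => ⟨i, h⟩, fun ⟨i, h⟩ => ⟨i, B.basicOpen_le _ h, h⟩⟩
  rw [this]
  exact isOpen_iUnion fun i => (B.basicOpen (s i)).2

/-- If `V(s)` is irreducible, then a generic point of it specializes to all of its points. -/
theorem IsGenericPointOfComponent.specializes (hs : IsIrreducible (zeroLocus s)) {η p : B}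
    (h : IsGenericPointOfComponent η (zeroLocus s)) (hp : p ∈ zeroLocus s) : η ⤳ p := by
  obtain ⟨ξ, hξ⟩ := QuasiSober.sober hs (isClosed_zeroLocus s)
  have hξ' : ξ ∈ zeroLocus s := hξ.mem
  rw [← h.2 ξ hξ' (hξ.specializes h.1)]
  exact hξ.specializes hp

end LineBundle

/-! ### Smooth morphisms in affine charts -/

section SmoothCharts

variable {k : Type u} [Field k] {B : Scheme.{u}} {π : B ⟶ Spec (CommRingCat.of k)}

theorem exists_specMap_eq {U : B.Opens} (hU : IsAffineOpen U) (π : B ⟶ Spec (CommRingCat.of k)) :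
    ∃ c : k →+* Γ(B, U), Spec.map (CommRingCat.ofHom c) = hU.fromSpec ≫ π :=
  ⟨(Spec.preimage (hU.fromSpec ≫ π)).hom, Spec.map_preimage _⟩

theorem smooth_specMap_quotient_iff {U : B.Opens} (hU : IsAffineOpen U)
    [Algebra k Γ(B, U)]
    (hc : Spec.map (CommRingCat.ofHom (algebraMap k Γ(B, U))) = hU.fromSpec ≫ π) (s : Γ(B, U)) :
    Smooth (Spec.map (CommRingCat.ofHom (Ideal.Quotient.mk (Ideal.span {s}))) ≫ hU.fromSpec ≫ π) ↔
      Algebra.Smooth k (Γ(B, U) ⧸ Ideal.span {s}) := by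
  rw [← hc, ← Spec.map_comp, HasRingHomProperty.Spec_iff (P := @Smooth)]
  exact RingHom.smooth_algebraMap (R := k) (S := Γ(B, U) ⧸ Ideal.span {s})

end SmoothCharts

/-! ### The divisors `a₄ = 0` and `4a₄ = a₂²` -/

namespace LineBundle

variable {k : Type u} [Field k] {B : Scheme.{u}} {π : B ⟶ Spec (CommRingCat.of k)}
  {L : LineBundle B}

/-- A smooth zero scheme is reduced. -/
theorem IsSmoothZeroScheme.isRadical {s : L.Family} (h : IsSmoothZeroScheme π s) (i : L.ι) :
    (Ideal.span {s i}).IsRadical := by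
  obtain ⟨c, hc⟩ := exists_specMap_eq (L.isAffineOpen i) π
  let := c.toAlgebra
  have := (smooth_specMap_quotient_iff (L.isAffineOpen i) hc (s i)).mp (h i)
  rw [Ideal.isRadical_iff_quotient_reduced]
  exact isReduced_of_smooth k _

variable {a₂ a₄ : L.Family}

/-- The divisor `4a₄ = a₂²` is smooth if the total space of the resolved model is. -/
theorem isSmoothZeroScheme_residualDisc [NeZero (2 : k)] [Smooth π] {Y : Scheme.{u}} {φ : Y ⟶ B}
    (hY : IsResolvedModel a₂ a₄ φ) [Smooth (φ ≫ π)] :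
    IsSmoothZeroScheme π (residualDisc a₂ a₄) := by
  intro i
  obtain ⟨c, hc⟩ := exists_specMap_eq (L.isAffineOpen i) π
  let := c.toAlgebra
  refine (smooth_specMap_quotient_iff (L.isAffineOpen i) hc _).mpr ?_
  have : Algebra.Smooth k Γ(B, (L.U i : B.Opens)) := by
    have : Smooth (Spec.map (CommRingCat.ofHom c)) := by
      rw [hc]
      infer_instance
    rw [HasRingHomProperty.Spec_iff (P := @Smooth)] at this
    exact this
  have : Algebra.Smooth k (PlaneRing (chartTX (a₂ i) (a₄ i))) := by
    obtain ⟨e, he⟩ := hY i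
    have : IsOpenImmersion e := MorphismProperty.of_isPullback he.flip
      (inferInstanceAs (IsOpenImmersion (L.isAffineOpen i).fromSpec))
    have := (isGluing_resolvedModel (a₂ i) (a₄ i)).isOpenImmersion_left
    have H : Smooth (chartTXToModel (a₂ i) (a₄ i) ≫ e ≫ φ ≫ π) := inferInstance
    rw [he.w_assoc, ← Category.assoc, chartTXToModel_toBase] at H
    have hc' : (L.U i).2.fromSpec ≫ π = Spec.map (CommRingCat.ofHom c) := hc.symm
    rw [hc', planeChartToBase, ← Spec.map_comp, HasRingHomProperty.Spec_iff (P := @Smooth)] at H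
    refine (RingHom.smooth_algebraMap (R := k) (S := PlaneRing (chartTX (a₂ i) (a₄ i)))).mp ?_
    rw [IsScalarTower.algebraMap_eq k Γ(B, (L.U i : B.Opens))]
    exact H
  exact smooth_residual (a₂ i) (a₄ i)

theorem IsTransverseAt.notMem {s t : L.Family} {p : B} (h : IsTransverseAt s t p) {i : L.ι}
    (hp : p ∈ (L.U i : B.Opens)) : B.presheaf.germ (L.U i) p hp (s i) ∉
      Ideal.span {B.presheaf.germ (L.U i) p hp (t i)} ⊔
        IsLocalRing.maximalIdeal (B.presheaf.stalk p) ^ 2 := by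
  obtain ⟨hs, ht, h⟩ := h i hp
  exact notMem_of_linearIndependent_cotangent hs ht h

theorem IsTransverseAt.symm {s t : L.Family} {p : B} (h : IsTransverseAt s t p) :
    IsTransverseAt t s p := fun i hp =>
  let ⟨hs, ht, h⟩ := h i hp
  ⟨ht, hs, LinearIndependent.pair_symm_iff.mp h⟩

theorem exists_four_mul_eq_one [CharZero k] (π : B ⟶ Spec (CommRingCat.of k)) (i : L.ι) :
    ∃ q : Γ(B, (L.U i : B.Opens)), 4 * q = 1 := by
  obtain ⟨c, -⟩ := exists_specMap_eq (L.isAffineOpen i) π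
  refine ⟨c 4⁻¹, ?_⟩
  rw [← map_ofNat c, ← map_mul, mul_inv_cancel₀ (by norm_num), map_one]

/-- To first order, `4a₄ - a₂²` is proportional to `a₄` along `a₂ = 0`. -/
theorem germ_mem_span_residualDisc_sup [CharZero k] (π : B ⟶ Spec (CommRingCat.of k)) {i : L.ι}
    {p : B} (hp : p ∈ (L.U i : B.Opens)) (h₂ : p ∉ B.basicOpen (a₂ i)) :
    B.presheaf.germ (L.U i) p hp (a₄ i) ∈
      Ideal.span {B.presheaf.germ (L.U i) p hp (residualDisc a₂ a₄ i)} ⊔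
        IsLocalRing.maximalIdeal (B.presheaf.stalk p) ^ 2 := by
  obtain ⟨q, hq⟩ := exists_four_mul_eq_one (L := L) π i
  rw [notMem_basicOpen_iff_germ hp] at h₂
  have e : a₄ i = residualDisc a₂ a₄ i * q + q * a₂ i ^ 2 := by
    rw [residualDisc]
    linear_combination -a₄ i * hq
  rw [e, map_add, map_mul, map_mul, map_pow]
  exact Submodule.add_mem_sup (Ideal.mul_mem_right _ _ (Ideal.mem_span_singleton_self _))
    (Ideal.mul_mem_left _ _ (Ideal.pow_mem_pow h₂ 2))

theorem mem_zeroLocus_iff_evaluation {s : L.Family} {p : B} :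
    p ∈ zeroLocus s ↔
      ∀ (i : L.ι) (hp : p ∈ (L.U i : B.Opens)), B.evaluation (L.U i) p hp (s i) = 0 :=
  forall₂_congr fun _ _ => (Scheme.evaluation_eq_zero_iff_notMem_basicOpen _ _ _ _).symm

theorem disc_eq (i : L.ι) : disc a₂ a₄ i = 16 * a₄ i ^ 2 * (a₂ i ^ 2 - 4 * a₄ i) := by
  simp only [disc, weierstrass, WeierstrassCurve.Δ, WeierstrassCurve.b₂, WeierstrassCurve.b₄,
    WeierstrassCurve.b₆, WeierstrassCurve.b₈]
  ring

theorem invC4_eq (i : L.ι) : invC4 a₂ a₄ i = 16 * (a₂ i ^ 2 - 3 * a₄ i) := by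
  simp only [invC4, weierstrass, WeierstrassCurve.c₄, WeierstrassCurve.b₂, WeierstrassCurve.b₄]
  ring

theorem invC6_eq (i : L.ι) : invC6 a₂ a₄ i = -32 * a₂ i * (2 * a₂ i ^ 2 - 9 * a₄ i) := by
  simp only [invC6, weierstrass, WeierstrassCurve.c₆, WeierstrassCurve.b₂, WeierstrassCurve.b₄,
    WeierstrassCurve.b₆]
  ring

/-- `V(a₂)` contains no generic point of `V(a₄)`. -/
theorem notMem_zeroLocus_of_mem_minimalPrimes (h₄ : L.IsSection 4 a₄)
    (htrans : ∀ p ∈ zeroLocus a₂ ∩ zeroLocus a₄, IsTransverseAt a₂ a₄ p) {i : L.ι}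
    (hr : (Ideal.span {a₄ i}).IsRadical) {p : B} (hp : p ∈ (L.U i : B.Opens))
    (h : ((L.isAffineOpen i).primeIdealOf ⟨p, hp⟩).asIdeal ∈ (Ideal.span {a₄ i}).minimalPrimes) :
    p ∉ zeroLocus a₂ := by
  intro hp₂
  have hp₄ : p ∈ zeroLocus a₄ := by
    rw [h₄.mem_zeroLocus_iff hp, notMem_basicOpen_iff (L.isAffineOpen i) hp]
    exact h.1.2 (Ideal.mem_span_singleton_self _)
  refine (htrans p ⟨hp₂, hp₄⟩).notMem hp (Ideal.mem_sup_left ?_)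
  rw [← maximalIdeal_stalk_eq (L.isAffineOpen i) hr hp h]
  exact (notMem_basicOpen_iff_germ hp _).mp (hp₂ i hp)

/-- `V(a₂)` contains no generic point of `V(4a₄ - a₂²)`. -/
theorem notMem_zeroLocus_of_mem_minimalPrimes_residualDisc [CharZero k]
    (π : B ⟶ Spec (CommRingCat.of k)) (h₄ : L.IsSection 4 a₄)
    (htrans : ∀ p ∈ zeroLocus a₂ ∩ zeroLocus a₄, IsTransverseAt a₂ a₄ p) {i : L.ι}
    (hr : (Ideal.span {residualDisc a₂ a₄ i}).IsRadical) {p : B} (hp : p ∈ (L.U i : B.Opens))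
    (h : ((L.isAffineOpen i).primeIdealOf ⟨p, hp⟩).asIdeal ∈
      (Ideal.span {residualDisc a₂ a₄ i}).minimalPrimes) : p ∉ zeroLocus a₂ := by
  intro hp₂
  obtain ⟨q, hq⟩ := exists_four_mul_eq_one (L := L) π i
  have hm₂ := (notMem_basicOpen_iff_germ hp _).mp (hp₂ i hp)
  have hp₄ : p ∈ zeroLocus a₄ := by
    have hδ := h.1.2 (Ideal.mem_span_singleton_self _)
    have ha₂ := (notMem_basicOpen_iff (L.isAffineOpen i) hp _).mp (hp₂ i hp)
    rw [h₄.mem_zeroLocus_iff hp, notMem_basicOpen_iff (L.isAffineOpen i) hp]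
    have e : a₄ i = q * residualDisc a₂ a₄ i + q * a₂ i * a₂ i := by
      rw [residualDisc]
      linear_combination -a₄ i * hq
    rw [e]
    exact add_mem (Ideal.mul_mem_left _ _ hδ) (Ideal.mul_mem_left _ _ ha₂)
  refine (htrans p ⟨hp₂, hp₄⟩).notMem hp ?_
  -- the local equation `4a₄ - a₂²` generates the maximal ideal, and `a₂²` is of second order
  have hle : IsLocalRing.maximalIdeal (B.presheaf.stalk p) ≤
      Ideal.span {B.presheaf.germ (L.U i) p hp (a₄ i)} ⊔
        IsLocalRing.maximalIdeal (B.presheaf.stalk p) ^ 2 := by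
    conv_lhs => rw [maximalIdeal_stalk_eq (L.isAffineOpen i) hr hp h]
    rw [Ideal.span_singleton_le_iff_mem, residualDisc, map_sub, map_mul, map_pow]
    exact sub_mem (Ideal.mem_sup_left (Ideal.mul_mem_left _ _ (Ideal.mem_span_singleton_self _)))
      (Ideal.mem_sup_right (Ideal.pow_mem_pow hm₂ 2))
  exact hle hm₂

/-- The intersection form `t² = a₂` over the generic point of `V(a₄)` does not split: a square root
of `a₂` there would extend to a function `w` on `V(a₄)`, as `V(a₄)` is normal, and `a₂ = w²` would
have a double zero along `V(a₄)` at every point of `V(a₂) ∩ V(a₄)`. -/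
theorem not_isSquare_evaluation (h₄ : L.IsSection 4 a₄) (hirr : IsIrreducible (zeroLocus a₄))
    (hsmooth : IsSmoothZeroScheme π a₄) {η : B}
    (hη : IsGenericPointOfComponent η (zeroLocus a₄)) {p : B}
    (h : IsTransverseAt a₂ a₄ p) (hp₂ : p ∈ zeroLocus a₂) {i : L.ι}
    (hp : p ∈ (L.U i : B.Opens)) (hηi : η ∈ (L.U i : B.Opens)) :
    ¬ IsSquare (B.evaluation (L.U i) η hηi (a₂ i)) := by
  intro hsq
  obtain ⟨c, hc⟩ := exists_specMap_eq (L.isAffineOpen i) π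
  let := c.toAlgebra
  have := (smooth_specMap_quotient_iff (L.isAffineOpen i) hc (a₄ i)).mp (hsmooth i)
  have hmin := hη.mem_minimalPrimes h₄ hηi
  -- `V(a₄)` is reduced and irreducible, so `a₄` generates the prime ideal of `η`
  have hker : RingHom.ker (B.evaluation (L.U i) η hηi).hom = Ideal.span {a₄ i} := by
    have e : RingHom.ker (B.evaluation (L.U i) η hηi).hom =
        ((L.isAffineOpen i).primeIdealOf ⟨η, hηi⟩).asIdeal := by
      ext f
      rw [RingHom.mem_ker, ← notMem_basicOpen_iff]
      exact Scheme.evaluation_eq_zero_iff_notMem_basicOpen _ _ _ _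
    rw [e]
    refine le_antisymm ?_ hmin.1.2
    rw [← (hsmooth.isRadical i).radical, Ideal.radical_eq_sInf]
    refine le_sInf fun Q ⟨hQ, hQ'⟩ => ?_
    let y : PrimeSpectrum Γ(B, (L.U i : B.Opens)) := ⟨Q, hQ'⟩
    have hy : (L.isAffineOpen i).fromSpec y ∈ zeroLocus a₄ := by
      rw [h₄.mem_zeroLocus_iff (fromSpec_mem _ y), notMem_basicOpen_iff (L.isAffineOpen i),
        primeIdealOf_fromSpec]
      · exact hQ (Ideal.mem_span_singleton_self _)
      · exact fromSpec_mem _ y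
    have := primeIdealOf_le_of_specializes (L.isAffineOpen i) (fromSpec_mem _ y) hηi
      (hη.specializes hirr hy)
    rwa [primeIdealOf_fromSpec] at this
  obtain ⟨w, d, e⟩ := exists_eq_sq_add_mul_of_isSquare k (B.evaluation (L.U i) η hηi).hom hker
    (exists_mul_evaluation_eq (L.isAffineOpen i) hηi) hsq
  have hm₂ := (notMem_basicOpen_iff_germ hp _).mp (hp₂ i hp)
  obtain ⟨-, hm₄, -⟩ := h i hp
  refine h.notMem hp ?_
  have hw : B.presheaf.germ (L.U i) p hp w ∈ IsLocalRing.maximalIdeal (B.presheaf.stalk p) := by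
    refine Ideal.IsPrime.mem_of_pow_mem inferInstance 2 ?_
    have : w ^ 2 = a₂ i - a₄ i * d := by rw [e]; ring
    rw [← map_pow, this, map_sub, map_mul]
    exact sub_mem hm₂ (Ideal.mul_mem_right _ _ hm₄)
  rw [e, map_add, map_mul, map_pow]
  exact add_mem (Ideal.mem_sup_right (Ideal.pow_mem_pow hw 2))
    (Ideal.mem_sup_left (Ideal.mul_mem_right _ _ (Ideal.mem_span_singleton_self _)))

end LineBundle

end SO3

/-! ### Discriminant and fibers of SO(3)-models -/

theorem mainTheorem11
    (B : Scheme.{0}) [B.Over (Spec (CommRingCat.of ℂ))] [IsIntegral B]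
    [Smooth (B ↘ Spec (CommRingCat.of ℂ))] [IsSeparated (B ↘ Spec (CommRingCat.of ℂ))]
    [QuasiCompact (B ↘ Spec (CommRingCat.of ℂ))]
    (L : LineBundle B) (a₂ a₄ : L.Family)
    (ha₂ : L.IsSection 2 a₂) (ha₄ : L.IsSection 4 a₄)
    (hsmooth₂ : IsSmoothZeroScheme (B ↘ Spec (CommRingCat.of ℂ)) a₂)
    (hsmooth₄ : IsSmoothZeroScheme (B ↘ Spec (CommRingCat.of ℂ)) a₄)
    (hirr₂ : IsIrreducible (zeroLocus a₂))
    (hirr₄ : IsIrreducible (zeroLocus a₄))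
    (hmeet : (zeroLocus a₂ ∩ zeroLocus a₄).Nonempty)
    (htrans : ∀ p ∈ zeroLocus a₂ ∩ zeroLocus a₄,
      IsTransverseAt a₂ a₄ p)
    (Y : Scheme.{0}) (φ : Y ⟶ B) (hY : IsResolvedModel a₂ a₄ φ)
    (hYsmooth : Smooth (φ ≫ (B ↘ Spec (CommRingCat.of ℂ)))) :
    -- the reduced discriminant consists of the two smooth divisors
    (∀ i, (Ideal.span {disc a₂ a₄ i}).radical =
      Ideal.span {a₄ i * residualDisc a₂ a₄ i}) ∧
    (IsDivisor a₄ ∧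
      IsSmoothZeroScheme (B ↘ Spec (CommRingCat.of ℂ)) a₄) ∧
    (IsDivisor (residualDisc a₂ a₄) ∧
      IsSmoothZeroScheme (B ↘ Spec (CommRingCat.of ℂ))
        (residualDisc a₂ a₄)) ∧
    -- their intersection, the cuspidal locus, is nowhere transverse
    zeroLocus a₄ ∩
        zeroLocus (residualDisc a₂ a₄) =
      zeroLocus a₂ ∩ zeroLocus a₄ ∧
    zeroLocus (invC4 a₂ a₄) ∩
        zeroLocus (invC6 a₂ a₄) =
      zeroLocus a₂ ∩ zeroLocus a₄ ∧
    (∀ p ∈ zeroLocus a₂ ∩ zeroLocus a₄,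
      ¬ IsTransverseAt a₄ (residualDisc a₂ a₄) p) ∧
    -- the fibers over all points: smooth, I₂, I₁ or III
    (∀ p ∉ zeroLocus (disc a₂ a₄),
      Smooth (φ.fiberToSpecResidueField p)) ∧
    (∀ p ∈ zeroLocus a₄, p ∉ zeroLocus a₂ →
      IsTypeI2 (k := B.residueField p) (φ.fiberToSpecResidueField p)) ∧
    (∀ p ∈ zeroLocus (residualDisc a₂ a₄),
      p ∉ zeroLocus a₂ →
      IsTypeI1 (k := B.residueField p) (φ.fiberToSpecResidueField p)) ∧
    (∀ p ∈ zeroLocus a₂ ∩ zeroLocus a₄,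
      IsTypeIII (k := B.residueField p) (φ.fiberToSpecResidueField p)) ∧
    -- the generic fibers
    (∀ η, IsGenericPointOfComponent η (zeroLocus a₄) →
      IsTypeI2ns (k := B.residueField η) (φ.fiberToSpecResidueField η)) ∧
    (∀ η, IsGenericPointOfComponent η
        (zeroLocus (residualDisc a₂ a₄)) →
      IsTypeI1 (k := B.residueField η) (φ.fiberToSpecResidueField η)) := by
  set π := B ↘ Spec (CommRingCat.of ℂ)
  have hδsec := ha₂.residualDisc ha₄
  have hδsmooth : IsSmoothZeroScheme π (residualDisc a₂ a₄) := isSmoothZeroScheme_residualDisc hY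
  have hr₄ := hsmooth₄.isRadical
  have hrδ := hδsmooth.isRadical
  -- at a point `p₀` of `V(a₂) ∩ V(a₄)`, neither `a₄` nor `4a₄ - a₂²` vanishes to second order, so
  -- both are nonzero sections
  obtain ⟨p₀, hp₀⟩ := hmeet
  obtain ⟨i₀, hi₀⟩ := L.exists_mem p₀
  have hn₄ : B.presheaf.germ (L.U i₀) p₀ hi₀ (a₄ i₀) ∉
      IsLocalRing.maximalIdeal (B.presheaf.stalk p₀) ^ 2 := fun h =>
    (htrans p₀ hp₀).symm.notMem hi₀ (Ideal.mem_sup_right h)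
  have hdiv₄ : IsDivisor a₄ :=
    ha₄.isDivisor (i := i₀) fun h => hn₄ (by rw [h, map_zero]; exact zero_mem _)
  have hdivδ : IsDivisor (residualDisc a₂ a₄) := hδsec.isDivisor (i := i₀) fun h => by
    have := germ_mem_span_residualDisc_sup (a₂ := a₂) (a₄ := a₄) π hi₀ (hp₀.1 i₀ hi₀)
    rw [h, map_zero, Ideal.span_singleton_zero, bot_sup_eq] at this
    exact hn₄ this
  have hfib {i : L.ι} {p : B} (hp : p ∈ (L.U i : B.Opens)) :
      IsIsoOver (S := Spec (CommRingCat.of (B.residueField p))) (φ.fiberToSpecResidueField p)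
        (resolvedModelToBase (B.evaluation (L.U i) p hp (a₂ i))
          (B.evaluation (L.U i) p hp (a₄ i))) := by
    obtain ⟨e, he⟩ := hY i
    exact isIsoOver_fiber (L.isAffineOpen i) he hp
  have hchar (p : B) : CharZero (B.residueField p) := by
    obtain ⟨i, hi⟩ := L.exists_mem p
    obtain ⟨c, -⟩ := exists_specMap_eq (L.isAffineOpen i) π
    exact charZero_of_injective_ringHom ((B.evaluation (L.U i) p hi).hom.comp c).injective
  have hinter : zeroLocus a₄ ∩ zeroLocus (residualDisc a₂ a₄) = zeroLocus a₂ ∩ zeroLocus a₄ := by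
    ext p
    have := hchar p
    simp only [Set.mem_inter_iff, mem_zeroLocus_iff_evaluation, residualDisc, map_sub, map_mul,
      map_pow, map_ofNat, ← forall_and]
    refine forall₂_congr fun i hp => ?_
    constructor
    · rintro ⟨h₄, hδ⟩
      rw [h₄, mul_zero, zero_sub, neg_eq_zero] at hδ
      exact ⟨pow_eq_zero_iff two_ne_zero |>.mp hδ, h₄⟩
    · rintro ⟨h₂, h₄⟩
      refine ⟨h₄, ?_⟩
      rw [h₂, h₄]
      ring
  have hcusp : zeroLocus (invC4 a₂ a₄) ∩ zeroLocus (invC6 a₂ a₄) =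
      zeroLocus a₂ ∩ zeroLocus a₄ := by
    ext p
    have := hchar p
    simp only [Set.mem_inter_iff, mem_zeroLocus_iff_evaluation, invC4_eq, invC6_eq, map_sub,
      map_mul, map_neg, map_pow, map_ofNat, ← forall_and]
    refine forall₂_congr fun i hp => ?_
    set b₂ := B.evaluation (L.U i) p hp (a₂ i)
    set b₄ := B.evaluation (L.U i) p hp (a₄ i)
    constructor
    · rintro ⟨h, h'⟩
      have h : b₂ ^ 2 - 3 * b₄ = 0 := (mul_eq_zero.mp h).resolve_left (by norm_num)
      have h₂ : b₂ = 0 := by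
        rcases mul_eq_zero.mp h' with h' | h'
        · exact (mul_eq_zero.mp h').resolve_left (by norm_num)
        · exact pow_eq_zero_iff two_ne_zero |>.mp (by linear_combination 3 * h - h')
      rw [h₂] at h
      refine ⟨h₂, (mul_eq_zero.mp (?_ : (3 : B.residueField p) * b₄ = 0)).resolve_left
        (by norm_num)⟩
      linear_combination -h
    · rintro ⟨h₂, h₄⟩
      rw [h₂, h₄]
      exact ⟨by ring, by ring⟩
  have hI1 : ∀ p ∈ zeroLocus (residualDisc a₂ a₄), p ∉ zeroLocus a₂ →
      IsTypeI1 (k := B.residueField p) (φ.fiberToSpecResidueField p) := by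
    intro p hp hp₂
    simp only [zeroLocus, Set.mem_ofPred_eq, not_forall, not_not] at hp₂
    obtain ⟨i, hi, h⟩ := hp₂
    rw [← Scheme.evaluation_ne_zero_iff_mem_basicOpen _ _ hi] at h
    have hδ := mem_zeroLocus_iff_evaluation.mp hp i hi
    rw [residualDisc, map_sub, map_mul, map_pow, map_ofNat] at hδ
    exact isTypeI1_of_isIsoOver (hfib hi) h hδ
  refine ⟨?_, ⟨hdiv₄, hsmooth₄⟩, ⟨hdivδ, hδsmooth⟩, hinter, hcusp, ?_, ?_, ?_, hI1, ?_, ?_, ?_⟩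
  · intro i
    have h : disc a₂ a₄ i = a₄ i ^ 2 * residualDisc a₂ a₄ i * (-16) := by
      rw [disc_eq, residualDisc]
      ring
    obtain ⟨q, hq⟩ := exists_four_mul_eq_one (L := L) π i
    have hu : IsUnit (-16 : Γ(B, (L.U i : B.Opens))) :=
      IsUnit.of_mul_eq_one (-q ^ 2) (by linear_combination (4 * q + 1) * hq)
    rw [h, Ideal.span_singleton_mul_right_unit hu]
    -- `4a₄ - a₂²` vanishes at no generic point of `V(a₄)`, as it agrees with `-a₂²` there
    refine radical_span_sq_mul (hr₄ i) (hrδ i) fun x hx =>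
      mem_of_mul_mem_of_notMem_minimalPrimes (hr₄ i) (fun P hP hδ => ?_) hx
    let y : PrimeSpectrum Γ(B, (L.U i : B.Opens)) := ⟨P, hP.1.1⟩
    have hy := fromSpec_mem (L.isAffineOpen i) y
    have hPy := primeIdealOf_fromSpec (L.isAffineOpen i) y
    refine notMem_zeroLocus_of_mem_minimalPrimes ha₄ htrans (hr₄ i) hy (by rw [hPy]; exact hP) ?_
    rw [ha₂.mem_zeroLocus_iff hy, notMem_basicOpen_iff (L.isAffineOpen i) hy, hPy]
    refine hP.1.1.mem_of_pow_mem 2 ?_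
    have e : a₂ i ^ 2 = 4 * a₄ i - residualDisc a₂ a₄ i := by
      rw [residualDisc]
      ring
    rw [e]
    exact sub_mem (Ideal.mul_mem_left _ _ (hP.1.2 (Ideal.mem_span_singleton_self _))) hδ
  · intro p hp h
    obtain ⟨i, hi⟩ := L.exists_mem p
    exact (h.notMem hi) (germ_mem_span_residualDisc_sup π hi (hp.1 i hi))
  · intro p hp
    simp only [zeroLocus, Set.mem_ofPred_eq, not_forall, not_not] at hp
    obtain ⟨i, hi, h⟩ := hp
    rw [disc_eq, ← Scheme.evaluation_ne_zero_iff_mem_basicOpen _ _ hi] at h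
    have := smooth_resolvedModelToBase (a₂ := B.evaluation (L.U i) p hi (a₂ i))
      (a₄ := B.evaluation (L.U i) p hi (a₄ i)) fun h0 => h (by
        simp only [map_mul, map_pow, map_sub, map_ofNat]
        linear_combination (16 * B.evaluation (L.U i) p hi (a₄ i)) * h0)
    exact (hfib hi).smooth
  · intro p hp₄ hp₂
    simp only [zeroLocus, Set.mem_ofPred_eq, not_forall, not_not] at hp₂
    obtain ⟨i, hi, h⟩ := hp₂
    rw [← Scheme.evaluation_ne_zero_iff_mem_basicOpen _ _ hi] at h
    have h₄ := (Scheme.evaluation_eq_zero_iff_notMem_basicOpen _ _ hi _).mpr (hp₄ i hi)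
    have H := hfib hi
    rw [h₄] at H
    exact isTypeI2_of_isIsoOver H h
  · intro p hp
    obtain ⟨i, hi⟩ := L.exists_mem p
    have h₂ := (Scheme.evaluation_eq_zero_iff_notMem_basicOpen _ _ hi _).mpr (hp.1 i hi)
    have h₄ := (Scheme.evaluation_eq_zero_iff_notMem_basicOpen _ _ hi _).mpr (hp.2 i hi)
    have H := hfib hi
    rw [h₂, h₄] at H
    exact isTypeIII_of_isIsoOver H
  · intro η hη
    -- `η` specializes to `p₀`, so it lies in every chart around `p₀`
    have hηi : η ∈ (L.U i₀ : B.Opens) :=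
      (hη.specializes hirr₄ hp₀.2).mem_open (L.U i₀ : B.Opens).2 hi₀
    have h₄ := (Scheme.evaluation_eq_zero_iff_notMem_basicOpen _ _ hηi _).mpr (hη.1 i₀ hηi)
    have H := hfib hηi
    rw [h₄] at H
    exact isTypeI2ns_of_isIsoOver H
      (not_isSquare_evaluation ha₄ hirr₄ hsmooth₄ hη (htrans p₀ hp₀) hp₀.1 hi₀ hηi)
  · intro η hη
    obtain ⟨i, hi⟩ := L.exists_mem η
    exact hI1 η hη.1 (notMem_zeroLocus_of_mem_minimalPrimes_residualDisc π ha₄ htrans (hrδ i) hi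
      (hη.mem_minimalPrimes hδsec hi))
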